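/- **Construction.** Let $N_0,N$ be integers with $0<N_0<N$, let $[N]=\{0,1,\dots,N-1\}$, and let $\Sigma$ be a non-empty collection of subsets of $[N]$ of cardinality $N_0$. Put $A_0=\{1\}$ and, for $k\ge 0$, choose for each $a\in A_k$ a set $S_{k+1,a}\in\Sigma$ and let $$A_{k+1}=\bigcup_{a\in A_k}\big(a+N^{-k-1}S_{k+1,a}\big),\qquad E_k=A_k+[0,N^{-k}].$$ Let $\mu$ be the weak limit of the probability measures $|E_k|^{-1}\mathbf 1_{E_k}\,dx$, a probability measure on $\bigcap_k E_k\subset[1,2]$, and let $\alpha=\log N_0/\log N$. The construction is *self-similar* if all the sets $S_{k+1,a}$ are equal to one fixed $S\in\Sigma$. Given $p\in[2,\infty)$ and real constants $c_0>0$, $c_1$, $C$, we say that $\mu$ is a *$\Lambda(p)$ Cantor measure* (with base $N$ and constants $c_0,c_1,C$) if every $S\in\Sigma$ satisfies $S\subset\{0,\dots,N-2\}$, $\;c_0N^{2/p}\le |S|\le c_1N^{2/p}$, and $$\Big\|\sum_{a\in S}c_ae^{2\pi i a x}\Big\|_{L^p([0,1])}\le C\Big(\sum_{a\in S}|c_a|^2\Big)^{1/2}\quad\text{for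 all }(c_a)_{a\in S}\subset\mathbb C .$$ Write $\mathcal A_tf(x)=\int f(x-ty)\,d\mu(y)$, $\widehat f(\xi)=\int e^{-2\pi i x\xi}f(x)\,dx$, $\widehat\mu(\xi)=\int e^{-2\pi i x\xi}\,d\mu(x)$, let $^\vee$ be the inverse Fourier transform in $x$, and let $\mathcal S$ be the class of complex-valued Schwartz functions on $\mathbb R$. **Theorem.** Fix $2\le p<\infty$ and real constants $c_0>0$, $c_1$, $C$. (i) For every $r$ with $p<r<\infty$ there is $N_1$ such that for every $N\ge N_1$ there is a constant $K$ such that for every $\Lambda(p)$ Cantor measure $\mu$ with base $N$ and constants $c_0,c_1,C$, and every $f\in\mathcal S$, $$\Big\|\,\|\mathcal A_tf(x)\|_{L^r([1,2],dt)}\Big\|_{L^p(\mathbb R,dx)}\le K\|f\|_p .$$ (ii) For every $\eta>0$ there is $N_1$ such that for every $N\ge N_1$ and every $\gamma\in\mathbb R$ there is a constant $K$ such that for every $\Lambda(p)$ Cantor measure $\mu$ with base $N$ and constants $c_0,c_1,C$ for which $\gamma\le \frac{\alpha}{2}-\eta$, and every $f\in\mathcal S$, $$\Big\|\Big[(1+|\xi|^2)^{\gamma/2}\,\widehat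 f(\xi)\,\widehat\mu(t\xi)\Big]^\vee\Big\|_{L^p(\mathbb R_x\times[1,2]_t)}\le K\|f\|_p .$$ (iii) In contrast, there is no Sobolev gain at a fixed time in the self-similar case: if $\mu$ is a $\Lambda(p)$ Cantor measure (with any base $N$ and constants $c_0,c_1,C$) given by a self-similar construction, then for no $\gamma>0$ and $t>0$ is there a constant $K$ with $$\Big\|\Big[(1+|\xi|^2)^{\gamma/2}\,\widehat f(\xi)\,\widehat\mu(t\xi)\Big]^\vee\Big\|_{L^p(\mathbb R_x)}\le K\|f\|_p\quad\text{for all } f\in\mathcal S .$$ -/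

import Mathlib

open MeasureTheory Filter
open scoped Topology FourierTransform ENNReal

noncomputable section

namespace LambdaCantor

/-- The data of the Cantor construction with base `N`: the number of digits `N₀` with `0 < N₀ < N`,
a non-empty collection `Sigma` of digit sets `S ⊆ {0, …, N - 1}` of cardinality `N₀`, and, for
every level `k` and every left endpoint `a` of a level-`k` interval, the digit set
`choice k a ∈ Sigma` used to subdivide the interval `[a, a + N⁻ᵏ]`.
(The values of `choice k a` at points `a` that are not level-`k` endpoints play no role.) -/
structure Construction (N : ℕ) where
  N₀ : ℕ
  N₀_pos : 0 < N₀
  N₀_lt : N₀ < N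
  Sigma : Set (Finset ℕ)
  Sigma_nonempty : Sigma.Nonempty
  digits_lt : ∀ S ∈ Sigma, ∀ s ∈ S, s < N
  card_eq : ∀ S ∈ Sigma, S.card = N₀
  choice : ℕ → ℝ → Finset ℕ
  choice_mem : ∀ k a, choice k a ∈ Sigma

namespace Construction

variable {N : ℕ} (D : Construction N)

/-- The left endpoints: `A₀ = {1}` and `Aₖ₊₁ = ⋃_{a ∈ Aₖ} (a + N⁻⁽ᵏ⁺¹⁾ S_{k+1,a})`. -/
def A : ℕ → Set ℝ
  | 0 => {1}
  | k + 1 => ⋃ a ∈ A k, {x | ∃ s ∈ D.choice k a, x = a + (s : ℝ) / (N : ℝ) ^ (k + 1)}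

/-- `Eₖ = Aₖ + [0, N⁻ᵏ]`. -/
def E (k : ℕ) : Set ℝ :=
  ⋃ a ∈ D.A k, Set.Icc a (a + 1 / (N : ℝ) ^ k)

/-- The absolutely continuous probability measure with density `|Eₖ|⁻¹ 1_{Eₖ}`. -/
def approxMeasure (k : ℕ) : Measure ℝ :=
  (volume (D.E k))⁻¹ • volume.restrict (D.E k)

/-- `μ` is the natural probability measure on the Cantor set `⋂ₖ Eₖ`: the weak limit of the
measures `|Eₖ|⁻¹ 1_{Eₖ} dx`. -/
structure IsCantorMeasure (μ : Measure ℝ) : Prop where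
  prob : IsProbabilityMeasure μ
  weak_limit : ∀ g : BoundedContinuousFunction ℝ ℝ,
    Tendsto (fun k => ∫ x, g x ∂(D.approxMeasure k)) atTop (𝓝 (∫ x, g x ∂μ))

/-- The dimension `α = log N₀ / log N`. -/
def alpha : ℝ := Real.log D.N₀ / Real.log N

/-- The self-similar case: one digit set is used at all steps. -/
def IsSelfSimilar : Prop :=
  ∃ S ∈ D.Sigma, ∀ k, ∀ a ∈ D.A k, D.choice k a = S

end Construction

/-- `S` is a `Λ(p)` set in `{0, …, N - 2}` with constants `c₀, c₁, C`: one has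
`c₀ N^{2/p} ≤ |S| ≤ c₁ N^{2/p}` and
`‖∑_{a ∈ S} c_a e^{2πi a x}‖_{L^p([0,1])} ≤ C (∑_{a ∈ S} |c_a|²)^{1/2}` for all coefficients. -/
structure IsLambdaSet (p c₀ c₁ C : ℝ) (N : ℕ) (S : Finset ℕ) : Prop where
  lt : ∀ s ∈ S, s + 1 < N
  card_ge : c₀ * (N : ℝ) ^ (2 / p) ≤ S.card
  card_le : (S.card : ℝ) ≤ c₁ * (N : ℝ) ^ (2 / p)
  norm_le : ∀ c : ℕ → ℂ,
    eLpNorm (fun x : ℝ => ∑ a ∈ S, c a * Complex.exp (2 * Real.pi * Complex.I * a * x))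
        (ENNReal.ofReal p) (volume.restrict (Set.Icc 0 1))
      ≤ ENNReal.ofReal (C * Real.sqrt (∑ a ∈ S, ‖c a‖ ^ 2))

/-- `μ` is the `Λ(p)` Cantor measure produced by the construction `D`, all of whose digit sets are
`Λ(p)` sets with constants `c₀, c₁, C`. -/
def IsLambdaCantorMeasure (p c₀ c₁ C : ℝ) {N : ℕ} (D : Construction N) (μ : Measure ℝ) : Prop :=
  (∀ S ∈ D.Sigma, IsLambdaSet p c₀ c₁ C N S) ∧ D.IsCantorMeasure μ

/-- The averages `𝒜_t f(x) = ∫ f(x - t y) dμ(y)`. -/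
def avg (μ : Measure ℝ) (f : SchwartzMap ℝ ℂ) (t x : ℝ) : ℂ :=
  ∫ y, f (x - t * y) ∂μ

/-- `μ̂(ξ) = ∫ e^{-2πi y ξ} dμ(y)`. -/
def fourierMeasure (μ : Measure ℝ) (ξ : ℝ) : ℂ :=
  ∫ y : ℝ, Complex.exp (-2 * Real.pi * Complex.I * y * ξ) ∂μ

/-- `[(1 + |ξ|²)^{γ/2} f̂(ξ) μ̂(tξ)]^∨ (x)`, that is, `(1 - Δ)^{γ/2} 𝒜_t f (x)` with the
normalization of the Laplacian for which `-Δ` has symbol `|ξ|²`. -/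
def sobolevAvg (γ : ℝ) (μ : Measure ℝ) (f : SchwartzMap ℝ ℂ) (t x : ℝ) : ℂ :=
  𝓕⁻ (fun ξ : ℝ =>
    (((1 + ξ ^ 2) ^ (γ / 2) : ℝ) : ℂ) * 𝓕 (f : ℝ → ℂ) ξ * fourierMeasure μ (t * ξ)) x

end LambdaCantor

end

/-! Parts (i) and (ii). Cut `f` into pieces with frequencies within `3|ξ₀|/N` of `ξ₀ = ±(1 +
1/N)^n`, plus a low-frequency piece, and replace `μ` by normalized sums over the level-`m` left
endpoints, which form a tree with `N₀` children at each node. Fix a node `a` of level `j` and shear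
`x` to `x + a t`. As functions of `t`, the terms that descend from the child with digit `s` have
frequencies within `O(|w|)` of `-s w`, where `w = ξ₀ / N^(j+1)`. Translating `t` by `δ / w`
therefore multiplies the contribution of this child essentially by `e^{2πi s δ}`; averaging over `δ
∈ [0, 1]` and using the `Λ(p)` inequality in `δ` separates the children (`IsLambdaSet.decoupling`).
In the `p`-th power of the norm one generation costs a constant times `N₀^{p/2}`, whereas the
triangle inequality costs `N₀^p`.

This works for the `k` generations with `N^k ≤ |ξ₀|` (`localNorm_succ_le`, `localNorm_le`); later
generations are treated trivially. After normalization the gain is `(b N₀^{-1/2})^k` with `b`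
independent of `N`. Since `N₀ = N^α`, this is about `|ξ₀|^{-α/2}`, up to `b^k ≤ |ξ₀|^{η/2}` when `N`
is large (`gain_le`). The Bessel weight costs `|ξ₀|^γ` and the passage from `L^p` to `L^r` in time
costs `|ξ₀|^{1/p - 1/r}` (Nikolskii), so the pieces sum geometrically when `γ + 1/p - 1/r ≤ α/2 - η`
(`exists_mixNorm_sobolevAvg_le`). Part (ii) is the case `r = p`. Part (i) is the case `γ = 0`: the
cardinality of the digit sets makes `α/2` close to `1/p`, which leaves a margin close to `1/r`.

Part (iii). An `L^p` multiplier norm dominates the supremum of its symbol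
(`norm_symbol_le_of_eLpNorm_le`). In the self-similar case `μ̂(N n) = μ̂(n)` for integers `n`, and
some `μ̂(n)` with `n ≠ 0` does not vanish: otherwise `μ` would project to Haar measure on the
circle, but the unused digit `N - 1` leaves a gap. So the symbol grows like `|ξ|^γ` along `ξ = N^k n
/ t`. -/

noncomputable section

namespace LambdaCantor

/-! ### Characters and convolution inequalities. -/

/-- The character `e^{2πi x}`. -/
def ec (x : ℝ) : ℂ := Complex.exp (2 * Real.pi * Complex.I * x)

lemma ec_zero : ec 0 = 1 := by simp [ec]

lemma ec_add (x y : ℝ) : ec (x + y) = ec x * ec y := by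
  rw [ec, ec, ec, ← Complex.exp_add]; push_cast; ring_nf

lemma ec_eq (x : ℝ) : ec x = Complex.exp ((2 * Real.pi * x : ℝ) * Complex.I) := by
  rw [ec]; push_cast; ring_nf

@[simp] lemma norm_ec (x : ℝ) : ‖ec x‖ = 1 := by
  rw [ec_eq, Complex.norm_exp_ofReal_mul_I]

@[simp] lemma enorm_ec (x : ℝ) : ‖ec x‖ₑ = 1 := by
  rw [← ofReal_norm, norm_ec, ENNReal.ofReal_one]

@[fun_prop] lemma continuous_ec : Continuous ec := by
  unfold ec; fun_prop

lemma ec_mul_neg (x : ℝ) : ec x * ec (-x) = 1 := by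
  rw [← ec_add, add_neg_cancel, ec_zero]

lemma ec_int (n : ℤ) : ec n = 1 := by
  rw [ec]
  have := Complex.exp_int_mul_two_pi_mul_I n
  rw [← this]; congr 1; push_cast; ring

lemma norm_ec_sub_le (x y : ℝ) : ‖ec x - ec y‖ ≤ 2 * Real.pi * |x - y| := by
  have h : ec x - ec y = ec y * (ec (x - y) - 1) := by
    rw [mul_sub, ← ec_add]; ring_nf
  rw [h, norm_mul, norm_ec, one_mul, ec_eq, mul_comm _ Complex.I]
  refine (Real.norm_exp_I_mul_ofReal_sub_one_le).trans (le_of_eq ?_)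
  rw [Real.norm_eq_abs, abs_mul, abs_of_pos Real.two_pi_pos]

/-- Jensen's inequality for a finite weight. -/
lemma rpow_lintegral_mul_le {α : Type*} [MeasurableSpace α] (ν : Measure α) {p : ℝ} (hp : 1 < p)
    {G q : α → ℝ≥0∞} (hG : AEMeasurable G ν) (hq : AEMeasurable q ν) :
    (∫⁻ u, G u * q u ∂ν) ^ p ≤ (∫⁻ u, G u ∂ν) ^ (p - 1) * ∫⁻ u, G u * q u ^ p ∂ν := by
  have hp0 : 0 < p := by linarith
  have hpq := Real.HolderConjugate.conjExponent hp
  set p' := Real.conjExponent p with hp'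
  have hp'0 : 0 < p' := hpq.symm.pos
  have h1 : ∀ u, G u * q u = G u ^ (1 / p') * (G u ^ (1 / p) * q u) := by
    intro u
    rw [← mul_assoc, ← ENNReal.rpow_add_of_nonneg _ _ (by positivity) (by positivity)]
    have := hpq.inv_add_inv_eq_one
    rw [show 1 / p' + 1 / p = 1 by rw [one_div, one_div, add_comm]; exact this, ENNReal.rpow_one]
  have h2 := ENNReal.lintegral_mul_le_Lp_mul_Lq ν hpq.symm (hG.pow_const (1 / p'))
    ((hG.pow_const (1 / p)).mul hq)
  have h3 : ∫⁻ u, G u * q u ∂ν ≤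
      (∫⁻ u, G u ∂ν) ^ (1 / p') * (∫⁻ u, G u * q u ^ p ∂ν) ^ (1 / p) := by
    calc ∫⁻ u, G u * q u ∂ν = ∫⁻ u, G u ^ (1 / p') * (G u ^ (1 / p) * q u) ∂ν := by
          simp_rw [← h1]
      _ ≤ _ := h2
      _ = _ := by
        congr 3
        · funext u
          rw [← ENNReal.rpow_mul, one_div_mul_cancel hp'0.ne', ENNReal.rpow_one]
        · funext u
          simp only [Pi.mul_apply]
          rw [ENNReal.mul_rpow_of_nonneg _ _ hp0.le, ← ENNReal.rpow_mul,
            one_div_mul_cancel hp0.ne', ENNReal.rpow_one]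
  calc (∫⁻ u, G u * q u ∂ν) ^ p
      ≤ ((∫⁻ u, G u ∂ν) ^ (1 / p') * (∫⁻ u, G u * q u ^ p ∂ν) ^ (1 / p)) ^ p := by gcongr
    _ = _ := by
      rw [ENNReal.mul_rpow_of_nonneg _ _ hp0.le, ← ENNReal.rpow_mul, ← ENNReal.rpow_mul,
        one_div_mul_cancel hp0.ne', ENNReal.rpow_one]
      congr 2
      have := hpq.sub_one_mul_conj
      field_simp
      linarith

/-- Young's inequality `‖k * f‖_p ≤ ‖k‖₁ ‖f‖_p` for nonnegative functions. -/
lemma lintegral_rpow_lconvolution_le {p : ℝ} (hp : 1 < p) {k f : ℝ → ℝ≥0∞} (hk : Measurable k)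
    (hf : Measurable f) :
    ∫⁻ x, (∫⁻ u, k u * f (x - u)) ^ p ≤ (∫⁻ u, k u) ^ p * ∫⁻ x, f x ^ p := by
  have hp0 : 0 < p := by linarith
  calc ∫⁻ x, (∫⁻ u, k u * f (x - u)) ^ p
      ≤ ∫⁻ x, (∫⁻ u, k u) ^ (p - 1) * ∫⁻ u, k u * f (x - u) ^ p := by
        refine lintegral_mono fun x => rpow_lintegral_mul_le _ hp hk.aemeasurable ?_
        exact (hf.comp (measurable_const.sub measurable_id)).aemeasurable
    _ = (∫⁻ u, k u) ^ (p - 1) * ∫⁻ x, ∫⁻ u, k u * f (x - u) ^ p := by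
        rw [lintegral_const_mul]
        refine Measurable.lintegral_prod_right' (f := fun z : ℝ × ℝ => k z.2 * f (z.1 - z.2) ^ p) ?_
        exact (hk.comp measurable_snd).mul
          ((hf.comp (measurable_fst.sub measurable_snd)).pow_const p)
    _ = (∫⁻ u, k u) ^ (p - 1) * ∫⁻ u, ∫⁻ x, k u * f (x - u) ^ p := by
        rw [lintegral_lintegral_swap]
        exact ((hk.comp measurable_snd).mul
          ((hf.comp (measurable_fst.sub measurable_snd)).pow_const p)).aemeasurable
    _ = (∫⁻ u, k u) ^ (p - 1) * ((∫⁻ u, k u) * ∫⁻ x, f x ^ p) := by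
        congr 1
        rw [← lintegral_mul_const _ hk]
        refine lintegral_congr fun u => ?_
        have hfu : Measurable fun x => f (x - u) := hf.comp (measurable_id.sub_const u)
        rw [lintegral_const_mul _ (hfu.pow_const p),
          lintegral_sub_right_eq_self (fun x => f x ^ p) u]
    _ = _ := by
        rw [← mul_assoc]
        congr 1
        conv_lhs => rw [← ENNReal.rpow_one (∫⁻ u, k u)]
        rw [← ENNReal.rpow_mul, one_mul,
          ← ENNReal.rpow_add_of_nonneg _ _ (by linarith) zero_le_one]
        ring_nf

/-! ### Decoupling from the `Λ(p)` inequality. -/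

/-- The bounded continuous function `h` is reproduced by convolution with `w Φ(w ·)`. -/
structure Reproduced (Φ : ℝ → ℂ) (w : ℝ) (h : ℝ → ℂ) : Prop where
  cont : Continuous h
  bdd : ∃ M, ∀ t, ‖h t‖ ≤ M
  eq : ∀ t, h t = ∫ u, Φ u * h (t - u / w)

/-- The `Λ(p)` inequality in integral form. -/
lemma IsLambdaSet.lintegral_le {p c₀ c₁ C : ℝ} (hp : 2 ≤ p) {N : ℕ} {S : Finset ℕ}
    (hS : IsLambdaSet p c₀ c₁ C N S) (c : ℕ → ℂ) :
    ∫⁻ δ in Set.Icc (0 : ℝ) 1, ‖∑ s ∈ S, c s * ec (s * δ)‖ₑ ^ p ≤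
      ENNReal.ofReal C ^ p * (S.card : ℝ≥0∞) ^ (p / 2 - 1) * ∑ s ∈ S, ‖c s‖ₑ ^ p := by
  have hp0 : 0 < p := by linarith
  have h1 := hS.norm_le c
  rw [eLpNorm_eq_lintegral_rpow_enorm_toReal (by simpa using hp0) ENNReal.ofReal_ne_top,
    ENNReal.toReal_ofReal hp0.le] at h1
  have h2 := ENNReal.rpow_le_rpow h1 hp0.le
  rw [← ENNReal.rpow_mul, one_div_mul_cancel hp0.ne', ENNReal.rpow_one] at h2
  have h3 : ENNReal.ofReal (C * Real.sqrt (∑ a ∈ S, ‖c a‖ ^ 2)) ^ p ≤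
      ENNReal.ofReal C ^ p * ((S.card : ℝ≥0∞) ^ (p / 2 - 1) * ∑ s ∈ S, ‖c s‖ₑ ^ p) := by
    rw [ENNReal.ofReal_mul' (Real.sqrt_nonneg _), ENNReal.mul_rpow_of_nonneg _ _ hp0.le]
    gcongr
    have hsum : ENNReal.ofReal (∑ a ∈ S, ‖c a‖ ^ 2) = ∑ a ∈ S, ‖c a‖ₑ ^ (2 : ℝ) := by
      rw [ENNReal.ofReal_sum_of_nonneg fun _ _ => by positivity]
      refine Finset.sum_congr rfl fun a _ => ?_
      rw [ENNReal.ofReal_pow (norm_nonneg _), ofReal_norm]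
      norm_cast
    rw [Real.sqrt_eq_rpow, ← ENNReal.ofReal_rpow_of_nonneg (by positivity) (by norm_num), hsum,
      ← ENNReal.rpow_mul]
    -- The power mean inequality with exponent `p / 2 ≥ 1`, applied to the squares `‖c a‖²`,
    -- produces the factor `|S|^{p/2 - 1}`.
    have := ENNReal.rpow_sum_le_const_mul_sum_rpow S (fun a => ‖c a‖ₑ ^ (2 : ℝ))
      (p := p / 2) (by linarith)
    rw [show 1 / 2 * p = p / 2 by ring]
    refine this.trans (le_of_eq ?_)
    congr 2
    funext a
    rw [← ENNReal.rpow_mul]; congr 1; ring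
  rw [mul_assoc]
  refine le_trans (le_of_eq ?_) (h2.trans h3)
  refine lintegral_congr fun δ => ?_
  congr 3
  funext a
  rw [ec]; congr 2; push_cast; ring

/-- Tonelli brings the `δ`-integral innermost, where the `Λ(p)` inequality is used with `t` and `u`
frozen. -/
lemma lintegral_swap_first {G : ℝ → ℝ≥0∞} (hG : Measurable G) {r : (ℝ × ℝ) × ℝ → ℝ≥0∞}
    (hr : Measurable r) (ν : Measure ℝ) [SFinite ν] (K : ℝ≥0∞) :
    ∫⁻ δ, (∫⁻ t, K * ∫⁻ u, G u * r ((δ, t), u)) ∂ν =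
      K * ∫⁻ t, ∫⁻ u, G u * ∫⁻ δ, r ((δ, t), u) ∂ν := by
  have hGr : Measurable fun z : (ℝ × ℝ) × ℝ => G z.2 * r z := (hG.comp measurable_snd).mul hr
  have m1 : Measurable fun z : ℝ × ℝ => ∫⁻ u, G u * r (z, u) := hGr.lintegral_prod_right'
  have e1 : ∀ δ, ∫⁻ t, K * ∫⁻ u, G u * r ((δ, t), u) =
      K * ∫⁻ t, ∫⁻ u, G u * r ((δ, t), u) := fun δ =>
    lintegral_const_mul _ (m1.comp (measurable_const.prodMk measurable_id))
  simp_rw [e1]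
  rw [lintegral_const_mul _ m1.lintegral_prod_right', lintegral_lintegral_swap m1.aemeasurable]
  congr 1
  refine lintegral_congr fun t => ?_
  rw [lintegral_lintegral_swap]
  · refine lintegral_congr fun u => ?_
    rw [lintegral_const_mul]
    exact hr.comp (by fun_prop : Measurable fun δ : ℝ => ((δ, t), u))
  · exact (hGr.comp (by fun_prop :
      Measurable fun z : ℝ × ℝ => ((z.1, t), z.2))).aemeasurable

/-- The shift by `u / w` disappears in the `t`-integral, so the weight contributes only its total
mass. -/
lemma lintegral_weight_translate {ι : Type*} {G : ℝ → ℝ≥0∞} (hG : Measurable G) (S : Finset ι)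
    {q : ι → ℝ → ℝ≥0∞} (hq : ∀ s ∈ S, Measurable (q s)) (w : ℝ) (K : ℝ≥0∞) :
    ∫⁻ t, ∫⁻ u, G u * (K * ∑ s ∈ S, q s (t - u / w)) =
      (∫⁻ u, G u) * (K * ∑ s ∈ S, ∫⁻ t, q s t) := by
  have hm2 : Measurable fun z : ℝ × ℝ => ∑ s ∈ S, q s (z.1 - z.2 / w) :=
    Finset.measurable_fun_sum _ fun s hs => (hq s hs).comp
      (by fun_prop : Measurable fun z : ℝ × ℝ => z.1 - z.2 / w)
  rw [lintegral_lintegral_swap, ← lintegral_mul_const _ hG]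
  · refine lintegral_congr fun u => ?_
    have hm3 : Measurable fun t => ∑ s ∈ S, q s (t - u / w) :=
      hm2.comp (by fun_prop : Measurable fun t : ℝ => (t, u))
    rw [lintegral_const_mul _ (hm3.const_mul _), lintegral_const_mul _ hm3,
      lintegral_finsetSum' S (f := fun s t => q s (t - u / w)) (fun s hs =>
        ((hq s hs).comp (measurable_id.sub_const (u / w))).aemeasurable)]
    congr 2
    refine Finset.sum_congr rfl fun s hs => ?_
    exact lintegral_sub_right_eq_self (q s) _
  · exact ((hG.comp measurable_snd).mul (hm2.const_mul _)).aemeasurable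

set_option maxHeartbeats 1000000 in
/-- Decoupling for functions with frequencies near `-w s`, `s ∈ S`, where `S` is a `Λ(p)` set. -/
lemma IsLambdaSet.decoupling {p c₀ c₁ C : ℝ} (hp : 2 ≤ p) {N : ℕ} {S : Finset ℕ}
    (hS : IsLambdaSet p c₀ c₁ C N S) {Φ : ℝ → ℂ} (hΦi : Integrable Φ)
    {G : ℝ → ℝ} (hG : Measurable G)
    (hΦG : ∀ u, ∀ δ ∈ Set.Icc (0 : ℝ) 1, ‖Φ (u - δ)‖ ≤ G u) {w : ℝ} (hw : w ≠ 0)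
    (h : ℕ → ℝ → ℂ)
    (hh : ∀ s ∈ S, Reproduced Φ w (h s)) :
    ∫⁻ t, ‖∑ s ∈ S, ec (-(s * w * t)) * h s t‖ₑ ^ p ≤
      (ENNReal.ofReal C * ∫⁻ u, ENNReal.ofReal (G u)) ^ p * (S.card : ℝ≥0∞) ^ (p / 2 - 1) *
        ∑ s ∈ S, ∫⁻ t, ‖h s t‖ₑ ^ p := by
  have hp0 : 0 < p := by linarith
  have hp1 : 1 < p := by linarith
  set G' : ℝ → ℝ≥0∞ := fun u => ENNReal.ofReal (G u) with hG'
  have hG'm : Measurable G' := hG.ennreal_ofReal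
  set Q : ℝ → ℂ := fun t => ∑ s ∈ S, ec (-(s * w * t)) * h s t with hQ
  have hQc : Continuous Q := by
    refine continuous_finsetSum _ fun s hs => ?_
    have := (hh s hs).cont
    fun_prop
  set R : ℝ → ℝ → ℝ → ℂ := fun δ t u =>
    ∑ s ∈ S, (ec (-(s * w * t)) * h s (t - u / w)) * ec (s * δ) with hR
  have hRc : Continuous fun z : (ℝ × ℝ) × ℝ => R z.1.1 z.1.2 z.2 := by
    refine continuous_finsetSum _ fun s hs => ?_
    have := (hh s hs).cont
    fun_prop
  have key : ∀ δ ∈ Set.Icc (0 : ℝ) 1, ∀ t, ‖Q (t - δ / w)‖ₑ ≤ ∫⁻ u, G' u * ‖R δ t u‖ₑ := by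
    intro δ hδ t
    -- Shifting `t` by `δ / w` turns the `s`-th character into itself times `ec (s * δ)`. The same
    -- shift inside `h s` is moved onto `Φ` by a change of variable, so the coefficients of the
    -- trigonometric polynomial in `δ` do not depend on `δ`.
    have e1 : Q (t - δ / w) = ∫ u, Φ (u - δ) * R δ t u := by
      have e2 : ∀ s ∈ S, ec (-(s * w * (t - δ / w))) * h s (t - δ / w) =
          ∫ u, Φ (u - δ) * (ec (-(s * w * t)) * h s (t - u / w) * ec (s * δ)) := by
        intro s hs
        rw [(hh s hs).eq, ← integral_const_mul,
          ← integral_sub_right_eq_self _ δ]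
        refine integral_congr_ae (.of_forall fun u => ?_)
        have a1 : -(s * w * (t - δ / w)) = -(s * w * t) + s * δ := by field_simp; ring
        have a2 : t - δ / w - (u - δ) / w = t - u / w := by field_simp; ring
        simp only [a1, a2, ec_add]
        ring
      rw [hQ]
      simp only
      rw [Finset.sum_congr rfl e2, ← integral_finsetSum]
      · simp only [hR, Finset.mul_sum]
      · intro s hs
        obtain ⟨M, hM⟩ := (hh s hs).bdd
        have hc := (hh s hs).cont
        refine (hΦi.comp_sub_right δ).mul_bdd (c := M) ?_ (.of_forall fun u => ?_)
        · exact Continuous.aestronglyMeasurable (by fun_prop)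
        · rw [norm_mul, norm_mul, norm_ec, norm_ec, one_mul, mul_one]; exact hM _
    rw [e1]
    refine (enorm_integral_le_lintegral_enorm _).trans (lintegral_mono fun u => ?_)
    rw [enorm_mul]
    gcongr
    rw [hG', ← ofReal_norm]
    exact ENNReal.ofReal_le_ofReal (hΦG u δ hδ)
  have hRm : Measurable fun z : (ℝ × ℝ) × ℝ => ‖R z.1.1 z.1.2 z.2‖ₑ ^ p :=
    (hRc.measurable.enorm).pow_const p
  have hint : ∀ t u, ∫⁻ δ in Set.Icc (0 : ℝ) 1, ‖R δ t u‖ₑ ^ p ≤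
      ENNReal.ofReal C ^ p * (S.card : ℝ≥0∞) ^ (p / 2 - 1) *
        ∑ s ∈ S, ‖h s (t - u / w)‖ₑ ^ p := by
    intro t u
    refine (hS.lintegral_le hp _).trans (le_of_eq ?_)
    simp
  have step1 : ∫⁻ t, ‖Q t‖ₑ ^ p ≤ ∫⁻ δ in Set.Icc (0 : ℝ) 1, ∫⁻ t,
      (∫⁻ u, G' u) ^ (p - 1) * ∫⁻ u, G' u * ‖R δ t u‖ₑ ^ p := by
    -- The `t`-integral is translation invariant, so it equals its mean over all shifts `δ / w` with
    -- `δ ∈ [0, 1]`.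
    have e0 : ∫⁻ t, ‖Q t‖ₑ ^ p = ∫⁻ _ in Set.Icc (0 : ℝ) 1, ∫⁻ t, ‖Q t‖ₑ ^ p := by simp
    rw [e0]
    refine setLIntegral_mono' measurableSet_Icc fun δ hδ => ?_
    rw [← lintegral_sub_right_eq_self (fun t => ‖Q t‖ₑ ^ p) (δ / w)]
    refine lintegral_mono fun t => ?_
    refine (ENNReal.rpow_le_rpow (key δ hδ t) hp0.le).trans
      (rpow_lintegral_mul_le _ hp1 hG'm.aemeasurable ?_)
    have hι : Continuous fun u : ℝ => (((δ, t), u) : (ℝ × ℝ) × ℝ) := by fun_prop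
    exact (hRc.comp hι).measurable.enorm.aemeasurable
  refine step1.trans ?_
  rw [lintegral_swap_first hG'm hRm]
  refine (mul_le_mul_right (lintegral_mono fun t => lintegral_mono fun u =>
    mul_le_mul_right (hint t u) _) _).trans (le_of_eq ?_)
  rw [lintegral_weight_translate hG'm S
    (fun s hs => (hh s hs).cont.measurable.enorm.pow_const p) w]
  generalize (∫⁻ u, G' u) = G0
  rw [ENNReal.mul_rpow_of_nonneg _ _ hp0.le]
  have e5 : G0 ^ p = G0 ^ (p - 1) * G0 := by
    conv_rhs => rw [← ENNReal.rpow_one G0]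
    rw [← ENNReal.rpow_mul, one_mul, ← ENNReal.rpow_add_of_nonneg _ _ (by linarith) zero_le_one]
    ring_nf
  rw [e5]
  ring

/-! ### The reproducing kernel and the time cutoff. -/

/-- A kernel `Φ` with Fourier transform equal to one on `[-6, 6]`, together with an integrable
bounded majorant `G` of its translates by `δ ∈ [0, 1]`. -/
structure IsReproducingKernel (Φ : ℝ → ℂ) (G : ℝ → ℝ) (M : ℝ) : Prop where
  integrable : Integrable Φ
  measurable_majorant : Measurable G
  integrable_majorant : Integrable G
  norm_le : ∀ u, ∀ δ ∈ Set.Icc (0 : ℝ) 1, ‖Φ (u - δ)‖ ≤ G u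
  majorant_le : ∀ u, G u ≤ M
  fourier_eq : ∀ κ : ℝ, |κ| ≤ 6 → ∫ u, Φ u * ec (-(κ * u)) = 1

lemma ec_fourier (f : ℝ → ℂ) (ξ : ℝ) : 𝓕 f ξ = ∫ u, f u * ec (-(ξ * u)) := by
  rw [Real.fourier_real_eq_integral_exp_smul]
  refine integral_congr_ae (.of_forall fun u => ?_)
  simp only [smul_eq_mul]
  rw [mul_comm, ec_eq]
  congr 3; push_cast; ring

lemma ec_fourierInv (f : ℝ → ℂ) (x : ℝ) : 𝓕⁻ f x = ∫ ξ, f ξ * ec (ξ * x) := by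
  rw [Real.fourierInv_eq']
  refine integral_congr_ae (.of_forall fun u => ?_)
  simp only [smul_eq_mul]
  rw [mul_comm, ec_eq]
  congr 4
  simp [mul_comm]

/-- A complex-valued Schwartz bump function. -/
lemma exists_schwartz_bump {r R : ℝ} (hr : 0 < r) (hR : r < R) :
    ∃ B : SchwartzMap ℝ ℂ, (∀ x, |x| ≤ r → B x = 1) ∧ (∀ x, R ≤ |x| → B x = 0) := by
  let b : ContDiffBump (0 : ℝ) := ⟨r, R, hr, hR⟩
  have hc : HasCompactSupport fun x : ℝ => ((b x : ℝ) : ℂ) :=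
    b.hasCompactSupport.comp_left Complex.ofReal_zero
  have hs : ContDiff ℝ (⊤ : ℕ∞) fun x : ℝ => ((b x : ℝ) : ℂ) :=
    Complex.ofRealCLM.contDiff.comp b.contDiff
  refine ⟨hc.toSchwartzMap hs, fun x hx => ?_, fun x hx => ?_⟩
  · change ((b x : ℝ) : ℂ) = 1
    rw [b.one_of_mem_closedBall (by simpa [Metric.mem_closedBall] using hx), Complex.ofReal_one]
  · change ((b x : ℝ) : ℂ) = 0
    rw [b.zero_of_le_dist (by simpa using hx), Complex.ofReal_zero]

lemma schwartz_decay_sq (Φ : SchwartzMap ℝ ℂ) : ∃ c, 0 < c ∧ ∀ u, ‖Φ u‖ ≤ c * (1 + u ^ 2)⁻¹ := by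
  obtain ⟨c0, h0, hc0⟩ := Φ.decay 0 0
  obtain ⟨c2, h2, hc2⟩ := Φ.decay 2 0
  refine ⟨c0 + c2, by positivity, fun u => ?_⟩
  rw [← div_eq_mul_inv, le_div_iff₀ (by positivity)]
  have a0 := hc0 u
  have a2 := hc2 u
  simp only [norm_iteratedFDeriv_zero, pow_zero, one_mul, Real.norm_eq_abs, sq_abs] at a0 a2
  nlinarith

lemma exists_reproducingKernel : ∃ Φ G M, IsReproducingKernel Φ G M := by
  obtain ⟨B, hB, -⟩ := exists_schwartz_bump (r := 6) (R := 7) (by norm_num) (by norm_num)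
  set Φ : SchwartzMap ℝ ℂ := 𝓕⁻ B with hΦ
  have hF : 𝓕 Φ = B := FourierTransform.fourier_fourierInv_eq B
  obtain ⟨c, hc, hdec⟩ := schwartz_decay_sq Φ
  refine ⟨Φ, fun u => 3 * c * (1 + u ^ 2)⁻¹, 3 * c, Φ.integrable, by fun_prop,
    integrable_inv_one_add_sq.const_mul _, fun u δ hδ => ?_, fun u => ?_, fun κ hκ => ?_⟩
  · refine (hdec _).trans ?_
    rw [mul_comm 3 c, mul_assoc]
    gcongr
    rw [← div_eq_mul_inv, le_div_iff₀ (by positivity), ← div_eq_inv_mul,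
      div_le_iff₀ (by positivity)]
    obtain ⟨h1, h2⟩ := hδ
    -- This is `u² ≤ 2 (u - δ)² + 2 δ²` with `δ² ≤ 1`, hence `1 + u² ≤ 3 (1 + (u - δ)²)`.
    nlinarith [sq_nonneg (u - 2 * δ), sq_nonneg δ, mul_nonneg h1 (sub_nonneg.2 h2)]
  · have : (1 + u ^ 2)⁻¹ ≤ 1 := inv_le_one_of_one_le₀ (by nlinarith [sq_nonneg u])
    nlinarith
  · rw [← ec_fourier, ← SchwartzMap.fourier_coe, hF, hB κ hκ]

/-- A smooth cutoff `χ` that is bounded below on `[1, 2]` and whose Fourier transform `ψ` is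
supported in `[-1/16, 1/16]`. -/
structure IsTimeCutoff (ψ χ : ℝ → ℂ) : Prop where
  integrable : Integrable ψ
  supp : ∀ σ, ψ σ ≠ 0 → |σ| ≤ 1 / 16
  eq : ∀ t, χ t = ∫ σ, ψ σ * ec (σ * t)
  cont : Continuous χ
  lintegral_ne_top : ∀ p : ℝ, 1 ≤ p → ∫⁻ t, ‖χ t‖ₑ ^ p ≠ ⊤
  half_le : ∀ t ∈ Set.Icc (1 : ℝ) 2, 1 / 2 ≤ ‖χ t‖

/-- `χ` is the inverse Fourier transform of a nonnegative bump of mass one on `[-1/16, 1/16]`. For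
`t ∈ [1, 2]` the phase `2π σ t` is at most `π/4 < π/3` in absolute value, so the real part of the
integrand is at least half the bump. -/
lemma exists_timeCutoff : ∃ ψ χ, IsTimeCutoff ψ χ := by
  let b : ContDiffBump (0 : ℝ) := ⟨1 / 32, 1 / 16, by norm_num, by norm_num⟩
  let β : ℝ → ℝ := b.normed volume
  have hβc : HasCompactSupport β := b.hasCompactSupport_normed
  have hc : HasCompactSupport fun x : ℝ => ((β x : ℝ) : ℂ) := hβc.comp_left Complex.ofReal_zero
  have hs : ContDiff ℝ (⊤ : ℕ∞) fun x : ℝ => ((β x : ℝ) : ℂ) :=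
    Complex.ofRealCLM.contDiff.comp b.contDiff_normed
  set B : SchwartzMap ℝ ℂ := hc.toSchwartzMap hs with hB
  have hBapp : ∀ x, B x = (β x : ℂ) := fun x => rfl
  have hsupp : ∀ σ, B σ ≠ 0 → |σ| ≤ 1 / 16 := by
    intro σ hσ
    have h1 : β σ ≠ 0 := by simpa [hBapp] using hσ
    have h2 : σ ∈ Function.support (b.normed volume) := h1
    rw [b.support_normed_eq] at h2
    have : |σ| < 1 / 16 := by rwa [mem_ball_zero_iff, Real.norm_eq_abs] at h2
    exact this.le
  set χ : SchwartzMap ℝ ℂ := 𝓕⁻ B with hχ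
  have hχeq : ∀ t, χ t = ∫ σ, B σ * ec (σ * t) := fun t => by
    rw [← ec_fourierInv, ← SchwartzMap.fourierInv_coe]
  refine ⟨B, χ, B.integrable, hsupp, hχeq, χ.continuous, fun p hp => ?_, fun t ht => ?_⟩
  · have hp0 : 0 < p := by linarith
    have h := (χ.memLp (ENNReal.ofReal p) volume).2
    rw [eLpNorm_eq_lintegral_rpow_enorm_toReal (by simpa using hp0) ENNReal.ofReal_ne_top,
      ENNReal.toReal_ofReal hp0.le] at h
    intro htop
    rw [htop, ENNReal.top_rpow_of_pos (by positivity)] at h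
    exact lt_irrefl _ h
  · refine le_trans ?_ (Complex.re_le_norm _)
    have hint : Integrable fun σ => B σ * ec (σ * t) :=
      B.integrable.mul_bdd (c := 1) (by fun_prop) (.of_forall fun σ => by simp)
    have h1 : (χ t).re = ∫ σ, β σ * Real.cos (2 * Real.pi * (σ * t)) := by
      rw [hχeq]
      have h2 : (∫ σ, B σ * ec (σ * t)).re = ∫ σ, (B σ * ec (σ * t)).re :=
        (integral_re hint).symm
      rw [h2]
      refine integral_congr_ae (.of_forall fun σ => ?_)
      simp only [hBapp, Complex.re_ofReal_mul]
      rw [ec_eq, Complex.exp_ofReal_mul_I_re]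
    rw [h1]
    have h3 : ∫ σ, β σ * (1 / 2) ≤ ∫ σ, β σ * Real.cos (2 * Real.pi * (σ * t)) := by
      have hβi : Integrable β := b.integrable_normed
      refine integral_mono (hβi.mul_const _) (hβi.mul_bdd (c := 1) ?_ ?_) fun σ => ?_
      · exact Continuous.aestronglyMeasurable (by fun_prop)
      · exact .of_forall fun σ => by simpa using Real.abs_cos_le_one _
      · by_cases h0 : β σ = 0
        · simp [h0]
        · have h4 := hsupp σ (by simpa [hBapp] using h0)
          have h5 : 0 ≤ β σ := b.nonneg_normed σ
          refine mul_le_mul_of_nonneg_left ?_ h5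
          rw [← Real.cos_pi_div_three, ← Real.cos_abs (2 * Real.pi * (σ * t))]
          refine Real.cos_le_cos_of_nonneg_of_le_pi (abs_nonneg _)
            (by linarith [Real.pi_pos]) ?_
          rw [abs_mul, abs_of_pos Real.two_pi_pos, abs_mul,
            abs_of_nonneg (by linarith [ht.1] : 0 ≤ t)]
          have : |σ| * t ≤ 1 / 16 * 2 :=
            mul_le_mul h4 ht.2 (by linarith [ht.1]) (by norm_num)
          nlinarith [Real.pi_pos]
    refine le_trans (le_of_eq ?_) h3
    rw [integral_mul_const]
    have : ∫ σ, β σ = 1 := b.integral_normed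
    rw [this, one_mul]

/-- Superpositions of characters with frequencies in `[-6|w|, 6|w|]` are reproduced. -/
lemma IsReproducingKernel.reproduced {Φ : ℝ → ℂ} {G : ℝ → ℝ} {M : ℝ}
    (hΦ : IsReproducingKernel Φ G M) {Z : Type*} [MeasurableSpace Z] {ν : Measure Z} [SFinite ν]
    {a : Z → ℂ} (ha : Integrable a ν) {κ : Z → ℝ} (hκ : Measurable κ) {w : ℝ} (hw : w ≠ 0)
    (hκw : ∀ z, a z ≠ 0 → |κ z| ≤ 6 * |w|) {h : ℝ → ℂ}
    (hh : ∀ t, h t = ∫ z, a z * ec (κ z * t) ∂ν) : Reproduced Φ w h := by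
  have hmeas : ∀ t, AEStronglyMeasurable (fun z => ec (κ z * t)) ν := fun t =>
    (continuous_ec.measurable.comp (hκ.mul_const t)).aestronglyMeasurable
  have hbd : ∀ t z, ‖a z * ec (κ z * t)‖ ≤ ‖a z‖ := fun t z => by simp
  obtain rfl : h = fun t => ∫ z, a z * ec (κ z * t) ∂ν := funext hh
  refine ⟨?_, ⟨∫ z, ‖a z‖ ∂ν, fun t => ?_⟩, fun t => ?_⟩
  · refine continuous_of_dominated (fun t => ha.aestronglyMeasurable.mul (hmeas t))
      (fun t => .of_forall (hbd t)) ha.norm (.of_forall fun z => by fun_prop)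
  · exact norm_integral_le_of_norm_le ha.norm (.of_forall (hbd t))
  · have e1 : ∀ u, Φ u * ∫ z, a z * ec (κ z * (t - u / w)) ∂ν =
        ∫ z, Φ u * (a z * ec (κ z * (t - u / w))) ∂ν := fun u => (integral_const_mul _ _).symm
    simp_rw [e1]
    rw [integral_integral_swap]
    · refine integral_congr_ae (.of_forall fun z => ?_)
      simp only
      by_cases hz : a z = 0
      · simp [hz]
      have e2 : ∀ u, Φ u * (a z * ec (κ z * (t - u / w))) =
          (a z * ec (κ z * t)) * (Φ u * ec (-(κ z / w * u))) := by
        intro u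
        rw [show κ z * (t - u / w) = κ z * t + -(κ z / w * u) by ring, ec_add]
        ring
      simp_rw [e2]
      rw [integral_const_mul, hΦ.fourier_eq, mul_one]
      rw [abs_div, div_le_iff₀ (abs_pos.2 hw)]
      exact hκw z hz
    · refine (hΦ.integrable.mul_prod ha).mono ?_ (.of_forall fun z => ?_)
      · refine (hΦ.integrable.aestronglyMeasurable.comp_fst).mul
          ((ha.aestronglyMeasurable.comp_snd).mul ?_)
        refine (continuous_ec.measurable.comp ?_).aestronglyMeasurable
        exact (hκ.comp measurable_snd).mul
          (measurable_const.sub (measurable_fst.div_const w))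
      · simp [Function.uncurry]

/-- The function is a superposition over `(σ, ξ)` of characters in `t` of frequency `σ + τ + ξ c`,
with density built from `ψ σ` and `φ ξ`. -/
lemma reproduced_cutoff {Φ : ℝ → ℂ} {G : ℝ → ℝ} {M : ℝ} (hΦ : IsReproducingKernel Φ G M)
    {ψ χ : ℝ → ℂ} (hχ : IsTimeCutoff ψ χ) {φ g : ℝ → ℂ} (hφ : Integrable φ)
    (hg : ∀ y, g y = ∫ ξ, φ ξ * ec (ξ * y)) {w : ℝ} (hw : w ≠ 0) (τ x c : ℝ)
    (hfreq : ∀ σ, |σ| ≤ 1 / 16 → ∀ ξ, φ ξ ≠ 0 → |σ + τ + ξ * c| ≤ 6 * |w|) :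
    Reproduced Φ w fun t => χ t * (ec (τ * t) * g (x + c * t)) := by
  have hφx : Integrable fun ξ => φ ξ * ec (ξ * x) :=
    hφ.mul_bdd (c := 1) (Continuous.aestronglyMeasurable (by fun_prop))
      (.of_forall fun σ => by simp)
  refine hΦ.reproduced (a := fun z : ℝ × ℝ => ψ z.1 * (φ z.2 * ec (z.2 * x)))
    (κ := fun z => z.1 + τ + z.2 * c) (hχ.integrable.mul_prod hφx) (by fun_prop) hw ?_ ?_
  · intro z hz
    exact hfreq z.1 (hχ.supp _ (left_ne_zero_of_mul hz)) z.2
      (left_ne_zero_of_mul (right_ne_zero_of_mul hz))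
  · intro t
    rw [hχ.eq, hg, ← integral_const_mul, ← integral_prod_mul]
    refine integral_congr_ae (.of_forall fun z => ?_)
    simp only
    rw [show z.2 * (x + c * t) = z.2 * x + z.2 * c * t by ring,
      show (z.1 + τ + z.2 * c) * t = z.1 * t + τ * t + z.2 * c * t by ring,
      ec_add, ec_add, ec_add]
    ring

lemma Reproduced.sum {Φ : ℝ → ℂ} (hΦ : Integrable Φ) {w : ℝ} {ι : Type*} (S : Finset ι)
    {h : ι → ℝ → ℂ} (hh : ∀ s ∈ S, Reproduced Φ w (h s)) :
    Reproduced Φ w fun t => ∑ s ∈ S, h s t := by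
  have hch : ∀ s ∈ S, ∃ M, ∀ t, ‖h s t‖ ≤ M := fun s hs => (hh s hs).bdd
  choose! M hM using hch
  refine ⟨continuous_finsetSum _ fun s hs => (hh s hs).cont,
    ⟨∑ s ∈ S, M s, fun t => norm_sum_le_of_le _ fun s hs => hM s hs t⟩, fun t => ?_⟩
  simp_rw [Finset.mul_sum]
  rw [integral_finsetSum]
  · exact Finset.sum_congr rfl fun s hs => (hh s hs).eq t
  · intro s hs
    have hc := (hh s hs).cont
    exact hΦ.mul_bdd (c := M s) (Continuous.aestronglyMeasurable (by fun_prop))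
      (.of_forall fun u => hM s hs _)

/-! ### The tree of left endpoints and the iterated decoupling. -/

namespace Construction

variable {N : ℕ} (D : Construction N)

/-- The sum of `g` over the level-`(j + i)` left endpoints that descend from the level-`j` left
endpoint `a`. -/
def W : ℕ → ℕ → ℝ → (ℝ → ℂ) → ℂ
  | 0, _, a, g => g a
  | i + 1, j, a, g => ∑ s ∈ D.choice j a, W i (j + 1) (a + (s : ℝ) / (N : ℝ) ^ (j + 1)) g

lemma N_pos {N : ℕ} (D : Construction N) : 0 < N := D.N₀_pos.trans D.N₀_lt

lemma N_pos' {N : ℕ} (D : Construction N) : (0 : ℝ) < N := Nat.cast_pos.2 D.N_pos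

lemma card_choice (j : ℕ) (a : ℝ) : (D.choice j a).card = D.N₀ := D.card_eq _ (D.choice_mem j a)

lemma W_const_mul (i j : ℕ) (a : ℝ) (c : ℂ) (g : ℝ → ℂ) :
    D.W i j a (fun y => c * g y) = c * D.W i j a g := by
  induction i generalizing j a with
  | zero => rfl
  | succ i ih => simp only [W, ih, Finset.mul_sum]

lemma Icc_child_subset {j : ℕ} {a : ℝ} {s : ℕ} (hs : s ∈ D.choice j a) :
    Set.Icc (a + (s : ℝ) / (N : ℝ) ^ (j + 1))
      (a + (s : ℝ) / (N : ℝ) ^ (j + 1) + 1 / (N : ℝ) ^ (j + 1)) ⊆ Set.Icc a (a + 1 / (N : ℝ) ^ j) := by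
  have hN := D.N_pos'
  have h1 : (s : ℝ) + 1 ≤ N := by exact_mod_cast D.digits_lt _ (D.choice_mem j a) s hs
  refine Set.Icc_subset_Icc (by have : (0 : ℝ) ≤ s / N ^ (j + 1) := by positivity
                                linarith) ?_
  rw [add_assoc, ← add_div]
  have h2 : ((s : ℝ) + 1) / (N : ℝ) ^ (j + 1) ≤ 1 / (N : ℝ) ^ j := by
    rw [div_le_div_iff₀ (by positivity) (by positivity), pow_succ, one_mul, mul_comm _ (N : ℝ)]
    gcongr
  linarith

lemma W_reproduced {Φ : ℝ → ℂ} (hΦ : Integrable Φ) {w : ℝ} {H : ℝ → ℝ → ℂ} (i j : ℕ) (a : ℝ)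
    (hH : ∀ y ∈ Set.Icc a (a + 1 / (N : ℝ) ^ j), Reproduced Φ w (H y)) :
    Reproduced Φ w fun t => D.W i j a fun y => H y t := by
  induction i generalizing j a with
  | zero =>
    refine hH a ⟨le_rfl, ?_⟩
    have : 0 ≤ 1 / (N : ℝ) ^ j := by positivity
    linarith
  | succ i ih =>
    exact Reproduced.sum hΦ _ fun s hs => ih _ _ fun y hy => hH y (D.Icc_child_subset hs hy)

lemma W_continuous {X : Type*} [TopologicalSpace X] {H : ℝ → X → ℂ} (hH : ∀ y, Continuous (H y))
    (i j : ℕ) (a : ℝ) : Continuous fun t => D.W i j a fun y => H y t := by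
  induction i generalizing j a with
  | zero => exact hH a
  | succ i ih => exact continuous_finsetSum _ fun s _ => ih _ _

end Construction

/-- For fixed `t` the shear is a translation in `x`. It is used to recentre the averages at a parent
endpoint `a`, so that only `a - y` enters the time frequencies. -/
lemma lintegral_shear {F : ℝ × ℝ → ℝ≥0∞} (hF : Measurable F) (a : ℝ) :
    ∫⁻ x, ∫⁻ t, F (x + a * t, t) = ∫⁻ x, ∫⁻ t, F (x, t) := by
  have h1 : Measurable (Function.uncurry fun x t => F (x + a * t, t)) := by
    unfold Function.uncurry; fun_prop
  have h2 : Measurable (Function.uncurry fun x t => F (x, t)) := by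
    unfold Function.uncurry; fun_prop
  refine (lintegral_lintegral_swap h1.aemeasurable).trans
    (Eq.trans ?_ (lintegral_lintegral_swap h2.aemeasurable).symm)
  exact lintegral_congr fun t => lintegral_add_right_eq_self (fun x => F (x, t)) (a * t)

lemma rpow_sub_one_mul_self (x : ℝ≥0∞) {q : ℝ} (hq : 1 ≤ q) : x ^ (q - 1) * x = x ^ q := by
  conv_lhs => enter [2]; rw [← ENNReal.rpow_one x]
  rw [← ENNReal.rpow_add_of_nonneg _ _ (by linarith) zero_le_one, sub_add_cancel]

lemma lintegral_lintegral_translate_mul {χ g : ℝ → ℂ} (hχ : Continuous χ) (hg : Continuous g)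
    (p : ℝ) (hp : 0 ≤ p) (a : ℝ) :
    ∫⁻ x, ∫⁻ t, ‖χ t * g (x - t * a)‖ₑ ^ p = (∫⁻ t, ‖χ t‖ₑ ^ p) * ∫⁻ x, ‖g x‖ₑ ^ p := by
  have h := lintegral_shear (F := fun z => ‖χ z.2 * g (z.1 - z.2 * a)‖ₑ ^ p)
    (by fun_prop) a
  rw [← h]
  simp only
  rw [← lintegral_mul_const _ (by fun_prop), lintegral_lintegral_swap (by fun_prop)]
  refine lintegral_congr fun t => ?_
  rw [← lintegral_const_mul _ (by fun_prop)]
  refine lintegral_congr fun x => ?_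
  rw [show x + a * t - t * a = x by ring, enorm_mul, ENNReal.mul_rpow_of_nonneg _ _ hp]

namespace Construction

variable {N : ℕ} (D : Construction N)

/-- The `p`-th power of the space-time `L^p` norm of the localized averages over descendants. -/
def localNorm (χ g : ℝ → ℂ) (p : ℝ) (i j : ℕ) (a : ℝ) : ℝ≥0∞ :=
  ∫⁻ x, ∫⁻ t, ‖χ t * D.W i j a fun y => g (x - t * y)‖ₑ ^ p

/-- Each generation costs `N₀^{p-1}` from the power mean inequality and `N₀` from the number of
children. The normalization `N₀^{-i}` of the averages cancels `N₀^{p i}` exactly: these generations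
give no decay and no loss. -/
lemma localNorm_le_trivial {χ g : ℝ → ℂ} (hχ : Continuous χ) (hg : Continuous g) {p : ℝ}
    (hp : 1 ≤ p) (i j : ℕ) (a : ℝ) :
    D.localNorm χ g p i j a ≤
      ((D.N₀ : ℝ≥0∞) ^ p) ^ i * ((∫⁻ t, ‖χ t‖ₑ ^ p) * ∫⁻ x, ‖g x‖ₑ ^ p) := by
  have hp0 : 0 ≤ p := by linarith
  induction i generalizing j a with
  | zero =>
    rw [pow_zero, one_mul, ← lintegral_lintegral_translate_mul hχ hg p hp0 a]
    rfl
  | succ i ih =>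
    set X := (∫⁻ t, ‖χ t‖ₑ ^ p) * ∫⁻ x, ‖g x‖ₑ ^ p
    have hc : ∀ b, Continuous fun z : ℝ × ℝ =>
        χ z.2 * D.W i (j + 1) b fun y => g (z.1 - z.2 * y) := fun b => by
      have := D.W_continuous (X := ℝ × ℝ) (H := fun y z => g (z.1 - z.2 * y))
        (fun y => by fun_prop) i (j + 1) b
      fun_prop
    have hm : ∀ b, Measurable fun z : ℝ × ℝ =>
        ‖χ z.2 * D.W i (j + 1) b fun y => g (z.1 - z.2 * y)‖ₑ ^ p := fun b =>
      (hc b).measurable.enorm.pow_const p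
    calc D.localNorm χ g p (i + 1) j a
        ≤ ∫⁻ x, ∫⁻ t, (D.N₀ : ℝ≥0∞) ^ (p - 1) * ∑ s ∈ D.choice j a,
          ‖χ t * D.W i (j + 1) (a + (s : ℝ) / (N : ℝ) ^ (j + 1)) fun y => g (x - t * y)‖ₑ ^ p := by
          refine lintegral_mono fun x => lintegral_mono fun t => ?_
          simp only [W, Finset.mul_sum]
          refine (ENNReal.rpow_le_rpow (enorm_sum_le _ _) hp0).trans ?_
          refine (ENNReal.rpow_sum_le_const_mul_sum_rpow _ _ hp).trans (le_of_eq ?_)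
          rw [D.card_choice, Finset.mul_sum]
      _ = (D.N₀ : ℝ≥0∞) ^ (p - 1) * ∑ s ∈ D.choice j a,
          D.localNorm χ g p i (j + 1) (a + (s : ℝ) / (N : ℝ) ^ (j + 1)) := by
          have hms : Measurable fun z : ℝ × ℝ => ∑ s ∈ D.choice j a,
              ‖χ z.2 * D.W i (j + 1) (a + (s : ℝ) / (N : ℝ) ^ (j + 1))
                fun y => g (z.1 - z.2 * y)‖ₑ ^ p :=
            Finset.measurable_fun_sum _ fun s _ => hm _
          have e : ∀ x, ∫⁻ t, (D.N₀ : ℝ≥0∞) ^ (p - 1) * ∑ s ∈ D.choice j a,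
              ‖χ t * D.W i (j + 1) (a + (s : ℝ) / (N : ℝ) ^ (j + 1))
                fun y => g (x - t * y)‖ₑ ^ p = (D.N₀ : ℝ≥0∞) ^ (p - 1) * ∑ s ∈ D.choice j a,
              ∫⁻ t, ‖χ t * D.W i (j + 1) (a + (s : ℝ) / (N : ℝ) ^ (j + 1))
                fun y => g (x - t * y)‖ₑ ^ p := by
            intro x
            have h1 := lintegral_const_mul (μ := volume) ((D.N₀ : ℝ≥0∞) ^ (p - 1))
              (hms.comp (measurable_prodMk_left (x := x)))
            refine h1.trans ?_
            congr 1
            exact lintegral_finsetSum _ fun s _ => (hm _).comp measurable_prodMk_left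
          simp_rw [e]
          rw [lintegral_const_mul _
              (Finset.measurable_fun_sum _ fun s _ => (hm _).lintegral_prod_right'),
            lintegral_finsetSum _ fun s _ => (hm _).lintegral_prod_right']
          rfl
      _ ≤ (D.N₀ : ℝ≥0∞) ^ (p - 1) * ∑ s ∈ D.choice j a, ((D.N₀ : ℝ≥0∞) ^ p) ^ i * X := by
          gcongr
          exact ih _ _
      _ = _ := by
          rw [Finset.sum_const, D.card_choice, nsmul_eq_mul, ← mul_assoc, ← mul_assoc]
          congr 1
          rw [pow_succ, mul_comm]
          congr 1
          exact rpow_sub_one_mul_self _ hp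

lemma localNorm_shear {χ g : ℝ → ℂ} (hχ : Continuous χ) (hg : Continuous g) (p : ℝ) (i j : ℕ)
    (a b : ℝ) :
    D.localNorm χ g p i j b =
      ∫⁻ x, ∫⁻ t, ‖χ t * D.W i j b fun y => g (x + (a - y) * t)‖ₑ ^ p := by
  have hc : Continuous fun z : ℝ × ℝ => χ z.2 * D.W i j b fun y => g (z.1 - z.2 * y) := by
    have := D.W_continuous (X := ℝ × ℝ) (H := fun y z => g (z.1 - z.2 * y))
      (fun y => by fun_prop) i j b
    fun_prop
  rw [localNorm, ← lintegral_shear (hc.measurable.enorm.pow_const p) a]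
  refine lintegral_congr fun x => lintegral_congr fun t => ?_
  simp only
  congr 6
  funext y
  congr 1
  ring

/-- For each fixed `x`, after the shear by `a`, the terms below the child with digit `s` have time
frequencies within `6 |w|` of `-s w`, and the decoupling inequality applies. The hypothesis `hj`
says `|w| ≥ 1`, which lets the frequency spread of `χ` be absorbed. -/
lemma localNorm_succ_le {p c₀ c₁ C : ℝ} (hp : 2 ≤ p) (hN : 3 ≤ N)
    (hΛ : ∀ S ∈ D.Sigma, IsLambdaSet p c₀ c₁ C N S) {Φ : ℝ → ℂ} {G : ℝ → ℝ} {M : ℝ}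
    (hΦ : IsReproducingKernel Φ G M) {ψ χ : ℝ → ℂ} (hχ : IsTimeCutoff ψ χ) {φ g : ℝ → ℂ}
    (hφ : Integrable φ) (hg : ∀ y, g y = ∫ ξ, φ ξ * ec (ξ * y)) (hgc : Continuous g) {ξ₀ : ℝ}
    (hφs : ∀ ξ, φ ξ ≠ 0 → |ξ - ξ₀| ≤ 3 * |ξ₀| / N) (i : ℕ) {j : ℕ} (a : ℝ)
    (hj : (N : ℝ) ^ (j + 1) ≤ |ξ₀|) :
    D.localNorm χ g p (i + 1) j a ≤
      (ENNReal.ofReal C * ∫⁻ u, ENNReal.ofReal (G u)) ^ p * (D.N₀ : ℝ≥0∞) ^ (p / 2 - 1) *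
        ∑ s ∈ D.choice j a, D.localNorm χ g p i (j + 1) (a + (s : ℝ) / (N : ℝ) ^ (j + 1)) := by
  have hNp := D.N_pos'
  have hNj : (0 : ℝ) < (N : ℝ) ^ (j + 1) := by positivity
  set w := ξ₀ / (N : ℝ) ^ (j + 1) with hw
  have hw1 : 1 ≤ |w| := by
    rw [hw, abs_div, abs_of_pos hNj, le_div_iff₀ hNj, one_mul]; exact hj
  have hw0 : w ≠ 0 := fun h => by rw [h, abs_zero] at hw1; linarith
  have hξw : |ξ₀| = |w| * (N : ℝ) ^ (j + 1) := by
    rw [hw, abs_div, abs_of_pos hNj, div_mul_cancel₀ _ hNj.ne']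
  let h : ℝ → ℕ → ℝ → ℂ := fun x s t => D.W i (j + 1) (a + (s : ℝ) / (N : ℝ) ^ (j + 1))
    fun y => χ t * (ec (s * w * t) * g (x + (a - y) * t))
  have hrep : ∀ x, ∀ s ∈ D.choice j a, Reproduced Φ w (h x s) := by
    intro x s hs
    refine D.W_reproduced hΦ.integrable _ _ _ fun y hy => ?_
    refine reproduced_cutoff hΦ hχ hφ hg hw0 _ x _ fun σ hσ ξ hξ => ?_
    have hs1 : (s : ℝ) ≤ N := by
      exact_mod_cast (D.digits_lt _ (D.choice_mem j a) s hs).le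
    obtain ⟨β, hβ, hβ0, hβ1⟩ : ∃ β : ℝ, y = a + s / (N : ℝ) ^ (j + 1) + β ∧ 0 ≤ β ∧
        β ≤ 1 / (N : ℝ) ^ (j + 1) :=
      ⟨y - (a + s / (N : ℝ) ^ (j + 1)), by ring, by linarith [hy.1], by linarith [hy.2]⟩
    -- With the modulation `-s w` removed, three errors remain: `|σ| ≤ 1/16` from the cutoff, at
    -- most `3 |w|` from the width of the frequency band (as `s ≤ N`), and at most `2 |w|` from the
    -- position `β` inside the child interval (as `|ξ| ≤ 2 |ξ₀|` for `N ≥ 3`). Their sum is at most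
    -- `6 |w|`.
    have e1 : σ + s * w + ξ * (a - y) =
        σ + ((ξ₀ - ξ) * (s / (N : ℝ) ^ (j + 1)) + -(ξ * β)) := by
      rw [hβ, hw]; ring
    have h1 := hφs ξ hξ
    have b1 : |(ξ₀ - ξ) * (s / (N : ℝ) ^ (j + 1))| ≤ 3 * |w| := by
      rw [abs_mul, abs_sub_comm, abs_of_nonneg (by positivity : (0 : ℝ) ≤ s / (N : ℝ) ^ (j + 1))]
      calc |ξ - ξ₀| * (s / (N : ℝ) ^ (j + 1))
          ≤ (3 * |ξ₀| / N) * (N / (N : ℝ) ^ (j + 1)) := by gcongr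
        _ = 3 * |w| := by rw [hξw]; field_simp
    have b2 : |-(ξ * β)| ≤ 2 * |w| := by
      rw [abs_neg, abs_mul, abs_of_nonneg hβ0]
      have h3 : 3 * |ξ₀| / N ≤ |ξ₀| := by
        rw [div_le_iff₀ hNp, mul_comm]
        have : (3 : ℝ) ≤ N := by exact_mod_cast hN
        gcongr
      have h4 : |ξ| ≤ 2 * |ξ₀| := by
        have := abs_sub_abs_le_abs_sub ξ ξ₀
        linarith
      calc |ξ| * β ≤ (2 * |ξ₀|) * (1 / (N : ℝ) ^ (j + 1)) := by gcongr
        _ = 2 * |w| := by rw [hξw]; field_simp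
    rw [e1]
    have t1 := abs_add_le σ ((ξ₀ - ξ) * (s / (N : ℝ) ^ (j + 1)) + -(ξ * β))
    have t2 := abs_add_le ((ξ₀ - ξ) * (s / (N : ℝ) ^ (j + 1))) (-(ξ * β))
    linarith
  have hdec := fun x => (hΛ _ (D.choice_mem j a)).decoupling hp hΦ.integrable
    hΦ.measurable_majorant hΦ.norm_le hw0 (h x) (hrep x)
  have hh : ∀ x s t, h x s t = ec (s * w * t) *
      (χ t * D.W i (j + 1) (a + (s : ℝ) / (N : ℝ) ^ (j + 1)) fun y => g (x + (a - y) * t)) := by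
    intro x s t
    simp only [h]
    rw [W_const_mul, W_const_mul]
    ring
  have hc : ∀ b, Continuous fun z : ℝ × ℝ =>
      χ z.2 * D.W i (j + 1) b fun y => g (z.1 + (a - y) * z.2) := fun b => by
    have := D.W_continuous (X := ℝ × ℝ) (H := fun y z => g (z.1 + (a - y) * z.2))
      (fun y => by fun_prop) i (j + 1) b
    have := hχ.cont
    fun_prop
  have hm : ∀ b, Measurable fun z : ℝ × ℝ =>
      ‖χ z.2 * D.W i (j + 1) b fun y => g (z.1 + (a - y) * z.2)‖ₑ ^ p := fun b =>
    (hc b).measurable.enorm.pow_const p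
  rw [D.localNorm_shear hχ.cont hgc p (i + 1) j a a]
  -- The modulation built into `h` is undone here, which gives the form required by the decoupling
  -- inequality.
  have eL : ∀ x t, χ t * D.W (i + 1) j a (fun y => g (x + (a - y) * t)) =
      ∑ s ∈ D.choice j a, ec (-(s * w * t)) * h x s t := by
    intro x t
    simp only [W, Finset.mul_sum]
    refine Finset.sum_congr rfl fun s _ => ?_
    rw [hh, ← mul_assoc, mul_comm (ec _), ec_mul_neg, one_mul]
  simp_rw [eL]
  refine (lintegral_mono hdec).trans ?_
  rw [D.card_choice]
  have eR : ∀ x s t, ‖h x s t‖ₑ = ‖χ t * D.W i (j + 1) (a + (s : ℝ) / (N : ℝ) ^ (j + 1))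
      fun y => g (x + (a - y) * t)‖ₑ := by
    intro x s t
    rw [hh, enorm_mul, enorm_ec, one_mul]
  simp_rw [eR]
  rw [lintegral_const_mul _
      (Finset.measurable_fun_sum _ fun s _ => (hm _).lintegral_prod_right'),
    lintegral_finsetSum _ fun s _ => (hm _).lintegral_prod_right']
  gcongr with s hs
  rw [D.localNorm_shear hχ.cont hgc p i (j + 1) a]

/-- The iterated decoupling estimate. -/
lemma localNorm_le {p c₀ c₁ C : ℝ} (hp : 2 ≤ p) (hN : 3 ≤ N)
    (hΛ : ∀ S ∈ D.Sigma, IsLambdaSet p c₀ c₁ C N S) {Φ : ℝ → ℂ} {G : ℝ → ℝ} {M : ℝ}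
    (hΦ : IsReproducingKernel Φ G M) {ψ χ : ℝ → ℂ} (hχ : IsTimeCutoff ψ χ) {φ g : ℝ → ℂ}
    (hφ : Integrable φ) (hg : ∀ y, g y = ∫ ξ, φ ξ * ec (ξ * y)) (hgc : Continuous g) {ξ₀ : ℝ}
    (hφs : ∀ ξ, φ ξ ≠ 0 → |ξ - ξ₀| ≤ 3 * |ξ₀| / N) (i k j : ℕ) (a : ℝ)
    (hj : (N : ℝ) ^ (j + k) ≤ |ξ₀|) :
    D.localNorm χ g p (i + k) j a ≤
      ((ENNReal.ofReal C * ∫⁻ u, ENNReal.ofReal (G u)) ^ p * (D.N₀ : ℝ≥0∞) ^ (p / 2)) ^ k *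
        (((D.N₀ : ℝ≥0∞) ^ p) ^ i * ((∫⁻ t, ‖χ t‖ₑ ^ p) * ∫⁻ x, ‖g x‖ₑ ^ p)) := by
  -- The first `k` generations below `a` are decoupled and the last `i` are left to the trivial
  -- bound. The invariant is that `j + k` stays fixed.
  induction k generalizing j a with
  | zero =>
    rw [pow_zero, one_mul]
    exact D.localNorm_le_trivial hχ.cont hgc (by linarith) i j a
  | succ k ih =>
    have hN1 : (1 : ℝ) ≤ N := by exact_mod_cast (by omega : 1 ≤ N)
    have hj' : (N : ℝ) ^ (j + 1 + k) ≤ |ξ₀| := by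
      rwa [show j + 1 + k = j + (k + 1) by ring]
    rw [← add_assoc]
    refine (D.localNorm_succ_le hp hN hΛ hΦ hχ hφ hg hgc hφs (i + k) a
      ((pow_le_pow_right₀ hN1 (by omega)).trans hj)).trans ?_
    refine (mul_le_mul_right (Finset.sum_le_sum fun s _ => ih (j + 1) _ hj') _).trans
      (le_of_eq ?_)
    rw [Finset.sum_const, D.card_choice, nsmul_eq_mul, pow_succ' _ k, ← mul_assoc, ← mul_assoc]
    congr 1
    -- The factor `N₀^{p/2 - 1}` and the `N₀` children combine to `N₀^{p/2}` per generation.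
    rw [mul_assoc _ ((D.N₀ : ℝ≥0∞) ^ (p / 2 - 1))]
    congr 2
    exact rpow_sub_one_mul_self _ (by linarith)

end Construction

/-! ### Convergence of normalized endpoint sums to the Cantor measure. -/

namespace Construction

variable {N : ℕ} (D : Construction N)

lemma one_lt_base {N : ℕ} (D : Construction N) : 1 < N :=
  lt_of_le_of_lt (Nat.succ_le_of_lt D.N₀_pos) D.N₀_lt

lemma W_const (i j : ℕ) (a : ℝ) (c : ℂ) : D.W i j a (fun _ => c) = (D.N₀ : ℂ) ^ i * c := by
  induction i generalizing j a with
  | zero => simp [W]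
  | succ i ih =>
    simp only [W, ih, Finset.sum_const, D.card_choice, nsmul_eq_mul]
    ring

lemma W_sub (i j : ℕ) (a : ℝ) (g h : ℝ → ℂ) :
    D.W i j a (fun y => g y - h y) = D.W i j a g - D.W i j a h := by
  induction i generalizing j a with
  | zero => rfl
  | succ i ih => simp only [W, ih, Finset.sum_sub_distrib]

lemma norm_W_le {g : ℝ → ℂ} {ε : ℝ} (hg : ∀ y, ‖g y‖ ≤ ε) (i j : ℕ) (a : ℝ) :
    ‖D.W i j a g‖ ≤ (D.N₀ : ℝ) ^ i * ε := by
  induction i generalizing j a with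
  | zero => simpa [W] using hg a
  | succ i ih =>
    simp only [W]
    refine (norm_sum_le_of_le _ fun s _ => ih (j + 1) _).trans (le_of_eq ?_)
    rw [Finset.sum_const, D.card_choice, nsmul_eq_mul, pow_succ]
    ring

/-- The left endpoints of level `j + i` that descend from the level-`j` endpoint `a`. -/
def leaves : ℕ → ℕ → ℝ → Set ℝ
  | 0, _, a => {a}
  | i + 1, j, a => ⋃ s ∈ D.choice j a, leaves i (j + 1) (a + (s : ℝ) / (N : ℝ) ^ (j + 1))

/-- `leaves` branches at the root, whereas `A` adds a generation at the tips; this reconciles the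
two recursions. -/
lemma leaves_succ (i j : ℕ) (a : ℝ) :
    D.leaves (i + 1) j a = ⋃ b ∈ D.leaves i j a,
      {x | ∃ s ∈ D.choice (j + i) b, x = b + (s : ℝ) / (N : ℝ) ^ (j + i + 1)} := by
  induction i generalizing j a with
  | zero =>
    ext x
    simp [leaves]
  | succ i ih =>
    have e (i : ℕ) : D.leaves (i + 1) j a = ⋃ s ∈ D.choice j a,
        D.leaves i (j + 1) (a + (s : ℝ) / (N : ℝ) ^ (j + 1)) := rfl
    rw [e (i + 1), e i]
    simp_rw [ih, show j + 1 + i = j + (i + 1) by ring]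
    ext x
    simp only [Set.mem_iUnion]
    constructor
    · rintro ⟨s, hs, b, hb, hx⟩
      exact ⟨b, ⟨s, hs, hb⟩, hx⟩
    · rintro ⟨b, ⟨s, hs, hb⟩, hx⟩
      exact ⟨s, hs, b, hb, hx⟩

lemma A_eq_leaves (k : ℕ) : D.A k = D.leaves k 0 1 := by
  induction k with
  | zero => rfl
  | succ k ih => rw [leaves_succ, A, ih]; simp only [zero_add]

lemma leaves_finite (i j : ℕ) (a : ℝ) : (D.leaves i j a).Finite := by
  induction i generalizing j a with
  | zero => exact Set.finite_singleton a
  | succ i ih => exact (D.choice j a).finite_toSet.biUnion fun s _ => ih _ _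

lemma leaves_subset (i j : ℕ) (a : ℝ) :
    ∀ b ∈ D.leaves i j a, Set.Icc b (b + 1 / (N : ℝ) ^ (j + i)) ⊆ Set.Icc a (a + 1 / (N : ℝ) ^ j) := by
  induction i generalizing j a with
  | zero => rintro b rfl; rfl
  | succ i ih =>
    intro b hb
    simp only [leaves, Set.mem_iUnion] at hb
    obtain ⟨s, hs, hb⟩ := hb
    have := ih _ _ b hb
    rw [show j + 1 + i = j + (i + 1) by ring] at this
    exact this.trans (D.Icc_child_subset hs)

lemma W_congr {i j : ℕ} {a : ℝ} {g h : ℝ → ℂ} (hgh : ∀ b ∈ D.leaves i j a, g b = h b) :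
    D.W i j a g = D.W i j a h := by
  induction i generalizing j a with
  | zero => exact hgh a rfl
  | succ i ih =>
    refine Finset.sum_congr rfl fun s hs => ih fun b hb => hgh b ?_
    simp only [leaves, Set.mem_iUnion]
    exact ⟨s, hs, hb⟩

/-- The half-open version of the part of `E_{j+i}` in the level-`j` interval of `a`. -/
def cell (i j : ℕ) (a : ℝ) : Set ℝ :=
  ⋃ b ∈ D.leaves i j a, Set.Ico b (b + 1 / (N : ℝ) ^ (j + i))

lemma cell_zero (j : ℕ) (a : ℝ) : D.cell 0 j a = Set.Ico a (a + 1 / (N : ℝ) ^ j) := by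
  simp [cell, leaves]

lemma cell_succ (i j : ℕ) (a : ℝ) :
    D.cell (i + 1) j a =
      ⋃ s ∈ D.choice j a, D.cell i (j + 1) (a + (s : ℝ) / (N : ℝ) ^ (j + 1)) := by
  ext x
  simp only [cell, leaves, Set.mem_iUnion, show j + 1 + i = j + (i + 1) by ring]
  constructor
  · rintro ⟨b, ⟨s, hs, hb⟩, hx⟩
    exact ⟨s, hs, b, hb, hx⟩
  · rintro ⟨s, hs, b, hb, hx⟩
    exact ⟨b, ⟨s, hs, hb⟩, hx⟩

lemma measurableSet_cell (i j : ℕ) (a : ℝ) : MeasurableSet (D.cell i j a) :=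
  (D.leaves_finite i j a).measurableSet_biUnion fun _ _ => measurableSet_Ico

lemma cell_subset (i j : ℕ) (a : ℝ) : D.cell i j a ⊆ Set.Ico a (a + 1 / (N : ℝ) ^ j) := by
  intro x hx
  simp only [cell, Set.mem_iUnion] at hx
  obtain ⟨b, hb, hx⟩ := hx
  have h0 : 0 ≤ 1 / (N : ℝ) ^ (j + i) := by positivity
  have h1 := D.leaves_subset i j a b hb
  have h2 := (h1 ⟨le_rfl, by linarith⟩).1
  have h3 := (h1 ⟨by linarith, le_rfl⟩).2
  exact ⟨h2.trans hx.1, hx.2.trans_le h3⟩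

/-- The children are disjoint because the intervals are half-open: a common point would force `s <
s' + 1` and `s' < s + 1`. Hence the tree sum `W` counts each cell once. -/
lemma integral_cell {H : ℝ → ℂ} (hH : Continuous H) (i j : ℕ) (a : ℝ) :
    ∫ x in D.cell i j a, H x =
      D.W i j a fun b => ∫ x in Set.Ico b (b + 1 / (N : ℝ) ^ (j + i)), H x := by
  induction i generalizing j a with
  | zero => rw [cell_zero]; rfl
  | succ i ih =>
    have hNp := D.N_pos'
    rw [cell_succ, integral_biUnion_finset]
    · simp only [W, ih, show j + 1 + i = j + (i + 1) by ring]
    · exact fun s _ => D.measurableSet_cell _ _ _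
    · intro s _ s' _ hss'
      refine Set.disjoint_left.2 fun x hx hx' => hss' ?_
      have h1 := D.cell_subset _ _ _ hx
      have h2 := D.cell_subset _ _ _ hx'
      have hp : (0 : ℝ) < (N : ℝ) ^ (j + 1) := by positivity
      have e1 : (s : ℝ) / (N : ℝ) ^ (j + 1) < (s' + 1 : ℝ) / (N : ℝ) ^ (j + 1) := by
        rw [add_div]; linarith [h1.1, h2.2]
      have e2 : (s' : ℝ) / (N : ℝ) ^ (j + 1) < (s + 1 : ℝ) / (N : ℝ) ^ (j + 1) := by
        rw [add_div]; linarith [h2.1, h1.2]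
      rw [div_lt_div_iff_of_pos_right hp] at e1 e2
      norm_cast at e1 e2
      omega
    · intro s _
      exact (hH.integrableOn_Icc (a := a + s / (N : ℝ) ^ (j + 1))
        (b := a + s / (N : ℝ) ^ (j + 1) + 1 / (N : ℝ) ^ (j + 1))).mono_set
        ((D.cell_subset _ _ _).trans Set.Ico_subset_Icc_self)

lemma E_ae_eq_cell (k : ℕ) : D.E k =ᵐ[volume] D.cell k 0 1 := by
  rw [E, A_eq_leaves, cell, zero_add]
  exact Filter.EventuallyEq.countable_bUnion (D.leaves_finite _ _ _).countable
    fun b _ => Ico_ae_eq_Icc.symm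

lemma volume_E (k : ℕ) : (volume (D.E k)) = ENNReal.ofReal ((D.N₀ : ℝ) ^ k * (1 / (N : ℝ) ^ k)) := by
  rw [measure_congr (D.E_ae_eq_cell k)]
  have h := D.integral_cell (H := fun _ => 1) continuous_const k 0 1
  have hfin : volume (D.cell k 0 1) ≠ ⊤ :=
    ((measure_mono (D.cell_subset k 0 1)).trans_lt (by simp)).ne
  simp only [zero_add, integral_const, MeasurableSet.univ, measureReal_restrict_apply,
    Set.univ_inter, Complex.real_smul, mul_one, Real.volume_real_Ico, add_sub_cancel_left,
    W_const] at h
  rw [max_eq_left (by positivity)] at h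
  have h' : volume.real (D.cell k 0 1) = (D.N₀ : ℝ) ^ k * (1 / (N : ℝ) ^ k) := by
    exact_mod_cast h
  rw [← h', Measure.real, ENNReal.ofReal_toReal hfin]

lemma integral_approxMeasure {H : ℝ → ℂ} (hH : Continuous H) (k : ℕ) :
    ∫ x, H x ∂(D.approxMeasure k) = (((D.N₀ : ℝ) ^ k * (1 / (N : ℝ) ^ k) : ℝ) : ℂ)⁻¹ *
      D.W k 0 1 fun b => ∫ x in Set.Ico b (b + 1 / (N : ℝ) ^ k), H x := by
  have hNp := D.N_pos'
  rw [approxMeasure, integral_smul_measure, setIntegral_congr_set (D.E_ae_eq_cell k),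
    D.integral_cell hH, volume_E, ENNReal.toReal_inv, ENNReal.toReal_ofReal (by positivity)]
  simp only [zero_add]
  rw [Complex.real_smul, Complex.ofReal_inv]

/-- The normalized sums over left endpoints converge to the Cantor measure. -/
lemma IsCantorMeasure.tendsto_W {μ : Measure ℝ} (hμ : D.IsCantorMeasure μ) {H : ℝ → ℂ} {K L : ℝ}
    (hK : ∀ x, ‖H x‖ ≤ K) (hL : ∀ x y, ‖H x - H y‖ ≤ L * |x - y|) :
    Tendsto (fun k => ((D.N₀ : ℂ) ^ k)⁻¹ * D.W k 0 1 H) atTop (𝓝 (∫ x, H x ∂μ)) := by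
  have hNp := D.N_pos'
  have hN0 : (0 : ℝ) < D.N₀ := Nat.cast_pos.2 D.N₀_pos
  have := hμ.prob
  have hL0 : 0 ≤ L := by
    have := (norm_nonneg _).trans (hL 1 0); simpa using this
  have hHc : Continuous H := by
    refine LipschitzWith.continuous (K := L.toNNReal) (LipschitzWith.of_dist_le_mul fun x y => ?_)
    rw [dist_eq_norm, Real.dist_eq, Real.coe_toNNReal _ hL0]
    exact hL x y
  let HR : BoundedContinuousFunction ℝ ℝ := BoundedContinuousFunction.ofNormedAddCommGroup
    (fun x => (H x).re) (by fun_prop) K fun x => (Complex.abs_re_le_norm _).trans (hK x)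
  let HI : BoundedContinuousFunction ℝ ℝ := BoundedContinuousFunction.ofNormedAddCommGroup
    (fun x => (H x).im) (by fun_prop) K fun x => (Complex.abs_im_le_norm _).trans (hK x)
  have hint : ∀ ν : Measure ℝ, IsFiniteMeasure ν → Integrable H ν := fun ν _ =>
    Integrable.of_bound hHc.aestronglyMeasurable K (.of_forall hK)
  have hsplit : ∀ ν : Measure ℝ, IsFiniteMeasure ν → ∫ x, H x ∂ν =
      ((∫ x, HR x ∂ν : ℝ) : ℂ) + ((∫ x, HI x ∂ν : ℝ) : ℂ) * Complex.I := fun ν hν =>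
    (integral_re_add_im (hint ν hν)).symm
  have hfin : ∀ k, IsFiniteMeasure (D.approxMeasure k) := by
    intro k
    refine ⟨?_⟩
    rw [approxMeasure, Measure.smul_apply, Measure.restrict_apply_univ, smul_eq_mul]
    exact (ENNReal.inv_mul_le_one _).trans_lt ENNReal.one_lt_top
  have h1 : Tendsto (fun k => ∫ x, H x ∂(D.approxMeasure k)) atTop (𝓝 (∫ x, H x ∂μ)) := by
    rw [hsplit μ inferInstance]
    simp_rw [fun k => hsplit (D.approxMeasure k) (hfin k)]
    exact ((Complex.continuous_ofReal.tendsto _).comp (hμ.weak_limit HR)).add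
      (((Complex.continuous_ofReal.tendsto _).comp (hμ.weak_limit HI)).mul_const _)
  refine tendsto_of_tendsto_of_dist h1 ?_
  have hlim : Tendsto (fun k : ℕ => L * (1 / (N : ℝ)) ^ k) atTop (𝓝 0) := by
    have h1N : (1 : ℝ) < N := by exact_mod_cast D.one_lt_base
    have := tendsto_pow_atTop_nhds_zero_of_lt_one (r := 1 / (N : ℝ)) (by positivity)
      (by rw [div_lt_one hNp]; exact h1N)
    simpa using this.const_mul L
  refine squeeze_zero (fun _ => dist_nonneg) (fun k => ?_) hlim
  set δ := 1 / (N : ℝ) ^ k with hδ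
  have hδ0 : 0 < δ := by positivity
  have e1 : ((D.N₀ : ℂ) ^ k)⁻¹ * D.W k 0 1 H =
      (((D.N₀ : ℝ) ^ k * δ : ℝ) : ℂ)⁻¹ * D.W k 0 1 fun b => δ * H b := by
    rw [W_const_mul]
    have : (δ : ℂ) ≠ 0 := by exact_mod_cast hδ0.ne'
    push_cast
    field_simp
  rw [D.integral_approxMeasure hHc, e1, dist_eq_norm, ← mul_sub, ← W_sub, norm_mul, norm_inv,
    Complex.norm_real, Real.norm_of_nonneg (by positivity)]
  -- Replacing `H` by its endpoint value costs `L δ` on an interval of length `δ`. After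
  -- normalization the total error is `L N^{-k}`.
  have h2 : ∀ b, ‖(∫ x in Set.Ico b (b + δ), H x) - δ * H b‖ ≤ L * δ * δ := by
    intro b
    have e2 : (δ : ℂ) * H b = ∫ x in Set.Ico b (b + δ), H b := by
      simp [hδ0.le]
    have hI : IntegrableOn H (Set.Ico b (b + δ)) :=
      (hHc.integrableOn_Icc).mono_set Set.Ico_subset_Icc_self
    rw [e2, ← integral_sub hI (by simp)]
    have h3 : ∀ x ∈ Set.Ico b (b + δ), ‖H x - H b‖ ≤ L * δ := by
      intro x hx
      refine (hL x b).trans ?_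
      gcongr
      rw [abs_of_nonneg (by linarith [hx.1])]
      linarith [hx.2]
    refine (norm_setIntegral_le_of_norm_le_const (by simp) h3).trans (le_of_eq ?_)
    simp [hδ0.le]
  refine (mul_le_mul_of_nonneg_left (D.norm_W_le h2 k 0 1) (by positivity)).trans (le_of_eq ?_)
  rw [one_div_pow, ← hδ]
  field_simp

end Construction

/-! ### Mixed norms and the Nikolskii inequality in time. -/

/-- The `L^r([1,2])` norm in the time variable. -/
def timeNorm (r : ℝ) (h : ℝ → ℂ) : ℝ≥0∞ := (∫⁻ t in Set.Icc (1 : ℝ) 2, ‖h t‖ₑ ^ r) ^ (1 / r)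

/-- The mixed norm in `L^p(ℝ; L^r([1,2]))`. -/
def mixNorm (p r : ℝ) (F : ℝ → ℝ → ℂ) : ℝ≥0∞ := (∫⁻ x, timeNorm r (F x) ^ p) ^ (1 / p)

lemma measurable_timeNorm (r : ℝ) {F : ℝ → ℝ → ℂ} (hF : Measurable fun z : ℝ × ℝ => F z.1 z.2) :
    Measurable fun x => timeNorm r (F x) := by
  have h : Measurable fun z : ℝ × ℝ => ‖F z.1 z.2‖ₑ ^ r := hF.enorm.pow_const r
  exact (h.lintegral_prod_right' (ν := volume.restrict (Set.Icc (1 : ℝ) 2))).pow_const _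

lemma mixNorm_add_le {p r : ℝ} (hp : 1 ≤ p) (hr : 1 ≤ r) {F G : ℝ → ℝ → ℂ}
    (hF : Measurable fun z : ℝ × ℝ => F z.1 z.2) (hG : Measurable fun z : ℝ × ℝ => G z.1 z.2) :
    mixNorm p r (fun x t => F x t + G x t) ≤ mixNorm p r F + mixNorm p r G := by
  have h1 : ∀ x, timeNorm r (fun t => F x t + G x t) ≤ timeNorm r (F x) + timeNorm r (G x) := by
    intro x
    refine le_trans ?_ (ENNReal.lintegral_Lp_add_le
      (hF.comp measurable_prodMk_left).enorm.aemeasurable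
      (hG.comp measurable_prodMk_left).enorm.aemeasurable hr)
    refine ENNReal.rpow_le_rpow (lintegral_mono fun t => ?_) (by positivity)
    exact ENNReal.rpow_le_rpow (enorm_add_le _ _) (by positivity)
  refine le_trans ?_ (ENNReal.lintegral_Lp_add_le (measurable_timeNorm r hF).aemeasurable
    (measurable_timeNorm r hG).aemeasurable hp)
  refine ENNReal.rpow_le_rpow (lintegral_mono fun x => ?_) (by positivity)
  exact ENNReal.rpow_le_rpow (h1 x) (by positivity)

lemma mixNorm_zero {p r : ℝ} (hp : 1 ≤ p) (hr : 1 ≤ r) : mixNorm p r (fun _ _ => 0) = 0 := by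
  have hp0 : 0 < p := by linarith
  have hr0 : 0 < r := by linarith
  simp [mixNorm, timeNorm, hp0, hr0]

lemma mixNorm_sum_le {p r : ℝ} (hp : 1 ≤ p) (hr : 1 ≤ r) {ι : Type*} (S : Finset ι)
    {F : ι → ℝ → ℝ → ℂ} (hF : ∀ i, Measurable fun z : ℝ × ℝ => F i z.1 z.2) :
    mixNorm p r (fun x t => ∑ i ∈ S, F i x t) ≤ ∑ i ∈ S, mixNorm p r (F i) := by
  classical
  induction S using Finset.induction_on with
  | empty => simp [mixNorm_zero hp hr]
  | insert i S hi ih =>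
    simp only [Finset.sum_insert hi]
    exact (mixNorm_add_le hp hr (hF i) (Finset.measurable_fun_sum S fun j _ => hF j)).trans
      (add_le_add le_rfl ih)

/-- Fatou's lemma for the mixed norm. -/
lemma mixNorm_le_of_tendsto {p r : ℝ} (hp : 1 ≤ p) (hr : 1 ≤ r) {F : ℕ → ℝ → ℝ → ℂ}
    {F' : ℝ → ℝ → ℂ} (hF : ∀ m, Measurable fun z : ℝ × ℝ => F m z.1 z.2)
    (hlim : ∀ x t, Tendsto (fun m => F m x t) atTop (𝓝 (F' x t))) {K : ℝ≥0∞}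
    (hK : ∀ᶠ m in atTop, mixNorm p r (F m) ≤ K) : mixNorm p r F' ≤ K := by
  have hp0 : 0 < p := by linarith
  have hr0 : 0 < r := by linarith
  have h1 : ∀ x, ∫⁻ t in Set.Icc (1 : ℝ) 2, ‖F' x t‖ₑ ^ r ≤
      liminf (fun m => ∫⁻ t in Set.Icc (1 : ℝ) 2, ‖F m x t‖ₑ ^ r) atTop := by
    intro x
    refine le_trans (lintegral_mono fun t => ?_) (lintegral_liminf_le fun m =>
      ((hF m).comp measurable_prodMk_left).enorm.pow_const r)
    exact (((ENNReal.continuous_rpow_const.comp continuous_enorm).tendsto _).comp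
      (hlim x t)).liminf_eq.ge
  have hmono : ∀ q : ℝ, 0 ≤ q → ∀ u : ℕ → ℝ≥0∞,
      (liminf u atTop) ^ q = liminf (fun m => u m ^ q) atTop := fun q hq u =>
    (ENNReal.monotone_rpow_of_nonneg hq).map_liminf_of_continuousAt _
      ENNReal.continuous_rpow_const.continuousAt
  have h2 : ∫⁻ x, timeNorm r (F' x) ^ p ≤
      liminf (fun m => ∫⁻ x, timeNorm r (F m x) ^ p) atTop := by
    refine le_trans (lintegral_mono fun x => ?_) (lintegral_liminf_le fun m =>
      (measurable_timeNorm r (hF m)).pow_const p)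
    simp only [timeNorm]
    rw [← hmono p hp0.le (fun m => (∫⁻ t in Set.Icc (1 : ℝ) 2, ‖F m x t‖ₑ ^ r) ^ (1 / r)),
      ← hmono (1 / r) (by positivity)]
    exact ENNReal.rpow_le_rpow (ENNReal.rpow_le_rpow (h1 x) (by positivity)) hp0.le
  calc mixNorm p r F' ≤ (liminf (fun m => ∫⁻ x, timeNorm r (F m x) ^ p) atTop) ^ (1 / p) :=
        ENNReal.rpow_le_rpow h2 (by positivity)
    _ = liminf (fun m => mixNorm p r (F m)) atTop := hmono _ (by positivity) _
    _ ≤ K := liminf_le_of_frequently_le' hK.frequently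

/-- Reproduced functions satisfy a Nikolskii inequality. -/
lemma Reproduced.enorm_rpow_le {Φ : ℝ → ℂ} {G : ℝ → ℝ} {M : ℝ} (hΦ : IsReproducingKernel Φ G M)
    {w : ℝ} (hw : w ≠ 0) {h : ℝ → ℂ} (hh : Reproduced Φ w h) {p : ℝ} (hp : 1 < p) (t : ℝ) :
    ‖h t‖ₑ ^ p ≤ (∫⁻ u, ENNReal.ofReal (G u)) ^ (p - 1) * ENNReal.ofReal M * ENNReal.ofReal |w| *
      ∫⁻ s, ‖h s‖ₑ ^ p := by
  have hp0 : 0 < p := by linarith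
  have hc := hh.cont.measurable
  have hΦG : ∀ u, ‖Φ u‖ₑ ≤ ENNReal.ofReal (G u) := fun u => by
    rw [← ofReal_norm]
    have := hΦ.norm_le u 0 (by simp)
    rw [sub_zero] at this
    exact ENNReal.ofReal_le_ofReal this
  have h1 : ‖h t‖ₑ ≤ ∫⁻ u, ENNReal.ofReal (G u) * ‖h (t - u / w)‖ₑ := by
    conv_lhs => rw [hh.eq t]
    refine (enorm_integral_le_lintegral_enorm _).trans (lintegral_mono fun u => ?_)
    rw [enorm_mul]
    gcongr
    exact hΦG u
  have hm : Measurable fun u => ‖h (t - u / w)‖ₑ := by fun_prop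
  have h2 : ∫⁻ u, ‖h (t - u / w)‖ₑ ^ p = ENNReal.ofReal |w| * ∫⁻ s, ‖h s‖ₑ ^ p := by
    have e1 : ∫⁻ s, ‖h s‖ₑ ^ p = ∫⁻ s, ‖h (t - s)‖ₑ ^ p :=
      (lintegral_sub_left_eq_self (fun s => ‖h s‖ₑ ^ p) t).symm
    have e2 : Measure.map (fun u : ℝ => w⁻¹ * u) volume = ENNReal.ofReal |w| • volume := by
      have := Real.map_volume_mul_left (inv_ne_zero hw)
      rwa [inv_inv] at this
    rw [e1, ← smul_eq_mul, ← lintegral_smul_measure, ← e2, lintegral_map (by fun_prop)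
      (by fun_prop)]
    refine lintegral_congr fun u => ?_
    rw [div_eq_inv_mul]
  calc ‖h t‖ₑ ^ p ≤ (∫⁻ u, ENNReal.ofReal (G u) * ‖h (t - u / w)‖ₑ) ^ p := by gcongr
    _ ≤ (∫⁻ u, ENNReal.ofReal (G u)) ^ (p - 1) *
        ∫⁻ u, ENNReal.ofReal (G u) * ‖h (t - u / w)‖ₑ ^ p :=
      rpow_lintegral_mul_le _ hp hΦ.measurable_majorant.ennreal_ofReal.aemeasurable hm.aemeasurable
    _ ≤ (∫⁻ u, ENNReal.ofReal (G u)) ^ (p - 1) *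
        ∫⁻ u, ENNReal.ofReal M * ‖h (t - u / w)‖ₑ ^ p := by
      gcongr with u
      exact hΦ.majorant_le u
    _ = _ := by
      rw [lintegral_const_mul _ (hm.pow_const p), h2]
      ring

/-- Write `‖h‖^r = ‖h‖^{r-p} ‖h‖^p` and bound the first factor by the supremum estimate; the
exponent `(r - p)/(p r)` is `1/p - 1/r`. In the application `h` is `χ h'`, and the factor `2` comes
from `‖χ‖ ≥ 1/2` on `[1, 2]`. -/
lemma timeNorm_le_of_reproduced {Φ : ℝ → ℂ} {G : ℝ → ℝ} {M : ℝ} (hΦ : IsReproducingKernel Φ G M)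
    {w : ℝ} (hw : w ≠ 0) {h h' : ℝ → ℂ} (hh : Reproduced Φ w h) {p r : ℝ} (hp : 1 < p)
    (hpr : p ≤ r) (hh' : ∀ t ∈ Set.Icc (1 : ℝ) 2, ‖h' t‖ₑ ≤ 2 * ‖h t‖ₑ) :
    timeNorm r h' ≤ 2 * ((∫⁻ u, ENNReal.ofReal (G u)) ^ (p - 1) * ENNReal.ofReal M *
      ENNReal.ofReal |w|) ^ (1 / p - 1 / r) * (∫⁻ s, ‖h s‖ₑ ^ p) ^ (1 / p) := by
  have hp0 : 0 < p := by linarith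
  have hr0 : 0 < r := by linarith
  have hsub : 0 ≤ 1 / p - 1 / r := by
    rw [sub_nonneg]; exact one_div_le_one_div_of_le hp0 hpr
  set Y := ∫⁻ s, ‖h s‖ₑ ^ p with hY
  set A := (∫⁻ u, ENNReal.ofReal (G u)) ^ (p - 1) * ENNReal.ofReal M * ENNReal.ofReal |w| with hA
  have h1 : ∀ t ∈ Set.Icc (1 : ℝ) 2, ‖h' t‖ₑ ^ r ≤ (2 ^ r * (A * Y) ^ ((r - p) / p)) * ‖h t‖ₑ ^ p := by
    intro t ht
    calc ‖h' t‖ₑ ^ r ≤ (2 * ‖h t‖ₑ) ^ r := ENNReal.rpow_le_rpow (hh' t ht) hr0.le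
      _ = 2 ^ r * ((‖h t‖ₑ ^ p) ^ ((r - p) / p) * ‖h t‖ₑ ^ p) := by
        rw [ENNReal.mul_rpow_of_nonneg _ _ hr0.le, ← ENNReal.rpow_mul,
          show p * ((r - p) / p) = r - p by field_simp,
          ← ENNReal.rpow_add_of_nonneg _ _ (sub_nonneg.2 hpr) hp0.le, sub_add_cancel]
      _ ≤ 2 ^ r * ((A * Y) ^ ((r - p) / p) * ‖h t‖ₑ ^ p) := by
        have hq : 0 ≤ (r - p) / p := div_nonneg (by linarith) hp0.le
        gcongr
        exact hh.enorm_rpow_le hΦ hw hp t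
      _ = _ := by ring
  have h2 : ∫⁻ t in Set.Icc (1 : ℝ) 2, ‖h' t‖ₑ ^ r ≤ (2 ^ r * (A * Y) ^ ((r - p) / p)) * Y := by
    refine (setLIntegral_mono' measurableSet_Icc h1).trans ?_
    refine (setLIntegral_le_lintegral _ _).trans (le_of_eq ?_)
    rw [lintegral_const_mul _ (hh.cont.measurable.enorm.pow_const p)]
  calc timeNorm r h' ≤ ((2 ^ r * (A * Y) ^ ((r - p) / p)) * Y) ^ (1 / r) :=
        ENNReal.rpow_le_rpow h2 (by positivity)
    _ = _ := by
      have hr1 : 0 ≤ 1 / r := by positivity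
      rw [ENNReal.mul_rpow_of_nonneg _ _ hr1, ENNReal.mul_rpow_of_nonneg _ _ hr1,
        ← ENNReal.rpow_mul, ← ENNReal.rpow_mul, mul_one_div_cancel hr0.ne', ENNReal.rpow_one,
        show (r - p) / p * (1 / r) = 1 / p - 1 / r by field_simp,
        ENNReal.mul_rpow_of_nonneg _ _ hsub, mul_assoc, mul_assoc, mul_assoc,
        ← ENNReal.rpow_add_of_nonneg _ _ hsub hr1, sub_add_cancel]

lemma timeNorm_const_mul {r : ℝ} (hr : 0 < r) (c : ℂ) (h : ℝ → ℂ) :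
    timeNorm r (fun t => c * h t) = ‖c‖ₑ * timeNorm r h := by
  simp only [timeNorm, enorm_mul, ENNReal.mul_rpow_of_nonneg _ _ hr.le]
  rw [lintegral_const_mul' _ _ (ENNReal.rpow_ne_top_of_nonneg hr.le enorm_ne_top),
    ENNReal.mul_rpow_of_nonneg _ _ (by positivity), ← ENNReal.rpow_mul, mul_one_div_cancel hr.ne',
    ENNReal.rpow_one]

lemma mixNorm_const_mul {p r : ℝ} (hp : 0 < p) (hr : 0 < r) (c : ℂ) (F : ℝ → ℝ → ℂ) :
    mixNorm p r (fun x t => c * F x t) = ‖c‖ₑ * mixNorm p r F := by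
  simp only [mixNorm, timeNorm_const_mul hr, ENNReal.mul_rpow_of_nonneg _ _ hp.le]
  rw [lintegral_const_mul' _ _ (ENNReal.rpow_ne_top_of_nonneg hp.le enorm_ne_top),
    ENNReal.mul_rpow_of_nonneg _ _ (by positivity), ← ENNReal.rpow_mul, mul_one_div_cancel hp.ne',
    ENNReal.rpow_one]

lemma norm_superposition_le {φ g : ℝ → ℂ} (hφ : Integrable φ)
    (hg : ∀ y, g y = ∫ ξ, φ ξ * ec (ξ * y)) (y : ℝ) : ‖g y‖ ≤ ∫ ξ, ‖φ ξ‖ := by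
  rw [hg]
  exact norm_integral_le_of_norm_le hφ.norm (.of_forall fun ξ => by simp)

lemma norm_superposition_sub_le {φ g : ℝ → ℂ} (hφ : Integrable φ)
    (hg : ∀ y, g y = ∫ ξ, φ ξ * ec (ξ * y)) {R : ℝ} (hR : ∀ ξ, φ ξ ≠ 0 → |ξ| ≤ R) (x y : ℝ) :
    ‖g x - g y‖ ≤ (2 * Real.pi * R * ∫ ξ, ‖φ ξ‖) * |x - y| := by
  have hi : ∀ y, Integrable fun ξ => φ ξ * ec (ξ * y) := fun y =>
    hφ.mul_bdd (c := 1) (Continuous.aestronglyMeasurable (by fun_prop))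
      (.of_forall fun σ => by simp)
  rw [hg, hg, ← integral_sub (hi x) (hi y)]
  have hb : ∀ ξ, ‖φ ξ * ec (ξ * x) - φ ξ * ec (ξ * y)‖ ≤ (2 * Real.pi * R * |x - y|) * ‖φ ξ‖ := by
    intro ξ
    by_cases h0 : φ ξ = 0
    · simp [h0]
    rw [← mul_sub, norm_mul, mul_comm]
    refine mul_le_mul_of_nonneg_right ((norm_ec_sub_le _ _).trans ?_) (norm_nonneg _)
    rw [← mul_sub, abs_mul, ← mul_assoc]
    have := hR ξ h0
    gcongr
  refine (norm_integral_le_of_norm_le (hφ.norm.const_mul _) (.of_forall hb)).trans (le_of_eq ?_)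
  rw [integral_const_mul]
  ring

lemma continuous_of_lipschitz_bound {g : ℝ → ℂ} {L : ℝ} (hL : ∀ x y, ‖g x - g y‖ ≤ L * |x - y|) :
    Continuous g := by
  have hL0 : 0 ≤ L := by simpa using (norm_nonneg _).trans (hL 1 0)
  refine LipschitzWith.continuous (K := L.toNNReal) (LipschitzWith.of_dist_le_mul fun x y => ?_)
  rw [dist_eq_norm, Real.dist_eq, Real.coe_toNNReal _ hL0]
  exact hL x y

namespace Construction

variable {N : ℕ} (D : Construction N)

/-- Passage from the space-time `L^p` bound to the mixed norm for band-limited functions. -/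
lemma mixNorm_W_le {Φ : ℝ → ℂ} {G : ℝ → ℝ} {M : ℝ} (hΦ : IsReproducingKernel Φ G M)
    {ψ χ : ℝ → ℂ} (hχ : IsTimeCutoff ψ χ) {φ g : ℝ → ℂ} (hφ : Integrable φ)
    (hg : ∀ y, g y = ∫ ξ, φ ξ * ec (ξ * y)) (hgc : Continuous g) {R : ℝ} (hR1 : 1 ≤ R)
    (hR : ∀ ξ, φ ξ ≠ 0 → |ξ| ≤ R) {p r : ℝ} (hp : 1 < p) (hpr : p ≤ r) (m : ℕ) :
    mixNorm p r (fun x t => D.W m 0 1 fun y => g (x - t * y)) ≤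
      2 * ((∫⁻ u, ENNReal.ofReal (G u)) ^ (p - 1) * ENNReal.ofReal M *
        ENNReal.ofReal R) ^ (1 / p - 1 / r) * D.localNorm χ g p m 0 1 ^ (1 / p) := by
  have hp0 : 0 < p := by linarith
  set c := 2 * ((∫⁻ u, ENNReal.ofReal (G u)) ^ (p - 1) * ENNReal.ofReal M *
        ENNReal.ofReal R) ^ (1 / p - 1 / r) with hc
  -- All endpoints lie in `[1, 2]`, so the time frequencies are at most `1/16 + 2 R ≤ 6 R`.
  have hrep : ∀ x, Reproduced Φ R (fun t => χ t * D.W m 0 1 fun y => g (x - t * y)) := by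
    intro x
    have h1 : Reproduced Φ R (fun t => D.W m 0 1 fun y =>
        χ t * (ec (0 * t) * g (x + (-y) * t))) := by
      refine D.W_reproduced hΦ.integrable _ _ _ fun y hy => ?_
      refine reproduced_cutoff hΦ hχ hφ hg (by linarith) _ x _ fun σ hσ ξ hξ => ?_
      have h2 : |ξ * -y| ≤ R * 2 := by
        rw [abs_mul, abs_neg]
        have := hR ξ hξ
        have : |y| ≤ 2 := by
          have h4 := hy.1
          have h5 := hy.2
          norm_num at h5
          rw [abs_le]; constructor <;> linarith
        gcongr
      rw [abs_of_pos (by linarith : 0 < R), add_zero]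
      have := abs_add_le σ (ξ * -y)
      linarith
    convert h1 using 2 with t
    rw [D.W_const_mul, D.W_const_mul, zero_mul, ec_zero, one_mul]
    congr 2
    funext y
    congr 1; ring
  have hx : ∀ x, timeNorm r (fun t => D.W m 0 1 fun y => g (x - t * y)) ≤
      c * (∫⁻ t, ‖χ t * D.W m 0 1 fun y => g (x - t * y)‖ₑ ^ p) ^ (1 / p) := by
    intro x
    have h := timeNorm_le_of_reproduced (h' := fun t => D.W m 0 1 fun y => g (x - t * y)) hΦ
      (by linarith : R ≠ 0) (hrep x) hp hpr fun t ht => ?_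
    · rwa [abs_of_pos (by linarith : 0 < R)] at h
    · rw [enorm_mul, ← mul_assoc]
      refine le_mul_of_one_le_left' ?_
      have h1 := hχ.half_le t ht
      rw [← ofReal_norm, ← ENNReal.ofReal_ofNat 2, ← ENNReal.ofReal_mul (by norm_num)]
      rw [ENNReal.one_le_ofReal]
      linarith
  have hm : Measurable fun x => ∫⁻ t, ‖χ t * D.W m 0 1 fun y => g (x - t * y)‖ₑ ^ p := by
    have hcont : Continuous fun z : ℝ × ℝ => χ z.2 * D.W m 0 1 fun y => g (z.1 - z.2 * y) := by
      have := D.W_continuous (X := ℝ × ℝ) (H := fun y z => g (z.1 - z.2 * y))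
        (fun y => by fun_prop) m 0 1
      have := hχ.cont
      fun_prop
    exact (hcont.measurable.enorm.pow_const p).lintegral_prod_right'
  calc mixNorm p r (fun x t => D.W m 0 1 fun y => g (x - t * y))
      ≤ (∫⁻ x, c ^ p * ∫⁻ t, ‖χ t * D.W m 0 1 fun y => g (x - t * y)‖ₑ ^ p) ^ (1 / p) := by
        refine ENNReal.rpow_le_rpow (lintegral_mono fun x => ?_) (by positivity)
        refine (ENNReal.rpow_le_rpow (hx x) hp0.le).trans (le_of_eq ?_)
        rw [ENNReal.mul_rpow_of_nonneg _ _ hp0.le, ← ENNReal.rpow_mul, one_div_mul_cancel hp0.ne',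
          ENNReal.rpow_one]
    _ = _ := by
        rw [lintegral_const_mul _ hm, ENNReal.mul_rpow_of_nonneg _ _ (by positivity),
          ← ENNReal.rpow_mul, mul_one_div_cancel hp0.ne', ENNReal.rpow_one]
        rfl

/-- The mixed norm estimate for the averages of a band-limited function. -/
lemma mixNorm_average_le {Φ : ℝ → ℂ} {G : ℝ → ℝ} {M : ℝ} (hΦ : IsReproducingKernel Φ G M)
    {ψ χ : ℝ → ℂ} (hχ : IsTimeCutoff ψ χ) {φ g : ℝ → ℂ} (hφ : Integrable φ)
    (hg : ∀ y, g y = ∫ ξ, φ ξ * ec (ξ * y)) {R : ℝ} (hR1 : 1 ≤ R)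
    (hR : ∀ ξ, φ ξ ≠ 0 → |ξ| ≤ R) {p r : ℝ} (hp : 1 < p) (hpr : p ≤ r) {μ : Measure ℝ}
    (hμ : D.IsCantorMeasure μ) {B : ℝ≥0∞} {k : ℕ}
    (hB : ∀ i, D.localNorm χ g p (i + k) 0 1 ≤ (B ^ p * (D.N₀ : ℝ≥0∞) ^ (p / 2)) ^ k *
      (((D.N₀ : ℝ≥0∞) ^ p) ^ i * ((∫⁻ t, ‖χ t‖ₑ ^ p) * ∫⁻ x, ‖g x‖ₑ ^ p))) :
    mixNorm p r (fun x t => ∫ y, g (x - t * y) ∂μ) ≤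
      2 * ((∫⁻ u, ENNReal.ofReal (G u)) ^ (p - 1) * ENNReal.ofReal M *
        ENNReal.ofReal R) ^ (1 / p - 1 / r) * ((B * (D.N₀ : ℝ≥0∞) ^ (-(1 / 2) : ℝ)) ^ k *
        ((∫⁻ t, ‖χ t‖ₑ ^ p) ^ (1 / p) * (∫⁻ x, ‖g x‖ₑ ^ p) ^ (1 / p))) := by
  have hp0 : 0 < p := by linarith
  have hlip := norm_superposition_sub_le hφ hg hR
  have hgc := continuous_of_lipschitz_bound hlip
  refine mixNorm_le_of_tendsto (by linarith) (by linarith)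
    (F := fun m x t => ((D.N₀ : ℂ) ^ m)⁻¹ * D.W m 0 1 fun y => g (x - t * y)) (fun m => ?_)
    (fun x t => ?_) ?_
  · have := D.W_continuous (X := ℝ × ℝ) (H := fun y z => g (z.1 - z.2 * y))
      (fun y => by fun_prop) m 0 1
    exact Continuous.measurable (by fun_prop)
  · refine IsCantorMeasure.tendsto_W D hμ (fun y => norm_superposition_le hφ hg _)
      (L := (2 * Real.pi * R * ∫ ξ, ‖φ ξ‖) * |t|) fun y y' => ?_
    refine (hlip _ _).trans (le_of_eq ?_)
    rw [show x - t * y - (x - t * y') = -(t * (y - y')) by ring, abs_neg, abs_mul]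
    ring
  -- For `m = i + k` the normalization `N₀^{-(i+k)}` cancels the trivial factor `N₀^i` and turns
  -- `N₀^{k/2}` into `N₀^{-k/2}`. The bound does not depend on `i`, so it survives the limit.
  · refine eventually_atTop.2 ⟨k, fun m hm => ?_⟩
    obtain ⟨i, rfl⟩ := Nat.exists_eq_add_of_le' hm
    rw [mixNorm_const_mul hp0 (by linarith)]
    have h1 := D.mixNorm_W_le hΦ hχ hφ hg hgc hR1 hR hp hpr (i + k)
    refine (mul_le_mul_right (h1.trans (mul_le_mul_right
      (ENNReal.rpow_le_rpow (hB i) (by positivity)) _)) _).trans (le_of_eq ?_)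
    set n : ℝ≥0∞ := (D.N₀ : ℝ≥0∞) with hn
    have hn0 : n ≠ 0 := by simpa [hn] using D.N₀_pos.ne'
    have hnt : n ≠ ⊤ := ENNReal.natCast_ne_top _
    have hp' : 0 ≤ 1 / p := by positivity
    have e1 : ‖((D.N₀ : ℂ) ^ (i + k))⁻¹‖ₑ = n⁻¹ ^ k * n⁻¹ ^ i := by
      have h3 : (D.N₀ : ℂ) ≠ 0 := by exact_mod_cast D.N₀_pos.ne'
      have h4 : ‖(D.N₀ : ℂ)‖ₑ = n := by
        rw [← ofReal_norm, Complex.norm_natCast, ENNReal.ofReal_natCast]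
      rw [enorm_inv (pow_ne_zero _ h3), enorm_pow, h4, ENNReal.inv_pow, pow_add, mul_comm]
    have hpow : ∀ (x : ℝ≥0∞) (j : ℕ), (x ^ j) ^ (1 / p) = (x ^ (1 / p)) ^ j := fun x j => by
      rw [← ENNReal.rpow_natCast, ← ENNReal.rpow_mul, mul_comm, ENNReal.rpow_mul,
        ENNReal.rpow_natCast]
    have e2 : ((B ^ p * n ^ (p / 2)) ^ k * ((n ^ p) ^ i * ((∫⁻ t, ‖χ t‖ₑ ^ p) *
        ∫⁻ x, ‖g x‖ₑ ^ p))) ^ (1 / p) = (B * n ^ (1 / 2 : ℝ)) ^ k * (n ^ i *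
        ((∫⁻ t, ‖χ t‖ₑ ^ p) ^ (1 / p) * (∫⁻ x, ‖g x‖ₑ ^ p) ^ (1 / p))) := by
      simp only [ENNReal.mul_rpow_of_nonneg _ _ hp', hpow]
      rw [← ENNReal.rpow_mul, ← ENNReal.rpow_mul, ← ENNReal.rpow_mul, mul_one_div_cancel hp0.ne',
        ENNReal.rpow_one, ENNReal.rpow_one, show p / 2 * (1 / p) = 1 / 2 by field_simp]
    have e3 : n ^ (-(1 / 2) : ℝ) = n⁻¹ * n ^ (1 / 2 : ℝ) := by
      rw [← ENNReal.rpow_neg_one, ← ENNReal.rpow_add _ _ hn0 hnt]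
      norm_num
    have e4 : n⁻¹ ^ i * n ^ i = 1 := by
      rw [← mul_pow, ENNReal.inv_mul_cancel hn0 hnt, one_pow]
    rw [e1, e2, e3]
    calc _ = (n⁻¹ ^ i * n ^ i) * (2 * ((∫⁻ u, ENNReal.ofReal (G u)) ^ (p - 1) * ENNReal.ofReal M *
        ENNReal.ofReal R) ^ (1 / p - 1 / r) * ((n⁻¹ ^ k * (B * n ^ (1 / 2 : ℝ)) ^ k) *
        ((∫⁻ t, ‖χ t‖ₑ ^ p) ^ (1 / p) * (∫⁻ x, ‖g x‖ₑ ^ p) ^ (1 / p)))) := by ring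
      _ = _ := by
        rw [e4, one_mul, ← mul_pow, mul_left_comm n⁻¹ B]

end Construction

/-! ### Fourier multipliers with integrable kernels. -/

/-- The kernel `x ↦ ∫ m(ξ) e^{2πi ξ x} dξ` of a multiplier `m`. -/
def kernel (m : ℝ → ℂ) (x : ℝ) : ℂ := ∫ ξ, m ξ * ec (ξ * x)

lemma continuous_kernel {m : ℝ → ℂ} (hm : Integrable m) : Continuous (kernel m) :=
  continuous_of_dominated
    (fun _ => hm.aestronglyMeasurable.mul (Continuous.aestronglyMeasurable (by fun_prop)))
    (fun x => .of_forall fun ξ => show ‖m ξ * ec (ξ * x)‖ ≤ ‖m ξ‖ by simp) hm.norm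
    (.of_forall fun ξ => by fun_prop)

/-- A Fourier multiplier with integrable kernel is bounded on `L^p`. -/
lemma lintegral_multiplier_le {m : ℝ → ℂ} (hm : Integrable m) (f : SchwartzMap ℝ ℂ) {p : ℝ}
    (hp : 1 < p) :
    ∫⁻ x, ‖kernel (fun ξ => m ξ * 𝓕 (f : ℝ → ℂ) ξ) x‖ₑ ^ p ≤
      (∫⁻ x, ‖kernel m x‖ₑ) ^ p * ∫⁻ x, ‖f x‖ₑ ^ p := by
  have hp0 : 0 ≤ p := by linarith
  have hk := (continuous_kernel hm).measurable.enorm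
  have hf := f.continuous.measurable.enorm
  refine le_trans (lintegral_mono fun x => ?_) (lintegral_rpow_lconvolution_le hp hk hf)
  refine ENNReal.rpow_le_rpow ?_ hp0
  have e1 : kernel (fun ξ => m ξ * 𝓕 (f : ℝ → ℂ) ξ) x = ∫ v, f v * kernel m (x - v) := by
    simp only [kernel]
    have e2 : ∀ ξ, m ξ * 𝓕 (f : ℝ → ℂ) ξ * ec (ξ * x) =
        ∫ v, m ξ * (f v * ec (ξ * (x - v))) := by
      intro ξ
      rw [integral_const_mul, ec_fourier, mul_assoc, ← integral_mul_const]
      congr 1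
      refine integral_congr_ae (.of_forall fun v => ?_)
      simp only
      rw [show ξ * (x - v) = -(ξ * v) + ξ * x by ring, ec_add]
      ring
    simp_rw [e2]
    rw [integral_integral_swap]
    · refine integral_congr_ae (.of_forall fun v => ?_)
      simp only
      rw [← integral_const_mul]
      refine integral_congr_ae (.of_forall fun ξ => ?_)
      simp only
      ring
    · refine (hm.mul_prod f.integrable).mono ?_ (.of_forall fun z => ?_)
      · refine hm.aestronglyMeasurable.comp_fst.mul (f.integrable.aestronglyMeasurable.comp_snd.mul ?_)
        exact Continuous.aestronglyMeasurable (by fun_prop)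
      · simp [Function.uncurry]
  rw [e1]
  refine (enorm_integral_le_lintegral_enorm _).trans (le_of_eq ?_)
  rw [← lintegral_sub_left_eq_self _ x]
  refine lintegral_congr fun u => ?_
  rw [enorm_mul, sub_sub_cancel, mul_comm]

lemma kernel_deriv {q q1 : ℝ → ℂ} (hq : ∀ ξ, HasDerivAt q (q1 ξ) ξ) (hi : Integrable q)
    (hi1 : Integrable q1) (x : ℝ) :
    kernel q1 x = -(2 * Real.pi * Complex.I * x) * kernel q x := by
  have hd : deriv q = q1 := funext fun ξ => (hq ξ).deriv
  have h := congrFun (Real.fourier_deriv hi (fun ξ => (hq ξ).differentiableAt)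
    (by rwa [hd])) (-x)
  have e : ∀ m : ℝ → ℂ, 𝓕 m (-x) = kernel m x := fun m => by
    rw [ec_fourier, kernel]
    refine integral_congr_ae (.of_forall fun ξ => ?_)
    simp only
    congr 2; ring
  rw [hd, e, e, smul_eq_mul] at h
  rw [h]; push_cast; ring

/-- The kernel of a compactly supported `C²` multiplier is integrable, with an explicit bound. -/
lemma lintegral_kernel_le {q q1 q2 : ℝ → ℂ} (hq : ∀ ξ, HasDerivAt q (q1 ξ) ξ)
    (hq1 : ∀ ξ, HasDerivAt q1 (q2 ξ) ξ) (hq2 : Continuous q2) {Q : ℝ} (hQ : ∀ ξ, ‖q ξ‖ ≤ Q)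
    (hQ2 : ∀ ξ, ‖q2 ξ‖ ≤ Q) (hs : ∀ ξ, ξ ∉ Set.Icc (-4 : ℝ) 4 → q ξ = 0 ∧ q1 ξ = 0 ∧ q2 ξ = 0) :
    ∫⁻ x, ‖kernel q x‖ₑ ≤ ENNReal.ofReal (16 * Q) * ∫⁻ x : ℝ, ENNReal.ofReal ((1 + x ^ 2)⁻¹) := by
  have hQ0 : 0 ≤ Q := (norm_nonneg _).trans (hQ 0)
  have hqc : Continuous q := continuous_iff_continuousAt.2 fun ξ => (hq ξ).continuousAt
  have hq1c : Continuous q1 := continuous_iff_continuousAt.2 fun ξ => (hq1 ξ).continuousAt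
  have hint : ∀ m : ℝ → ℂ, Continuous m → (∀ ξ, ξ ∉ Set.Icc (-4 : ℝ) 4 → m ξ = 0) →
      Integrable m := fun m hm h0 =>
    hm.integrable_of_hasCompactSupport (HasCompactSupport.intro isCompact_Icc h0)
  have hi := hint q hqc fun ξ h => (hs ξ h).1
  have hi1 := hint q1 hq1c fun ξ h => (hs ξ h).2.1
  have hi2 := hint q2 hq2 fun ξ h => (hs ξ h).2.2
  have hb : ∀ m : ℝ → ℂ, (∀ ξ, ‖m ξ‖ ≤ Q) → (∀ ξ, ξ ∉ Set.Icc (-4 : ℝ) 4 → m ξ = 0) →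
      ∀ x, ‖kernel m x‖ ≤ 8 * Q := by
    intro m hmQ hm0 x
    have e : kernel m x = ∫ ξ in Set.Icc (-4 : ℝ) 4, m ξ * ec (ξ * x) := by
      rw [kernel, setIntegral_eq_integral_of_forall_compl_eq_zero]
      intro ξ hξ
      rw [hm0 ξ hξ, zero_mul]
    rw [e]
    refine (norm_setIntegral_le_of_norm_le_const (C := Q) (by simp) fun ξ _ => ?_).trans
      (le_of_eq ?_)
    · simpa using hmQ ξ
    · norm_num [Real.volume_real_Icc]; ring
  have hpt : ∀ x, ‖kernel q x‖ ≤ 16 * Q * (1 + x ^ 2)⁻¹ := by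
    intro x
    rw [← div_eq_mul_inv, le_div_iff₀ (by positivity)]
    have h0 := hb q hQ (fun ξ h => (hs ξ h).1) x
    have h2 := hb q2 hQ2 (fun ξ h => (hs ξ h).2.2) x
    rw [kernel_deriv hq1 hi1 hi2, kernel_deriv hq hi hi1] at h2
    simp only [norm_mul, norm_neg, Complex.norm_I, mul_one, Complex.norm_real, Complex.norm_ofNat,
      Real.norm_eq_abs, abs_of_pos Real.pi_pos] at h2
    -- The kernel of `q2` has modulus `4π² x²` times that of `q`, and `4π² ≥ 1` is discarded. Here
    -- `8` is the length of `[-4, 4]`; adding the bound `8 Q` for `kernel q` itself gives `16 Q`.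
    have h3 : x ^ 2 * ‖kernel q x‖ ≤ 8 * Q := by
      refine le_trans ?_ h2
      have : 2 * Real.pi * |x| * (2 * Real.pi * |x| * ‖kernel q x‖) =
          (4 * Real.pi ^ 2) * (x ^ 2 * ‖kernel q x‖) := by
        rw [← sq_abs x]; ring
      rw [this]
      refine le_mul_of_one_le_left (by positivity) ?_
      nlinarith [Real.pi_gt_three]
    linarith
  rw [← lintegral_const_mul _ (by fun_prop)]
  refine lintegral_mono fun x => ?_
  rw [← ofReal_norm, ← ENNReal.ofReal_mul (by positivity)]
  exact ENNReal.ofReal_le_ofReal (hpt x)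

/-- Scaling of kernels. -/
lemma lintegral_kernel_scale {m q : ℝ → ℂ} {l : ℝ} (hl : l ≠ 0) {c : ℂ}
    (hmq : ∀ ξ, m ξ = c * q (ξ / l)) :
    ∫⁻ x, ‖kernel m x‖ₑ = ‖c‖ₑ * ∫⁻ x, ‖kernel q x‖ₑ := by
  have e : ∀ x, kernel m x = c * (|l| * kernel q (l * x)) := by
    intro x
    have h1 : kernel m x = c * ∫ ξ, q (ξ / l) * ec (ξ / l * (l * x)) := by
      rw [kernel, ← integral_const_mul]
      refine integral_congr_ae (.of_forall fun ξ => ?_)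
      simp only
      rw [hmq, mul_assoc, show ξ / l * (l * x) = ξ * x by field_simp]
    rw [h1, Measure.integral_comp_div (fun u => q u * ec (u * (l * x))) l, kernel,
      Complex.real_smul]
  simp_rw [e]
  have e2 : ∀ x, ‖c * (|l| * kernel q (l * x))‖ₑ =
      ‖c‖ₑ * (ENNReal.ofReal |l| * ‖kernel q (l * x)‖ₑ) := by
    intro x
    rw [enorm_mul, enorm_mul]
    congr 2
    rw [← ofReal_norm, Complex.norm_real, Real.norm_eq_abs, abs_abs]
  simp_rw [e2]
  rw [lintegral_const_mul' _ _ enorm_ne_top, lintegral_const_mul' _ _ ENNReal.ofReal_ne_top]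
  congr 1
  have h2 := Real.map_volume_mul_left hl
  have h3 : ∫⁻ x, ‖kernel q (l * x)‖ₑ = ∫⁻ y, ‖kernel q y‖ₑ ∂(Measure.map (l * ·) volume) :=
    ((Homeomorph.mulLeft₀ l hl).measurableEmbedding.lintegral_map (μ := volume)
      (fun y => ‖kernel q y‖ₑ)).symm
  rw [h3, h2, lintegral_smul_measure, smul_eq_mul, ← mul_assoc, ← ENNReal.ofReal_mul (abs_nonneg _),
    abs_inv, mul_inv_cancel₀ (abs_pos.2 hl).ne', ENNReal.ofReal_one, one_mul]

/-! ### The frequency partition with ratio `1 + 1/N`. -/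

/-- A smooth step: zero for `ξ ≤ 1` and one for `ξ ≥ 1 + 1/N`. -/
def step (N : ℕ) (ξ : ℝ) : ℝ := Real.smoothTransition (N * (ξ - 1))

/-- The ratio `1 + 1/N` of consecutive frequency scales. -/
def ratio (N : ℕ) : ℝ := 1 + 1 / N

/-- A smooth bump supported in `[1, (1 + 1/N)²]`, the difference of consecutive steps. -/
def bump (N : ℕ) (ξ : ℝ) : ℝ := step N ξ - step N (ξ / ratio N)

lemma ratio_pos (N : ℕ) : 0 < ratio N := by unfold ratio; positivity

lemma one_le_ratio (N : ℕ) : 1 ≤ ratio N := by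
  unfold ratio; have : (0 : ℝ) ≤ 1 / N := by positivity
  linarith

lemma contDiff_step (N : ℕ) : ContDiff ℝ 2 (step N) := by
  unfold step
  exact Real.smoothTransition.contDiff.comp (by fun_prop)

lemma contDiff_bump (N : ℕ) : ContDiff ℝ 2 (bump N) := by
  have h := contDiff_step N
  have h2 : ContDiff ℝ 2 fun ξ => step N (ξ / ratio N) := h.comp (by fun_prop)
  exact h.sub h2

lemma step_of_le {N : ℕ} {ξ : ℝ} (h : ξ ≤ 1) : step N ξ = 0 :=
  Real.smoothTransition.zero_of_nonpos (mul_nonpos_of_nonneg_of_nonpos (by positivity) (by linarith))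

lemma step_of_ge {N : ℕ} (hN : 0 < N) {ξ : ℝ} (h : ratio N ≤ ξ) : step N ξ = 1 := by
  refine Real.smoothTransition.one_of_one_le ?_
  have hN' : (0 : ℝ) < N := by exact_mod_cast hN
  unfold ratio at h
  have : (N : ℝ) * (1 / N) = 1 := by field_simp
  nlinarith

lemma bump_of_le {N : ℕ} {ξ : ℝ} (h : ξ ≤ 1) : bump N ξ = 0 := by
  have h1 : ξ / ratio N ≤ 1 := by
    rw [div_le_one (ratio_pos N)]; exact h.trans (one_le_ratio N)
  rw [bump, step_of_le h, step_of_le h1, sub_zero]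

lemma bump_of_ge {N : ℕ} (hN : 0 < N) {ξ : ℝ} (h : ratio N ^ 2 ≤ ξ) : bump N ξ = 0 := by
  have h1 : ratio N ≤ ξ / ratio N := by
    rw [le_div_iff₀ (ratio_pos N), ← sq]; exact h
  have h2 : ratio N ≤ ξ := by nlinarith [one_le_ratio N]
  rw [bump, step_of_ge hN h1, step_of_ge hN h2, sub_self]

lemma ratio_le_two {N : ℕ} (hN : 0 < N) : ratio N ≤ 2 := by
  have : (1 : ℝ) / N ≤ 1 := by
    rw [div_le_one (by exact_mod_cast hN)]; exact_mod_cast hN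
  unfold ratio; linarith

/-- Since `(1 + 1/N)² - 1 ≤ 3/N`, each piece is as narrow as `localNorm_succ_le` requires. This is
why the ratio of scales is `1 + 1/N` and not `2`. Negative `l` covers the negative frequencies. -/
lemma abs_sub_le_of_bump_ne_zero {N : ℕ} (hN : 0 < N) {l ξ : ℝ} (hl : l ≠ 0)
    (h : bump N (ξ / l) ≠ 0) : |ξ - l| ≤ 3 * |l| / N := by
  have h1 : 1 < ξ / l := by by_contra h0; exact h (bump_of_le (not_lt.1 h0))
  have h2 : ξ / l < ratio N ^ 2 := by by_contra h0; exact h (bump_of_ge hN (not_lt.1 h0))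
  have e : ξ - l = (ξ / l - 1) * l := by field_simp
  have hN' : (1 : ℝ) ≤ N := by exact_mod_cast hN
  have h3 : ratio N ^ 2 - 1 ≤ 3 / N := by
    unfold ratio
    have h4 : (1 : ℝ) / N * (1 / N) ≤ 1 / N := by
      refine mul_le_of_le_one_left (by positivity) ?_
      rw [div_le_one (by linarith)]; exact hN'
    have : (3 : ℝ) / N = 3 * (1 / N) := by ring
    nlinarith
  rw [e, abs_mul, abs_of_pos (by linarith), mul_div_right_comm]
  refine mul_le_mul_of_nonneg_right (by linarith) (abs_nonneg _)

/-- The low-frequency part of the partition of unity. -/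
def lowStep (N : ℕ) (ξ : ℝ) : ℝ := 1 - step N ξ - step N (-ξ)

lemma contDiff_lowStep (N : ℕ) : ContDiff ℝ 2 (lowStep N) := by
  have h := contDiff_step N
  have h2 : ContDiff ℝ 2 fun ξ => step N (-ξ) := h.comp (by fun_prop)
  exact (contDiff_const.sub h).sub h2

lemma lowStep_of_le {N : ℕ} {ξ : ℝ} (h : |ξ| ≤ 1) : lowStep N ξ = 1 := by
  rw [lowStep, step_of_le (abs_le.1 h).2, step_of_le (by linarith [(abs_le.1 h).1])]; simp

lemma lowStep_of_ge {N : ℕ} (hN : 0 < N) {ξ : ℝ} (h : ratio N ≤ |ξ|) : lowStep N ξ = 0 := by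
  have h1 := one_le_ratio N
  rcases le_abs.1 h with h | h
  · rw [lowStep, step_of_ge hN h, step_of_le (by linarith : -ξ ≤ 1)]; simp
  · rw [lowStep, step_of_ge hN h, step_of_le (by linarith : ξ ≤ 1)]; simp

lemma abs_step_le (N : ℕ) (ξ : ℝ) : |step N ξ| ≤ 1 := by
  rw [step, abs_of_nonneg (Real.smoothTransition.nonneg _)]
  exact Real.smoothTransition.le_one _

lemma abs_lowStep_le (N : ℕ) (ξ : ℝ) : |lowStep N ξ| ≤ 3 := by
  have h1 := abs_le.1 (abs_step_le N ξ)
  have h2 := abs_le.1 (abs_step_le N (-ξ))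
  rw [lowStep, abs_le]
  constructor <;> linarith

/-- The telescoping partition of unity. -/
lemma lowStep_scale (N M : ℕ) (ξ : ℝ) :
    lowStep N (ξ / ratio N ^ M) = lowStep N ξ + ∑ n ∈ Finset.range M,
      (bump N (ξ / ratio N ^ n) + bump N (ξ / -ratio N ^ n)) := by
  induction M with
  | zero => simp
  | succ M ih =>
    rw [Finset.sum_range_succ, ← add_assoc, ← ih]
    have hr := ratio_pos N
    simp only [lowStep, bump]
    have e1 : ξ / ratio N ^ M / ratio N = ξ / ratio N ^ (M + 1) := by rw [pow_succ]; field_simp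
    -- The term `-ratio N ^ M` means `-(ratio N ^ M)`, whatever the parity of `M`.
    have e2 : ξ / -ratio N ^ M / ratio N = -(ξ / ratio N ^ (M + 1)) := by
      rw [pow_succ, div_neg]; field_simp
    rw [e1, e2, div_neg]
    ring

/-! ### Kernel bounds for the localized Bessel symbols. -/

lemma exists_bound_of_contDiff_two {b : ℝ → ℝ} (hb : ContDiff ℝ 2 b)
    {c d : ℝ} (hs : ∀ ξ, ξ ∉ Set.Icc c d → b ξ = 0) :
    ∃ A, 0 ≤ A ∧ ∀ ξ, |b ξ| ≤ A ∧ |deriv b ξ| ≤ A ∧ |deriv (deriv b) ξ| ≤ A := by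
  have hc : HasCompactSupport b := HasCompactSupport.intro isCompact_Icc hs
  have hd : ContDiff ℝ 1 (deriv b) := ContDiff.deriv' (n := 1) (by rw [one_add_one_eq_two]; exact hb)
  obtain ⟨A0, h0⟩ := hc.exists_bound_of_continuous hb.continuous
  obtain ⟨A1, h1⟩ := hc.deriv.exists_bound_of_continuous hd.continuous
  obtain ⟨A2, h2⟩ := hc.deriv.deriv.exists_bound_of_continuous
    (ContDiff.continuous_deriv hd le_rfl)
  refine ⟨max A0 (max A1 A2), ?_, fun ξ => ⟨?_, ?_, ?_⟩⟩
  · exact ((norm_nonneg _).trans (h0 0)).trans (le_max_left _ _)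
  · exact (h0 ξ).trans (le_max_left _ _)
  · exact (h1 ξ).trans ((le_max_left _ _).trans (le_max_right _ _))
  · exact (h2 ξ).trans ((le_max_right _ _).trans (le_max_right _ _))

/-- The number `17 = 1 + 4²` bounds `ε + ξ²` for `ε ≤ 1` and `ξ ∈ [1, 4]`; the absolute value admits
exponents of either sign. -/
lemma rpow_le_of_mem {u : ℝ} (h1 : 1 ≤ u) (h2 : u ≤ 17) (s : ℝ) : u ^ s ≤ 17 ^ |s| :=
  (Real.rpow_le_rpow_of_exponent_le h1 (le_abs_self s)).trans
    (Real.rpow_le_rpow (by linarith) h2 (abs_nonneg s))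

/-- Uniform bounds for the symbols `b(ξ) (ε + ξ²)^s` with `b` supported in `[1, 4]`. -/
lemma exists_symbol_kernel_bound {b : ℝ → ℝ} (hb : ContDiff ℝ 2 b)
    (hs : ∀ ξ, ξ ∉ Set.Icc (1 : ℝ) 4 → b ξ = 0) (s : ℝ) :
    ∃ K : ℝ, ∀ ε : ℝ, 0 < ε → ε ≤ 1 →
      ∫⁻ x, ‖kernel (fun ξ => ((b ξ * (ε + ξ ^ 2) ^ s : ℝ) : ℂ)) x‖ₑ ≤ ENNReal.ofReal K := by
  obtain ⟨A, hA, hAb⟩ := exists_bound_of_contDiff_two hb hs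
  have hd : ContDiff ℝ 1 (deriv b) := ContDiff.deriv' (n := 1) (by rw [one_add_one_eq_two]; exact hb)
  have hdb : ∀ ξ, HasDerivAt b (deriv b ξ) ξ := fun ξ =>
    (hb.differentiable (by norm_num) ξ).hasDerivAt
  have hddb : ∀ ξ, HasDerivAt (deriv b) (deriv (deriv b) ξ) ξ := fun ξ =>
    (hd.differentiable (by norm_num) ξ).hasDerivAt
  have hts : tsupport b ⊆ Set.Icc 1 4 := closure_minimal
    (fun ξ hξ => by by_contra h; exact hξ (hs ξ h)) isClosed_Icc
  have hz1 : ∀ ξ, ξ ∉ Set.Icc (1 : ℝ) 4 → deriv b ξ = 0 := fun ξ hξ =>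
    image_eq_zero_of_notMem_tsupport fun h => hξ (hts (tsupport_deriv_subset h))
  have hz2 : ∀ ξ, ξ ∉ Set.Icc (1 : ℝ) 4 → deriv (deriv b) ξ = 0 := fun ξ hξ =>
    image_eq_zero_of_notMem_tsupport fun h =>
      hξ (hts (tsupport_deriv_subset (tsupport_deriv_subset h)))
  set T0 : ℝ := 17 ^ |s|
  set T1 : ℝ := 17 ^ |s - 1|
  set T2 : ℝ := 17 ^ |s - 2|
  have hT0 : 0 ≤ T0 := by positivity
  have hT1 : 0 ≤ T1 := by positivity
  have hT2 : 0 ≤ T2 := by positivity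
  set H1 : ℝ := 8 * |s| * T1
  set H2 : ℝ := 2 * |s| * T1 + 64 * |s| * |s - 1| * T2
  have hH1 : 0 ≤ H1 := by positivity
  have hH2 : 0 ≤ H2 := by positivity
  -- The Leibniz bound for the second derivative of `b(ξ) (ε + ξ²)^s`: `A` bounds `b`, `b'`, `b''`,
  -- while `T0`, `H1`, `H2` bound the power and its first two derivatives on `[1, 4]`, uniformly in
  -- `ε`.
  set Q : ℝ := A * T0 + 2 * A * H1 + A * H2
  have hI : ∫⁻ x : ℝ, ENNReal.ofReal ((1 + x ^ 2)⁻¹) ≠ ⊤ := by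
    have h := (integrable_inv_one_add_sq).hasFiniteIntegral
    rw [hasFiniteIntegral_iff_ofReal (.of_forall fun x => by positivity)] at h
    exact h.ne
  refine ⟨(16 * Q) * (∫⁻ x : ℝ, ENNReal.ofReal ((1 + x ^ 2)⁻¹)).toReal, fun ε hε hε1 => ?_⟩
  have hu : ∀ ξ : ℝ, 0 < ε + ξ ^ 2 := fun ξ => by positivity
  have hdu : ∀ ξ : ℝ, HasDerivAt (fun ξ : ℝ => ε + ξ ^ 2) (2 * ξ) ξ := fun ξ => by
    simpa using (hasDerivAt_pow 2 ξ).const_add ε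
  have hdr : ∀ (s ξ : ℝ), HasDerivAt (fun ξ : ℝ => (ε + ξ ^ 2) ^ s)
      (2 * ξ * s * (ε + ξ ^ 2) ^ (s - 1)) ξ := fun s ξ =>
    (hdu ξ).rpow_const (Or.inl (hu ξ).ne')
  set h1 : ℝ → ℝ := fun ξ => 2 * ξ * s * (ε + ξ ^ 2) ^ (s - 1) with hh1
  set h2 : ℝ → ℝ := fun ξ => 2 * s * (ε + ξ ^ 2) ^ (s - 1) +
    2 * ξ * s * (2 * ξ * (s - 1) * (ε + ξ ^ 2) ^ (s - 2)) with hh2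
  have hd1 : ∀ ξ, HasDerivAt h1 (h2 ξ) ξ := fun ξ => by
    have h3 := (((hasDerivAt_id ξ).const_mul 2).mul_const s).mul (hdr (s - 1) ξ)
    rw [show s - 1 - 1 = s - 2 by ring, mul_one] at h3
    exact h3
  have hcu : ∀ s : ℝ, Continuous fun ξ : ℝ => (ε + ξ ^ 2) ^ s := fun s =>
    Continuous.rpow_const (by fun_prop) fun ξ => Or.inl (hu ξ).ne'
  have hbnd : ∀ ξ ∈ Set.Icc (1 : ℝ) 4, |(ε + ξ ^ 2) ^ s| ≤ T0 ∧ |h1 ξ| ≤ H1 ∧ |h2 ξ| ≤ H2 := by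
    intro ξ hξ
    have a1 : 1 ≤ ε + ξ ^ 2 := by nlinarith [hξ.1]
    have a2 : ε + ξ ^ 2 ≤ 17 := by nlinarith [hξ.1, hξ.2]
    have b0 := rpow_le_of_mem a1 a2 s
    have b1 := rpow_le_of_mem a1 a2 (s - 1)
    have b2 := rpow_le_of_mem a1 a2 (s - 2)
    have c0 : ∀ s : ℝ, 0 ≤ (ε + ξ ^ 2) ^ s := fun s => (Real.rpow_pos_of_pos (hu ξ) s).le
    have hξ0 : 0 ≤ ξ := by linarith [hξ.1]
    have hξ4 := hξ.2
    refine ⟨by rwa [abs_of_nonneg (c0 s)], ?_, ?_⟩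
    · rw [hh1]
      simp only [abs_mul, abs_of_nonneg (c0 _), abs_of_nonneg hξ0, abs_two]
      calc 2 * ξ * |s| * (ε + ξ ^ 2) ^ (s - 1) ≤ 2 * 4 * |s| * T1 := by gcongr
        _ = H1 := by ring
    · rw [hh2]
      refine (abs_add_le _ _).trans ?_
      simp only [abs_mul, abs_of_nonneg (c0 _), abs_of_nonneg hξ0, abs_two]
      calc 2 * |s| * (ε + ξ ^ 2) ^ (s - 1) + 2 * ξ * |s| * (2 * ξ * |s - 1| * (ε + ξ ^ 2) ^ (s - 2))
          ≤ 2 * |s| * T1 + 2 * 4 * |s| * (2 * 4 * |s - 1| * T2) := by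
            have := c0 (s - 2)
            gcongr
        _ = H2 := by ring
  set q : ℝ → ℝ := fun ξ => b ξ * (ε + ξ ^ 2) ^ s with hq
  set q1 : ℝ → ℝ := fun ξ => deriv b ξ * (ε + ξ ^ 2) ^ s + b ξ * h1 ξ with hq1
  set q2 : ℝ → ℝ := fun ξ => (deriv (deriv b) ξ * (ε + ξ ^ 2) ^ s + deriv b ξ * h1 ξ) +
    (deriv b ξ * h1 ξ + b ξ * h2 ξ) with hq2
  have hdq : ∀ ξ, HasDerivAt q (q1 ξ) ξ := fun ξ => (hdb ξ).mul (hdr s ξ)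
  have hdq1 : ∀ ξ, HasDerivAt q1 (q2 ξ) ξ := fun ξ =>
    ((hddb ξ).mul (hdr s ξ)).add ((hdb ξ).mul (hd1 ξ))
  have hzero : ∀ ξ, ξ ∉ Set.Icc (1 : ℝ) 4 → q ξ = 0 ∧ q1 ξ = 0 ∧ q2 ξ = 0 := fun ξ hξ => by
    simp [hq, hq1, hq2, hs ξ hξ, hz1 ξ hξ, hz2 ξ hξ]
  have hQ : ∀ ξ, |q ξ| ≤ Q ∧ |q2 ξ| ≤ Q := by
    intro ξ
    by_cases hξ : ξ ∈ Set.Icc (1 : ℝ) 4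
    · obtain ⟨e0, e1, e2⟩ := hbnd ξ hξ
      obtain ⟨f0, f1, f2⟩ := hAb ξ
      constructor
      · rw [hq]
        simp only [abs_mul]
        calc |b ξ| * |(ε + ξ ^ 2) ^ s| ≤ A * T0 := by gcongr
          _ ≤ Q := by
            have : 0 ≤ 2 * A * H1 + A * H2 := by positivity
            simp only [Q]; linarith
      · rw [hq2]
        refine (abs_add_le _ _).trans ((add_le_add (abs_add_le _ _) (abs_add_le _ _)).trans ?_)
        simp only [abs_mul]
        calc _ ≤ A * T0 + A * H1 + (A * H1 + A * H2) := by gcongr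
          _ = Q := by simp only [Q]; ring
    · obtain ⟨z0, -, z2⟩ := hzero ξ hξ
      rw [z0, z2, abs_zero]
      have : 0 ≤ Q := by positivity
      exact ⟨this, this⟩
  have hmem : ∀ ξ, ξ ∉ Set.Icc (-4 : ℝ) 4 → ξ ∉ Set.Icc (1 : ℝ) 4 := fun ξ h h' =>
    h ⟨by linarith [h'.1], h'.2⟩
  have hb1 : Continuous (deriv b) := hd.continuous
  have hb0 : Continuous b := hb.continuous
  have hc2 : Continuous q2 := by
    have k0 := hcu s
    have k1 := hcu (s - 1)
    have k2 := hcu (s - 2)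
    simp only [hq2, hh1, hh2]
    fun_prop
  have hfin := lintegral_kernel_le (q := fun ξ => (q ξ : ℂ)) (q1 := fun ξ => (q1 ξ : ℂ))
    (q2 := fun ξ => (q2 ξ : ℂ)) (fun ξ => (hdq ξ).ofReal_comp) (fun ξ => (hdq1 ξ).ofReal_comp)
    (Complex.continuous_ofReal.comp hc2) (Q := Q) (fun ξ => by simpa using (hQ ξ).1)
    (fun ξ => by simpa using (hQ ξ).2) fun ξ hξ => by
      obtain ⟨z0, z1, z2⟩ := hzero ξ (hmem ξ hξ)
      simp [z0, z1, z2]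
  refine hfin.trans (le_of_eq ?_)
  rw [ENNReal.ofReal_mul (show 0 ≤ 16 * Q by positivity), ENNReal.ofReal_toReal hI]

/-- The symbol `(1 + ξ²)^{γ/2}`. -/
def bessel (γ ξ : ℝ) : ℝ := (1 + ξ ^ 2) ^ (γ / 2)

/-- The high-frequency pieces have kernels of `L¹` norm `O(|l|^γ)`. -/
lemma exists_piece_kernel_bound {N : ℕ} (hN : 0 < N) (γ : ℝ) :
    ∃ K : ℝ, 0 ≤ K ∧ ∀ l : ℝ, 1 ≤ |l| →
      ∫⁻ x, ‖kernel (fun ξ => ((bump N (ξ / l) * bessel γ ξ : ℝ) : ℂ)) x‖ₑ ≤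
        ENNReal.ofReal (K * |l| ^ γ) := by
  have hsupp : ∀ ξ, ξ ∉ Set.Icc (1 : ℝ) 4 → bump N ξ = 0 := by
    intro ξ hξ
    by_contra h
    refine hξ ⟨?_, ?_⟩
    · by_contra h0; exact h (bump_of_le (not_le.1 h0).le)
    · by_contra h0
      refine h (bump_of_ge hN ?_)
      have := ratio_le_two hN
      have := ratio_pos N
      nlinarith
  obtain ⟨K, hK⟩ := exists_symbol_kernel_bound (contDiff_bump N) hsupp (γ / 2)
  refine ⟨max K 0, le_max_right _ _, fun l hl => ?_⟩
  have hl0 : l ≠ 0 := fun h => by rw [h, abs_zero] at hl; linarith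
  have hlp : 0 < |l| := abs_pos.2 hl0
  have hsq : 1 ≤ l ^ 2 := by rw [← sq_abs]; nlinarith
  have hscale := lintegral_kernel_scale (m := fun ξ => ((bump N (ξ / l) * bessel γ ξ : ℝ) : ℂ))
    (q := fun ξ => ((bump N ξ * (1 / l ^ 2 + ξ ^ 2) ^ (γ / 2) : ℝ) : ℂ)) hl0
    (c := ((|l| ^ γ : ℝ) : ℂ)) fun ξ => by
      -- Rescaling by `l` turns the Bessel symbol into `|l|^γ (ε + ξ²)^{γ/2}` with `ε = l⁻² ≤ 1`,
      -- hence the need for uniformity in `ε`.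
      have : bessel γ ξ = |l| ^ γ * (1 / l ^ 2 + (ξ / l) ^ 2) ^ (γ / 2) := by
        rw [bessel, show |l| ^ γ = (l ^ 2) ^ (γ / 2) by
          rw [← sq_abs, ← Real.rpow_natCast, ← Real.rpow_mul (abs_nonneg _)]; congr 1; push_cast; ring,
          ← Real.mul_rpow (by positivity) (by positivity)]
        congr 1; field_simp
      rw [this]; push_cast; ring
  have he : ‖((|l| ^ γ : ℝ) : ℂ)‖ₑ = ENNReal.ofReal (|l| ^ γ) := by
    rw [← ofReal_norm, Complex.norm_real, Real.norm_of_nonneg (by positivity)]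
  rw [hscale, he, mul_comm, ENNReal.ofReal_mul (le_max_right _ _)]
  gcongr
  refine (hK _ (by positivity) ?_).trans (ENNReal.ofReal_le_ofReal (le_max_left _ _))
  rw [div_le_one (by positivity)]
  exact hsq

lemma contDiff_bessel (γ : ℝ) : ContDiff ℝ 2 (bessel γ) := by
  unfold bessel
  refine ContDiff.rpow_const_of_ne (by fun_prop) fun ξ => ?_
  positivity

lemma exists_low_kernel_bound {N : ℕ} (hN : 0 < N) (γ : ℝ) :
    ∃ K : ℝ, 0 ≤ K ∧
      ∫⁻ x, ‖kernel (fun ξ => ((lowStep N ξ * bessel γ ξ : ℝ) : ℂ)) x‖ₑ ≤ ENNReal.ofReal K := by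
  set q : ℝ → ℝ := fun ξ => lowStep N ξ * bessel γ ξ with hq
  have hqc : ContDiff ℝ 2 q := (contDiff_lowStep N).mul (contDiff_bessel γ)
  have hzero : ∀ ξ, ξ ∉ Set.Icc (-4 : ℝ) 4 → q ξ = 0 := by
    intro ξ hξ
    rw [hq]
    simp only
    rw [lowStep_of_ge hN, zero_mul]
    by_contra h
    have := ratio_le_two hN
    have h2 := abs_lt.1 (not_le.1 h)
    exact hξ ⟨by linarith, by linarith⟩
  obtain ⟨A, hA, hAb⟩ := exists_bound_of_contDiff_two hqc hzero
  have hd : ContDiff ℝ 1 (deriv q) := ContDiff.deriv' (n := 1) (by rw [one_add_one_eq_two]; exact hqc)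
  have hdq : ∀ ξ, HasDerivAt q (deriv q ξ) ξ := fun ξ =>
    (hqc.differentiable (by norm_num) ξ).hasDerivAt
  have hddq : ∀ ξ, HasDerivAt (deriv q) (deriv (deriv q) ξ) ξ := fun ξ =>
    (hd.differentiable (by norm_num) ξ).hasDerivAt
  have hts : tsupport q ⊆ Set.Icc (-4) 4 := closure_minimal
    (fun ξ hξ => by by_contra h; exact hξ (hzero ξ h)) isClosed_Icc
  have hfin := lintegral_kernel_le (q := fun ξ => (q ξ : ℂ)) (q1 := fun ξ => ((deriv q ξ : ℝ) : ℂ))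
    (q2 := fun ξ => ((deriv (deriv q) ξ : ℝ) : ℂ)) (fun ξ => (hdq ξ).ofReal_comp)
    (fun ξ => (hddq ξ).ofReal_comp)
    (Complex.continuous_ofReal.comp (ContDiff.continuous_deriv hd le_rfl)) (Q := A)
    (fun ξ => by simpa using (hAb ξ).1) (fun ξ => by simpa using (hAb ξ).2.2) fun ξ hξ => by
      have z1 : deriv q ξ = 0 :=
        image_eq_zero_of_notMem_tsupport fun h => hξ (hts (tsupport_deriv_subset h))
      have z2 : deriv (deriv q) ξ = 0 := image_eq_zero_of_notMem_tsupport fun h =>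
        hξ (hts (tsupport_deriv_subset (tsupport_deriv_subset h)))
      simp [hzero ξ hξ, z1, z2]
  have hI : ∫⁻ x : ℝ, ENNReal.ofReal ((1 + x ^ 2)⁻¹) ≠ ⊤ := by
    have h := (integrable_inv_one_add_sq).hasFiniteIntegral
    rw [hasFiniteIntegral_iff_ofReal (.of_forall fun x => by positivity)] at h
    exact h.ne
  refine ⟨(16 * A) * (∫⁻ x : ℝ, ENNReal.ofReal ((1 + x ^ 2)⁻¹)).toReal, by positivity,
    hfin.trans (le_of_eq ?_)⟩
  rw [ENNReal.ofReal_mul (show 0 ≤ 16 * A by positivity), ENNReal.ofReal_toReal hI]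

/-! ### Averages as multipliers and the estimate of a single piece. -/

/-- The averages with a general frequency profile `φ`. -/
def multAvg (μ : Measure ℝ) (φ : ℝ → ℂ) (t x : ℝ) : ℂ :=
  ∫ ξ, φ ξ * fourierMeasure μ (t * ξ) * ec (ξ * x)

lemma fourierMeasure_eq (μ : Measure ℝ) (ξ : ℝ) :
    fourierMeasure μ ξ = ∫ y, ec (-(y * ξ)) ∂μ := by
  refine integral_congr_ae (.of_forall fun y => ?_)
  simp only
  rw [ec]; congr 1; push_cast; ring

lemma norm_fourierMeasure_le (μ : Measure ℝ) [IsProbabilityMeasure μ] (ξ : ℝ) :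
    ‖fourierMeasure μ ξ‖ ≤ 1 := by
  rw [fourierMeasure_eq]
  refine (norm_integral_le_of_norm_le_const (C := 1) (.of_forall fun y => ?_)).trans (by simp)
  simp

@[fun_prop]
lemma continuous_fourierMeasure (μ : Measure ℝ) [IsProbabilityMeasure μ] :
    Continuous (fourierMeasure μ) := by
  rw [funext (fourierMeasure_eq μ)]
  exact continuous_of_dominated (bound := fun _ => 1)
    (fun ξ => Continuous.aestronglyMeasurable (by fun_prop))
    (fun ξ => .of_forall fun y => by simp) (integrable_const _) (.of_forall fun y => by fun_prop)

lemma sobolevAvg_eq_multAvg (γ : ℝ) (μ : Measure ℝ) (f : SchwartzMap ℝ ℂ) (t x : ℝ) :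
    sobolevAvg γ μ f t x = multAvg μ (fun ξ => (bessel γ ξ : ℂ) * 𝓕 (f : ℝ → ℂ) ξ) t x := by
  rw [sobolevAvg, ec_fourierInv]
  rfl

/-- Fubini. The physical-space form is the one to which the convergence of endpoint sums applies. -/
lemma multAvg_eq_integral (μ : Measure ℝ) [IsProbabilityMeasure μ] {φ : ℝ → ℂ}
    (hφ : Integrable φ) (t x : ℝ) : multAvg μ φ t x = ∫ y, kernel φ (x - t * y) ∂μ := by
  simp only [multAvg, kernel]
  rw [integral_integral_swap]
  · refine integral_congr_ae (.of_forall fun ξ => ?_)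
    simp only
    rw [fourierMeasure_eq, ← integral_const_mul, ← integral_mul_const]
    refine integral_congr_ae (.of_forall fun y => ?_)
    simp only
    rw [show ξ * (x - t * y) = -(y * (t * ξ)) + ξ * x by ring, ec_add]
    ring
  · refine ((integrable_const (1 : ℂ) (μ := μ)).mul_prod hφ).mono ?_ (.of_forall fun z => ?_)
    · refine hφ.aestronglyMeasurable.comp_snd.mul ?_
      exact Continuous.aestronglyMeasurable (by fun_prop)
    · simp [Function.uncurry]

lemma continuous_multAvg (μ : Measure ℝ) [IsProbabilityMeasure μ] {φ : ℝ → ℂ}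
    (hφ : Integrable φ) : Continuous fun z : ℝ × ℝ => multAvg μ φ z.2 z.1 := by
  refine continuous_of_dominated (bound := fun ξ => ‖φ ξ‖) (fun z => ?_) (fun z => .of_forall fun ξ => ?_)
    hφ.norm (.of_forall fun ξ => by fun_prop)
  · refine (hφ.aestronglyMeasurable.mul ?_).mul ?_ <;>
      exact Continuous.aestronglyMeasurable (by fun_prop)
  · rw [norm_mul, norm_mul, norm_ec, mul_one]
    exact mul_le_of_le_one_right (norm_nonneg _) (norm_fourierMeasure_le μ _)

lemma integrable_bessel_mul_fourier (γ : ℝ) (f : SchwartzMap ℝ ℂ) :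
    Integrable fun ξ => (bessel γ ξ : ℂ) * 𝓕 (f : ℝ → ℂ) ξ := by
  have hg : Function.HasTemperateGrowth fun ξ : ℝ => (1 + ‖ξ‖ ^ 2) ^ (γ / 2) :=
    Function.hasTemperateGrowth_one_add_norm_sq_rpow ℝ (γ / 2)
  have h := (SchwartzMap.smulLeftCLM ℂ (fun ξ : ℝ => (1 + ‖ξ‖ ^ 2) ^ (γ / 2)) (𝓕 f)).integrable
    (μ := volume)
  rw [SchwartzMap.smulLeftCLM_apply hg] at h
  refine h.congr (.of_forall fun ξ => ?_)
  simp only [bessel, Complex.real_smul, Real.norm_eq_abs, sq_abs, SchwartzMap.fourier_coe]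

lemma eLpNorm_ofReal_eq {p : ℝ} (hp : 0 < p) (f : ℝ → ℂ) (ν : Measure ℝ) :
    eLpNorm f (ENNReal.ofReal p) ν = (∫⁻ x, ‖f x‖ₑ ^ p ∂ν) ^ (1 / p) := by
  rw [eLpNorm_eq_lintegral_rpow_enorm_toReal (by simpa using hp) ENNReal.ofReal_ne_top,
    ENNReal.toReal_ofReal hp.le]

/-- The estimate for one frequency-localized piece, given the bound for the space-time norms. -/
lemma mixNorm_multAvg_piece_le {N : ℕ} (D : Construction N) {Φ : ℝ → ℂ} {G : ℝ → ℝ} {M : ℝ}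
    (hΦ : IsReproducingKernel Φ G M) {ψ χ : ℝ → ℂ} (hχ : IsTimeCutoff ψ χ) {m : ℝ → ℂ}
    (hm : Integrable m) (f : SchwartzMap ℝ ℂ) {R : ℝ} (hR1 : 1 ≤ R)
    (hR : ∀ ξ, m ξ ≠ 0 → |ξ| ≤ R) {p r : ℝ} (hp : 1 < p) (hpr : p ≤ r) {μ : Measure ℝ}
    (hμ : D.IsCantorMeasure μ) {B : ℝ≥0∞} {k : ℕ} {L : ℝ≥0∞}
    (hL : ∫⁻ x, ‖kernel m x‖ₑ ≤ L)
    (hB : ∀ g : ℝ → ℂ, Continuous g →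
      (∀ y, g y = ∫ ξ, (m ξ * 𝓕 (f : ℝ → ℂ) ξ) * ec (ξ * y)) → ∀ i,
      D.localNorm χ g p (i + k) 0 1 ≤ (B ^ p * (D.N₀ : ℝ≥0∞) ^ (p / 2)) ^ k *
      (((D.N₀ : ℝ≥0∞) ^ p) ^ i * ((∫⁻ t, ‖χ t‖ₑ ^ p) * ∫⁻ x, ‖g x‖ₑ ^ p))) :
    mixNorm p r (fun x t => multAvg μ (fun ξ => m ξ * 𝓕 (f : ℝ → ℂ) ξ) t x) ≤
      2 * ((∫⁻ u, ENNReal.ofReal (G u)) ^ (p - 1) * ENNReal.ofReal M *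
        ENNReal.ofReal R) ^ (1 / p - 1 / r) * ((B * (D.N₀ : ℝ≥0∞) ^ (-(1 / 2) : ℝ)) ^ k *
        ((∫⁻ t, ‖χ t‖ₑ ^ p) ^ (1 / p) * (L * eLpNorm f (ENNReal.ofReal p) volume))) := by
  have hp0 : 0 < p := by linarith
  have := hμ.prob
  obtain ⟨Mf, hMf⟩ : ∃ Mf, ∀ ξ, ‖𝓕 (f : ℝ → ℂ) ξ‖ ≤ Mf := by
    obtain ⟨c, -, hc⟩ := (𝓕 f).decay 0 0
    exact ⟨c, fun ξ => by simpa [SchwartzMap.fourier_coe] using hc ξ⟩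
  have hfc : Continuous (𝓕 (f : ℝ → ℂ)) := by
    rw [← SchwartzMap.fourier_coe]; exact (𝓕 f).continuous
  have hφ : Integrable fun ξ => m ξ * 𝓕 (f : ℝ → ℂ) ξ :=
    hm.mul_bdd (c := Mf) hfc.aestronglyMeasurable (.of_forall hMf)
  have h1 := D.mixNorm_average_le hΦ hχ hφ (g := kernel fun ξ => m ξ * 𝓕 (f : ℝ → ℂ) ξ)
    (fun _ => rfl) hR1 (fun ξ hξ => hR ξ (left_ne_zero_of_mul hξ)) hp hpr hμ
    (hB _ (continuous_kernel hφ) fun _ => rfl)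
  simp_rw [← multAvg_eq_integral μ hφ] at h1
  refine h1.trans ?_
  gcongr
  rw [eLpNorm_ofReal_eq hp0]
  calc _ ≤ ((∫⁻ x, ‖kernel m x‖ₑ) ^ p * ∫⁻ x, ‖f x‖ₑ ^ p) ^ (1 / p) :=
        ENNReal.rpow_le_rpow (lintegral_multiplier_le hm f hp) (by positivity)
    _ = (∫⁻ x, ‖kernel m x‖ₑ) * (∫⁻ x, ‖f x‖ₑ ^ p) ^ (1 / p) := by
        rw [ENNReal.mul_rpow_of_nonneg _ _ (by positivity), ← ENNReal.rpow_mul,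
          mul_one_div_cancel hp0.ne', ENNReal.rpow_one]
    _ ≤ _ := by gcongr

/-- The arithmetic of exponents: decoupling gain against the Sobolev and Nikolskii losses. -/
lemma gain_le {N N₀ : ℕ} (hN : 1 < N) (hN₀ : 0 < N₀) (hN₀N : N₀ < N) {b η β γ : ℝ} (hb0 : 0 ≤ b)
    (hη : 0 < η) (hb : b ≤ (N : ℝ) ^ (η / 2))
    (hγ : γ + β ≤ Real.log N₀ / Real.log N / 2 - η) {l : ℝ} {k : ℕ} (h1 : 1 ≤ l)
    (hk : (N : ℝ) ^ k ≤ l) (hk1 : l < (N : ℝ) ^ (k + 1)) :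
    l ^ β * l ^ γ * (b * (N₀ : ℝ) ^ (-(1 / 2) : ℝ)) ^ k ≤ (N : ℝ) ^ (1 + η) * l ^ (-(η / 2)) := by
  have hN1 : (1 : ℝ) < N := by exact_mod_cast hN
  have hNp : (0 : ℝ) < N := by linarith
  have hN0p : (0 : ℝ) < N₀ := by exact_mod_cast hN₀
  have hlogN : 0 < Real.log N := Real.log_pos hN1
  have hlp : 0 < l := by linarith
  set α := Real.log N₀ / Real.log N with hα
  have hα0 : 0 ≤ α := div_nonneg (Real.log_nonneg (by exact_mod_cast hN₀)) hlogN.le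
  have hα1 : α ≤ 1 := by
    rw [hα, div_le_one hlogN]
    exact Real.log_le_log hN0p (by exact_mod_cast hN₀N.le)
  have hNα : (N : ℝ) ^ α = N₀ := by
    rw [Real.rpow_def_of_pos hNp, hα, mul_div_cancel₀ _ hlogN.ne', Real.exp_log hN0p]
  -- The decay exponent of one piece: `α/2` from decoupling, less the `η/2` that absorbs the
  -- constant `b`. The hypothesis on `γ + β` leaves another `η/2` for summation over the scales.
  set e := α / 2 - η / 2 with he
  have hbN : b * (N₀ : ℝ) ^ (-(1 / 2) : ℝ) ≤ (N : ℝ) ^ (-e) := by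
    rw [← hNα, ← Real.rpow_mul hNp.le, show -e = η / 2 + α * -(1 / 2) by rw [he]; ring,
      Real.rpow_add hNp]
    gcongr
  have hNk : ((N : ℝ) ^ (-e)) ^ k ≤ (N : ℝ) ^ (1 + η) * l ^ (-e) := by
    have e0 : ((N : ℝ) ^ (-e)) ^ k = ((N : ℝ) ^ k) ^ (-e) := by
      rw [← Real.rpow_natCast, ← Real.rpow_mul hNp.le, mul_comm, Real.rpow_mul hNp.le,
        Real.rpow_natCast]
    have hNη : 1 ≤ (N : ℝ) ^ (1 + η) := Real.one_le_rpow hN1.le (by linarith)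
    rw [e0]
    -- The power `N^k` is known only up to a factor `N`. For `e ≥ 0` the lower bound `l / N ≤ N^k`
    -- costs `N^e ≤ N^{1+η}`; for `e ≤ 0` the upper bound `N^k ≤ l` costs nothing.
    rcases le_total 0 e with h | h
    · have h2 : l / N ≤ (N : ℝ) ^ k := by
        rw [div_le_iff₀ hNp, ← pow_succ]; exact hk1.le
      calc ((N : ℝ) ^ k) ^ (-e) ≤ (l / N) ^ (-e) :=
            Real.rpow_le_rpow_of_nonpos (by positivity) h2 (by linarith)
        _ = (N : ℝ) ^ e * l ^ (-e) := by
            rw [Real.div_rpow hlp.le hNp.le, Real.rpow_neg hNp.le, div_inv_eq_mul, mul_comm]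
        _ ≤ (N : ℝ) ^ (1 + η) * l ^ (-e) := by
            gcongr
            · exact hN1.le
            · linarith
    · calc ((N : ℝ) ^ k) ^ (-e) ≤ l ^ (-e) :=
            Real.rpow_le_rpow (by positivity) hk (by linarith)
        _ ≤ _ := le_mul_of_one_le_left (by positivity) hNη
  calc l ^ β * l ^ γ * (b * (N₀ : ℝ) ^ (-(1 / 2) : ℝ)) ^ k
      ≤ l ^ (e - η / 2) * ((N : ℝ) ^ (1 + η) * l ^ (-e)) := by
        refine mul_le_mul ?_ ?_ (by positivity) (by positivity)
        · rw [← Real.rpow_add hlp]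
          exact Real.rpow_le_rpow_of_exponent_le h1 (by rw [he]; linarith)
        · exact (pow_le_pow_left₀ (by positivity) hbN k).trans hNk
    _ = _ := by
        rw [mul_left_comm, ← Real.rpow_add hlp]
        congr 2; ring

lemma exists_pow_le_lt {N : ℕ} (hN : 1 < N) {l : ℝ} (h1 : 1 ≤ l) :
    ∃ k : ℕ, (N : ℝ) ^ k ≤ l ∧ l < (N : ℝ) ^ (k + 1) :=
  exists_nat_pow_near h1 (by exact_mod_cast hN)

lemma continuous_bessel (γ : ℝ) : Continuous (bessel γ) := (contDiff_bessel γ).continuous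

lemma abs_le_of_bump_ne_zero {N : ℕ} (hN : 3 ≤ N) {l ξ : ℝ} (hl : l ≠ 0)
    (h : bump N (ξ / l) ≠ 0) : |ξ| ≤ 4 * |l| := by
  have h1 := abs_sub_le_of_bump_ne_zero (by omega) hl h
  have h2 : 3 * |l| / N ≤ 3 * |l| := by
    refine div_le_self (by positivity) ?_
    exact_mod_cast (by omega : 1 ≤ N)
  have := abs_sub_abs_le_abs_sub ξ l
  linarith

lemma integrable_piece {N : ℕ} (hN : 3 ≤ N) (γ : ℝ) {l : ℝ} (hl : l ≠ 0) :
    Integrable fun ξ => ((bump N (ξ / l) * bessel γ ξ : ℝ) : ℂ) := by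
  have h1 := (contDiff_bump N).continuous
  have h2 := continuous_bessel γ
  refine Continuous.integrable_of_hasCompactSupport (by fun_prop)
    (HasCompactSupport.intro (isCompact_Icc (a := -(4 * |l|)) (b := 4 * |l|)) fun ξ hξ => ?_)
  by_contra h
  refine hξ (abs_le.1 (abs_le_of_bump_ne_zero hN hl fun h0 => h ?_))
  simp [h0]

lemma integrable_low {N : ℕ} (hN : 3 ≤ N) (γ : ℝ) :
    Integrable fun ξ => ((lowStep N ξ * bessel γ ξ : ℝ) : ℂ) := by
  have h1 := (contDiff_lowStep N).continuous
  have h2 := continuous_bessel γ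
  refine Continuous.integrable_of_hasCompactSupport (by fun_prop)
    (HasCompactSupport.intro (isCompact_Icc (a := -(2 : ℝ)) (b := 2)) fun ξ hξ => ?_)
  by_contra h
  refine hξ (abs_le.1 ?_)
  by_contra h0
  refine h ?_
  rw [lowStep_of_ge (by omega) ((ratio_le_two (by omega)).trans (not_le.1 h0).le)]
  simp

/-- The bound for one high-frequency piece at scale `l`. -/
lemma mixNorm_high_le {p r c₀ c₁ C : ℝ} (hp : 2 ≤ p) (hpr : p ≤ r) {Φ : ℝ → ℂ} {G : ℝ → ℝ} {M : ℝ}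
    (hΦ : IsReproducingKernel Φ G M) {ψ χ : ℝ → ℂ} (hχ : IsTimeCutoff ψ χ) {N : ℕ} (hN : 3 ≤ N)
    {η γ b K : ℝ} (hη : 0 < η) (hK : 0 ≤ K) (hb0 : 0 ≤ b) (hb : b ≤ (N : ℝ) ^ (η / 2))
    (hbC : ENNReal.ofReal C * ∫⁻ u, ENNReal.ofReal (G u) ≤ ENNReal.ofReal b)
    (hKl : ∀ l : ℝ, 1 ≤ |l| →
      ∫⁻ x, ‖kernel (fun ξ => ((bump N (ξ / l) * bessel γ ξ : ℝ) : ℂ)) x‖ₑ ≤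
        ENNReal.ofReal (K * |l| ^ γ))
    {D : Construction N} {μ : Measure ℝ} (hμ : IsLambdaCantorMeasure p c₀ c₁ C D μ)
    (hγ : γ + (1 / p - 1 / r) ≤ D.alpha / 2 - η) (f : SchwartzMap ℝ ℂ) {l : ℝ} (hl : 1 ≤ |l|) :
    mixNorm p r (fun x t => multAvg μ
        (fun ξ => ((bump N (ξ / l) * bessel γ ξ : ℝ) : ℂ) * 𝓕 (f : ℝ → ℂ) ξ) t x) ≤
      2 * ((∫⁻ u, ENNReal.ofReal (G u)) ^ (p - 1) * ENNReal.ofReal M * 4) ^ (1 / p - 1 / r) *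
        ((∫⁻ t, ‖χ t‖ₑ ^ p) ^ (1 / p) * ENNReal.ofReal (K * (N : ℝ) ^ (1 + η))) *
        ENNReal.ofReal (|l| ^ (-(η / 2))) * eLpNorm f (ENNReal.ofReal p) volume := by
  have hp1 : 1 < p := by linarith
  have hl0 : l ≠ 0 := fun h => by rw [h, abs_zero] at hl; linarith
  have hlp : 0 < |l| := by linarith
  have hβ : 0 ≤ 1 / p - 1 / r := by
    rw [sub_nonneg]; exact one_div_le_one_div_of_le (by linarith) hpr
  -- The generations worth decoupling are those whose intervals have length at least `|l|⁻¹`.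
  obtain ⟨k, hk, hk1⟩ := exists_pow_le_lt (N := N) (by omega) hl
  set X := (∫⁻ t, ‖χ t‖ₑ ^ p) ^ (1 / p) with hX
  set A := (∫⁻ u, ENNReal.ofReal (G u)) ^ (p - 1) * ENNReal.ofReal M with hA
  have hfc : Continuous (𝓕 (f : ℝ → ℂ)) := by
    rw [← SchwartzMap.fourier_coe]; exact (𝓕 f).continuous
  have hm := integrable_piece hN γ hl0
  have hφ : Integrable fun ξ => ((bump N (ξ / l) * bessel γ ξ : ℝ) : ℂ) * 𝓕 (f : ℝ → ℂ) ξ := by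
    obtain ⟨c, -, hc⟩ := (𝓕 f).decay 0 0
    exact hm.mul_bdd (c := c) hfc.aestronglyMeasurable
      (.of_forall fun ξ => by simpa [SchwartzMap.fourier_coe] using hc ξ)
  have hne : ∀ ξ, ((bump N (ξ / l) * bessel γ ξ : ℝ) : ℂ) ≠ 0 → bump N (ξ / l) ≠ 0 :=
    fun ξ h h0 => h (by simp [h0])
  have h1 := mixNorm_multAvg_piece_le D hΦ hχ hm f (R := 4 * |l|) (by linarith)
    (fun ξ hξ => abs_le_of_bump_ne_zero hN hl0 (hne ξ hξ)) hp1 hpr hμ.2 (k := k) (hKl l hl)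
    (B := ENNReal.ofReal b) fun g hgc hg i => by
      refine (D.localNorm_le hp hN hμ.1 hΦ hχ hφ hg hgc (ξ₀ := l) (fun ξ hξ =>
        abs_sub_le_of_bump_ne_zero (by omega) hl0 (hne ξ (left_ne_zero_of_mul hξ))) i k 0 1
        (by simpa using hk)).trans ?_
      gcongr
  refine h1.trans ?_
  have e1 : (A * ENNReal.ofReal (4 * |l|)) ^ (1 / p - 1 / r) =
      (A * 4) ^ (1 / p - 1 / r) * ENNReal.ofReal (|l| ^ (1 / p - 1 / r)) := by
    rw [ENNReal.ofReal_mul (by norm_num), ← mul_assoc, ENNReal.mul_rpow_of_nonneg _ _ hβ,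
      ENNReal.ofReal_rpow_of_pos hlp, ENNReal.ofReal_ofNat]
  have hN0p : (0 : ℝ) < D.N₀ := by exact_mod_cast D.N₀_pos
  have e2 : (ENNReal.ofReal b * (D.N₀ : ℝ≥0∞) ^ (-(1 / 2) : ℝ)) ^ k =
      ENNReal.ofReal ((b * (D.N₀ : ℝ) ^ (-(1 / 2) : ℝ)) ^ k) := by
    rw [ENNReal.ofReal_pow (by positivity), ENNReal.ofReal_mul hb0,
      ← ENNReal.ofReal_rpow_of_pos hN0p, ENNReal.ofReal_natCast]
  have hgain := gain_le (N := N) (N₀ := D.N₀) (by omega) D.N₀_pos D.N₀_lt hb0 hη hb hγ hl hk hk1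
  rw [e1, e2]
  set P := 2 * (A * 4) ^ (1 / p - 1 / r) with hP
  set F := eLpNorm f (ENNReal.ofReal p) volume
  calc _ = P * (X * (ENNReal.ofReal (|l| ^ (1 / p - 1 / r)) *
        (ENNReal.ofReal ((b * (D.N₀ : ℝ) ^ (-(1 / 2) : ℝ)) ^ k) *
          ENNReal.ofReal (K * |l| ^ γ)))) * F := by
        rw [hP]; ring
    _ ≤ P * (X * (ENNReal.ofReal (K * (N : ℝ) ^ (1 + η)) * ENNReal.ofReal (|l| ^ (-(η / 2))))) *
        F := by
        gcongr P * (X * ?_) * F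
        rw [← ENNReal.ofReal_mul (by positivity), ← ENNReal.ofReal_mul (by positivity),
          ← ENNReal.ofReal_mul (by positivity)]
        refine ENNReal.ofReal_le_ofReal ?_
        calc _ = K * (|l| ^ (1 / p - 1 / r) * |l| ^ γ *
              (b * (D.N₀ : ℝ) ^ (-(1 / 2) : ℝ)) ^ k) := by ring
          _ ≤ K * ((N : ℝ) ^ (1 + η) * |l| ^ (-(η / 2))) := by gcongr
          _ = _ := by ring
    _ = _ := by ring

/-- The bound for the low-frequency piece. -/
lemma mixNorm_low_le {p r c₀ c₁ C : ℝ} (hp : 2 ≤ p) (hpr : p ≤ r) {Φ : ℝ → ℂ} {G : ℝ → ℝ} {M : ℝ}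
    (hΦ : IsReproducingKernel Φ G M) {ψ χ : ℝ → ℂ} (hχ : IsTimeCutoff ψ χ) {N : ℕ} (hN : 3 ≤ N)
    {γ : ℝ} {L : ℝ≥0∞}
    (hL : ∫⁻ x, ‖kernel (fun ξ => ((lowStep N ξ * bessel γ ξ : ℝ) : ℂ)) x‖ₑ ≤ L)
    {D : Construction N} {μ : Measure ℝ} (hμ : IsLambdaCantorMeasure p c₀ c₁ C D μ)
    (f : SchwartzMap ℝ ℂ) :
    mixNorm p r (fun x t => multAvg μ
        (fun ξ => ((lowStep N ξ * bessel γ ξ : ℝ) : ℂ) * 𝓕 (f : ℝ → ℂ) ξ) t x) ≤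
      2 * ((∫⁻ u, ENNReal.ofReal (G u)) ^ (p - 1) * ENNReal.ofReal M * 2) ^ (1 / p - 1 / r) *
        ((∫⁻ t, ‖χ t‖ₑ ^ p) ^ (1 / p) * L) * eLpNorm f (ENNReal.ofReal p) volume := by
  have hp1 : 1 < p := by linarith
  -- No generation is decoupled at low frequency: `k = 0`, so the value of `B` is immaterial.
  have h1 := mixNorm_multAvg_piece_le D hΦ hχ (integrable_low hN γ) f (R := 2) (by norm_num)
    (fun ξ hξ => ?_) hp1 hpr hμ.2 (k := 0) hL (B := 1) fun g hgc hg i => ?_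
  · rw [pow_zero, one_mul, ENNReal.ofReal_ofNat] at h1
    refine h1.trans (le_of_eq ?_)
    ring
  · by_contra h0
    refine hξ ?_
    rw [lowStep_of_ge (by omega) ((ratio_le_two (by omega)).trans (not_le.1 h0).le)]
    simp
  · rw [pow_zero, one_mul, add_zero]
    exact D.localNorm_le_trivial hχ.cont hgc (by linarith) i 0 1

/-! ### Summation over the scales and the estimates (i) and (ii). -/

/-- The partial sums of the frequency decomposition converge. -/
lemma tendsto_multAvg_lowStep {N : ℕ} (hN : 3 ≤ N) (γ : ℝ) (μ : Measure ℝ) [IsProbabilityMeasure μ]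
    (f : SchwartzMap ℝ ℂ) (t x : ℝ) :
    Tendsto (fun M : ℕ => multAvg μ (fun ξ =>
      ((lowStep N (ξ / ratio N ^ M) * bessel γ ξ : ℝ) : ℂ) * 𝓕 (f : ℝ → ℂ) ξ) t x) atTop
      (𝓝 (sobolevAvg γ μ f t x)) := by
  rw [sobolevAvg_eq_multAvg]
  have hint := integrable_bessel_mul_fourier γ f
  have hfc : Continuous (𝓕 (f : ℝ → ℂ)) := by
    rw [← SchwartzMap.fourier_coe]; exact (𝓕 f).continuous
  have hlc := (contDiff_lowStep N).continuous
  have hbc := continuous_bessel γ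
  refine tendsto_integral_of_dominated_convergence
    (fun ξ => 3 * ‖(bessel γ ξ : ℂ) * 𝓕 (f : ℝ → ℂ) ξ‖) (fun M => ?_) (hint.norm.const_mul 3)
    (fun M => .of_forall fun ξ => ?_) (.of_forall fun ξ => ?_)
  · exact Continuous.aestronglyMeasurable (by fun_prop)
  · beta_reduce
    rw [norm_mul, norm_ec, mul_one, norm_mul, Complex.ofReal_mul, mul_assoc, norm_mul,
      Complex.norm_real, Real.norm_eq_abs]
    calc _ ≤ 3 * ‖(bessel γ ξ : ℂ) * 𝓕 (f : ℝ → ℂ) ξ‖ * 1 := by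
          gcongr
          · exact abs_lowStep_le _ _
          · exact norm_fourierMeasure_le μ _
      _ = _ := mul_one _
  · have hr1 : 1 < ratio N := by
      unfold ratio
      have : (0 : ℝ) < 1 / N := by
        have : (0 : ℝ) < N := by exact_mod_cast (by omega : 0 < N)
        positivity
      linarith
    refine tendsto_const_nhds.congr' ?_
    filter_upwards [(tendsto_pow_atTop_atTop_of_one_lt hr1).eventually_ge_atTop |ξ|] with M hM
    have hp : 0 < ratio N ^ M := pow_pos (ratio_pos N) M
    rw [lowStep_of_le, one_mul]
    rw [abs_div, abs_of_pos hp, div_le_one hp]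
    exact hM

lemma multAvg_lowStep_eq {N : ℕ} (hN : 3 ≤ N) (γ : ℝ) (μ : Measure ℝ) [IsProbabilityMeasure μ]
    (f : SchwartzMap ℝ ℂ) (M : ℕ) (t x : ℝ) :
    multAvg μ (fun ξ =>
      ((lowStep N (ξ / ratio N ^ M) * bessel γ ξ : ℝ) : ℂ) * 𝓕 (f : ℝ → ℂ) ξ) t x =
    multAvg μ (fun ξ => ((lowStep N ξ * bessel γ ξ : ℝ) : ℂ) * 𝓕 (f : ℝ → ℂ) ξ) t x +
    ∑ n ∈ Finset.range M,
      (multAvg μ (fun ξ =>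
        ((bump N (ξ / ratio N ^ n) * bessel γ ξ : ℝ) : ℂ) * 𝓕 (f : ℝ → ℂ) ξ) t x +
      multAvg μ (fun ξ =>
        ((bump N (ξ / -ratio N ^ n) * bessel γ ξ : ℝ) : ℂ) * 𝓕 (f : ℝ → ℂ) ξ) t x) := by
  have hfc : Continuous (𝓕 (f : ℝ → ℂ)) := by
    rw [← SchwartzMap.fourier_coe]; exact (𝓕 f).continuous
  obtain ⟨c, -, hc⟩ := (𝓕 f).decay 0 0
  have hI : ∀ m : ℝ → ℂ, Integrable m →
      Integrable fun ξ => m ξ * 𝓕 (f : ℝ → ℂ) ξ * fourierMeasure μ (t * ξ) * ec (ξ * x) := by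
    intro m hm
    have h1 : Integrable fun ξ => m ξ * 𝓕 (f : ℝ → ℂ) ξ := hm.mul_bdd (c := c)
      hfc.aestronglyMeasurable (.of_forall fun ξ => by simpa [SchwartzMap.fourier_coe] using hc ξ)
    have h2 := h1.mul_bdd (g := fun ξ => fourierMeasure μ (t * ξ)) (c := 1)
      (Continuous.aestronglyMeasurable (by fun_prop))
      (.of_forall fun ξ => norm_fourierMeasure_le μ _)
    exact h2.mul_bdd (c := 1) (Continuous.aestronglyMeasurable (by fun_prop))
      (.of_forall fun ξ => by simp)
  have hl0 : ∀ n : ℕ, ratio N ^ n ≠ 0 := fun n => (pow_pos (ratio_pos N) n).ne'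
  have hpl := fun n : ℕ => hI _ (integrable_piece hN γ (hl0 n))
  have hmi := fun n : ℕ => hI _ (integrable_piece hN γ (neg_ne_zero.2 (hl0 n)))
  have hadd := fun n : ℕ => (hpl n).fun_add (hmi n)
  have hsum : ∀ n ∈ Finset.range M, _ = _ := fun n _ => (integral_add (hpl n) (hmi n)).symm
  simp only [multAvg]
  rw [Finset.sum_congr rfl hsum,
    ← integral_finsetSum _ fun n _ => hadd n,
    ← integral_add (hI _ (integrable_low hN γ)) (integrable_finsetSum _ fun n _ => hadd n)]
  refine integral_congr_ae (.of_forall fun ξ => ?_)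
  simp only
  rw [lowStep_scale]
  push_cast
  rw [add_mul, add_mul, add_mul, add_mul, Finset.sum_mul, Finset.sum_mul, Finset.sum_mul,
    Finset.sum_mul]
  congr 1
  refine Finset.sum_congr rfl fun n _ => ?_
  ring

/-- Mixed norm Sobolev estimate for `Λ(p)` Cantor measures. -/
theorem exists_mixNorm_sobolevAvg_le {p r : ℝ} (c₀ c₁ C : ℝ) (hp : 2 ≤ p) (hpr : p ≤ r) {η : ℝ}
    (hη : 0 < η) :
    ∃ N₁ : ℕ, ∀ N : ℕ, N₁ ≤ N → ∀ γ : ℝ, ∃ K : ℝ≥0∞, K ≠ ⊤ ∧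
      ∀ (D : Construction N) (μ : Measure ℝ), IsLambdaCantorMeasure p c₀ c₁ C D μ →
        γ + (1 / p - 1 / r) ≤ D.alpha / 2 - η → ∀ f : SchwartzMap ℝ ℂ,
          mixNorm p r (fun x t => sobolevAvg γ μ f t x) ≤
            K * eLpNorm f (ENNReal.ofReal p) volume := by
  have hp1 : 1 < p := by linarith
  have hr1 : 1 ≤ r := by linarith
  have hp0 : 0 < p := by linarith
  have hβ : 0 ≤ 1 / p - 1 / r := by
    rw [sub_nonneg]; exact one_div_le_one_div_of_le (by linarith) hpr
  obtain ⟨Φ, G, M, hΦ⟩ := exists_reproducingKernel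
  obtain ⟨ψ, χ, hχ⟩ := exists_timeCutoff
  have hGfin : ∫⁻ u, ENNReal.ofReal (G u) ≠ ⊤ := by
    have h := hΦ.integrable_majorant.hasFiniteIntegral
    rw [hasFiniteIntegral_iff_ofReal (.of_forall fun u => ?_)] at h
    · exact h.ne
    · have := (norm_nonneg _).trans (hΦ.norm_le u 0 (by simp)); exact this
  -- The loss per decoupled generation. It does not depend on `N`, so `N₁` can be chosen to make it
  -- at most `N^{η/2}`; nor does it involve `γ`, which is why `γ` may be quantified after `N₁`.
  set b : ℝ := (ENNReal.ofReal C * ∫⁻ u, ENNReal.ofReal (G u)).toReal with hb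
  have hbC : ENNReal.ofReal C * ∫⁻ u, ENNReal.ofReal (G u) ≤ ENNReal.ofReal b := by
    rw [hb, ENNReal.ofReal_toReal (ENNReal.mul_ne_top ENNReal.ofReal_ne_top hGfin)]
  have hlarge : ∀ᶠ N : ℕ in atTop, b ≤ (N : ℝ) ^ (η / 2) :=
    ((tendsto_rpow_atTop (by positivity : 0 < η / 2)).comp
      tendsto_natCast_atTop_atTop).eventually_ge_atTop b
  obtain ⟨N₁, hN₁⟩ := eventually_atTop.1 (hlarge.and (eventually_ge_atTop 3))
  refine ⟨N₁, fun N hN γ => ?_⟩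
  obtain ⟨hbN, hN3⟩ := hN₁ N hN
  obtain ⟨K, hK, hKl⟩ := exists_piece_kernel_bound (N := N) (by omega) γ
  obtain ⟨K', -, hKlow⟩ := exists_low_kernel_bound (N := N) (by omega) γ
  -- At `|l| = ratio N ^ n` the remaining decay `|l|^{-η/2}` is `θ^n`, a convergent geometric series
  -- for each fixed `N`.
  set θ : ℝ := ratio N ^ (-(η / 2)) with hθ
  have hratio : 1 < ratio N := by
    unfold ratio
    have : (0 : ℝ) < N := by exact_mod_cast (by omega : 0 < N)
    have : (0 : ℝ) < 1 / N := by positivity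
    linarith
  have hθ1 : θ < 1 := Real.rpow_lt_one_of_one_lt_of_neg hratio (by linarith)
  set A := (∫⁻ u, ENNReal.ofReal (G u)) ^ (p - 1) * ENNReal.ofReal M with hA
  have hAfin : A ≠ ⊤ := ENNReal.mul_ne_top
    (ENNReal.rpow_ne_top_of_nonneg (by linarith) hGfin) ENNReal.ofReal_ne_top
  set X := (∫⁻ t, ‖χ t‖ₑ ^ p) ^ (1 / p) with hX
  have hXfin : X ≠ ⊤ := ENNReal.rpow_ne_top_of_nonneg (by positivity) (hχ.lintegral_ne_top p hp1.le)
  set P := 2 * (A * 4) ^ (1 / p - 1 / r) * (X * ENNReal.ofReal (K * (N : ℝ) ^ (1 + η))) with hP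
  have hPfin : P ≠ ⊤ := by
    refine ENNReal.mul_ne_top (ENNReal.mul_ne_top (by simp) ?_)
      (ENNReal.mul_ne_top hXfin ENNReal.ofReal_ne_top)
    exact ENNReal.rpow_ne_top_of_nonneg hβ (ENNReal.mul_ne_top hAfin (by simp))
  set P0 := 2 * (A * 2) ^ (1 / p - 1 / r) * (X * ENNReal.ofReal K') with hP0
  have hP0fin : P0 ≠ ⊤ := by
    refine ENNReal.mul_ne_top (ENNReal.mul_ne_top (by simp) ?_)
      (ENNReal.mul_ne_top hXfin ENNReal.ofReal_ne_top)
    exact ENNReal.rpow_ne_top_of_nonneg hβ (ENNReal.mul_ne_top hAfin (by simp))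
  set T : ℝ≥0∞ := (1 - ENNReal.ofReal θ)⁻¹ with hT
  have hTfin : T ≠ ⊤ := by
    rw [hT, ENNReal.inv_ne_top]
    refine (tsub_pos_of_lt ?_).ne'
    rw [← ENNReal.ofReal_one]
    exact (ENNReal.ofReal_lt_ofReal_iff one_pos).2 hθ1
  refine ⟨P0 + 2 * P * T, ENNReal.add_ne_top.2 ⟨hP0fin,
    ENNReal.mul_ne_top (ENNReal.mul_ne_top (by simp) hPfin) hTfin⟩, fun D μ hμ hγ f => ?_⟩
  have := hμ.2.prob
  set F := eLpNorm f (ENNReal.ofReal p) volume with hF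
  have hhigh : ∀ n : ℕ, ∀ l : ℝ, |l| = ratio N ^ n → mixNorm p r (fun x t => multAvg μ
      (fun ξ => ((bump N (ξ / l) * bessel γ ξ : ℝ) : ℂ) * 𝓕 (f : ℝ → ℂ) ξ) t x) ≤
      P * ENNReal.ofReal θ ^ n * F := by
    intro n l hl
    refine (mixNorm_high_le hp hpr hΦ hχ hN3 hη hK (by positivity) hbN hbC hKl hμ hγ f
      (l := l) ?_).trans (le_of_eq ?_)
    · rw [hl]; exact one_le_pow₀ hratio.le
    · rw [← ENNReal.ofReal_pow (by positivity), hl, hθ, ← Real.rpow_natCast, ← Real.rpow_natCast,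
        ← Real.rpow_mul (ratio_pos N).le, ← Real.rpow_mul (ratio_pos N).le, mul_comm (n : ℝ)]
  have hfc : Continuous (𝓕 (f : ℝ → ℂ)) := by
    rw [← SchwartzMap.fourier_coe]; exact (𝓕 f).continuous
  obtain ⟨c, -, hc⟩ := (𝓕 f).decay 0 0
  have hmeas : ∀ m : ℝ → ℂ, Integrable m → Measurable fun z : ℝ × ℝ =>
      multAvg μ (fun ξ => m ξ * 𝓕 (f : ℝ → ℂ) ξ) z.2 z.1 := fun m hm =>
    (continuous_multAvg μ (hm.mul_bdd (c := c) hfc.aestronglyMeasurable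
      (.of_forall fun ξ => by simpa [SchwartzMap.fourier_coe] using hc ξ))).measurable
  have hl0 : ∀ n : ℕ, ratio N ^ n ≠ 0 := fun n => (pow_pos (ratio_pos N) n).ne'
  have hm0 := hmeas _ (integrable_low hN3 γ)
  have hm1 := fun n : ℕ => hmeas _ (integrable_piece hN3 γ (hl0 n))
  have hm2 := fun n : ℕ => hmeas _ (integrable_piece hN3 γ (neg_ne_zero.2 (hl0 n)))
  refine mixNorm_le_of_tendsto hp1.le hr1 (fun M => ?_)
    (fun x t => tendsto_multAvg_lowStep hN3 γ μ f t x) (.of_forall fun M => ?_)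
  · simp_rw [multAvg_lowStep_eq hN3 γ μ f M]
    exact hm0.add (Finset.measurable_fun_sum _ fun n _ => (hm1 n).add (hm2 n))
  · simp_rw [multAvg_lowStep_eq hN3 γ μ f M]
    refine (mixNorm_add_le hp1.le hr1 hm0
      (Finset.measurable_fun_sum _ fun n _ => (hm1 n).add (hm2 n))).trans ?_
    rw [add_mul]
    refine add_le_add (mixNorm_low_le hp hpr hΦ hχ hN3 hKlow hμ f) ?_
    refine (mixNorm_sum_le hp1.le hr1 _ fun n => (hm1 n).add (hm2 n)).trans ?_
    calc _ ≤ ∑ n ∈ Finset.range M, (P * ENNReal.ofReal θ ^ n * F + P * ENNReal.ofReal θ ^ n * F) := by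
          refine Finset.sum_le_sum fun n _ => (mixNorm_add_le hp1.le hr1 (hm1 n) (hm2 n)).trans ?_
          refine add_le_add (hhigh n _ ?_) (hhigh n _ ?_)
          · exact abs_of_pos (pow_pos (ratio_pos N) n)
          · rw [abs_neg]; exact abs_of_pos (pow_pos (ratio_pos N) n)
      _ = 2 * P * (∑ n ∈ Finset.range M, ENNReal.ofReal θ ^ n) * F := by
          rw [Finset.mul_sum, Finset.sum_mul]
          exact Finset.sum_congr rfl fun n _ => by ring
      _ ≤ 2 * P * T * F := by
          gcongr
          rw [hT, ← ENNReal.tsum_geometric]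
          exact ENNReal.sum_le_tsum _

lemma kernel_fourier (f : SchwartzMap ℝ ℂ) (x : ℝ) : kernel (𝓕 (f : ℝ → ℂ)) x = f x := by
  rw [kernel, ← ec_fourierInv, ← SchwartzMap.fourier_coe, ← SchwartzMap.fourierInv_coe,
    FourierTransform.fourierInv_fourier_eq]

lemma sobolevAvg_zero (μ : Measure ℝ) [IsProbabilityMeasure μ] (f : SchwartzMap ℝ ℂ) (t x : ℝ) :
    sobolevAvg 0 μ f t x = avg μ f t x := by
  have h : (fun ξ => (bessel 0 ξ : ℂ) * 𝓕 (f : ℝ → ℂ) ξ) = 𝓕 (f : ℝ → ℂ) := by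
    funext ξ
    simp [bessel]
  rw [sobolevAvg_eq_multAvg, multAvg_eq_integral μ (integrable_bessel_mul_fourier 0 f), h]
  simp only [kernel_fourier]
  rfl

lemma eLpNorm_ofReal_eq_of_ennreal {p : ℝ} (hp : 0 < p) (f : ℝ → ℝ≥0∞) (ν : Measure ℝ) :
    eLpNorm f (ENNReal.ofReal p) ν = (∫⁻ x, f x ^ p ∂ν) ^ (1 / p) := by
  rw [eLpNorm_eq_lintegral_rpow_enorm_toReal (by simpa using hp) ENNReal.ofReal_ne_top,
    ENNReal.toReal_ofReal hp.le]
  simp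

/-- The dimension of a `Λ(p)` Cantor measure is close to `2 / p`. -/
lemma IsLambdaCantorMeasure.alpha_ge {p c₀ c₁ C : ℝ} (hc₀ : 0 < c₀) {N : ℕ}
    {D : Construction N} {μ : Measure ℝ} (h : IsLambdaCantorMeasure p c₀ c₁ C D μ) :
    2 / p + Real.log c₀ / Real.log N ≤ D.alpha := by
  obtain ⟨S, hS⟩ := D.Sigma_nonempty
  have hN : (1 : ℝ) < N := by
    have := D.N₀_pos; have := D.N₀_lt
    exact_mod_cast (by omega : 1 < N)
  have hlog : 0 < Real.log N := Real.log_pos hN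
  have hN0 : (0 : ℝ) < N := by linarith
  have h1 := (h.1 S hS).card_ge
  rw [D.card_eq S hS] at h1
  have h2 := Real.log_le_log (by positivity) h1
  rw [Real.log_mul hc₀.ne' (by positivity), Real.log_rpow hN0] at h2
  rw [Construction.alpha, le_div_iff₀ hlog, add_mul, div_mul_cancel₀ _ hlog.ne']
  linarith

/-- The mixed norm estimate for averages over `Λ(p)` Cantor measures. -/
theorem exists_eLpNorm_avg_le {p : ℝ} (c₀ c₁ C : ℝ) (hp : 2 ≤ p) (hc₀ : 0 < c₀) {r : ℝ}
    (hr : p < r) : ∃ N₁ : ℕ, ∀ N : ℕ, N₁ ≤ N → ∃ K : ℝ,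
      ∀ (D : Construction N) (μ : Measure ℝ), IsLambdaCantorMeasure p c₀ c₁ C D μ →
        ∀ f : SchwartzMap ℝ ℂ,
          eLpNorm (fun x : ℝ => eLpNorm (fun t : ℝ => avg μ f t x)
              (ENNReal.ofReal r) (volume.restrict (Set.Icc (1 : ℝ) 2)))
              (ENNReal.ofReal p) volume
            ≤ ENNReal.ofReal K * eLpNorm f (ENNReal.ofReal p) volume := by
  have hp0 : 0 < p := by linarith
  have hr0 : 0 < r := by linarith
  obtain ⟨N₁, h⟩ := exists_mixNorm_sobolevAvg_le c₀ c₁ C hp hr.le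
    -- The margin of about `1/r` is split in two halves: one is this `η`, the other pays for the
    -- defect of `α/2` from `1/p`.
    (η := 1 / (2 * r)) (by positivity)
  -- Large `N` makes `log c₀ / log N ≥ -1/r`, hence `α/2 ≥ 1/p - 1/(2r)`.
  obtain ⟨N₂, hN₂⟩ := eventually_atTop.1 ((Real.tendsto_log_atTop.comp
    tendsto_natCast_atTop_atTop).eventually_ge_atTop (-(r * Real.log c₀)))
  refine ⟨max N₁ N₂, fun N hN => ?_⟩
  obtain ⟨K, hK, hKl⟩ := h N ((le_max_left _ _).trans hN) 0
  have hlogN := hN₂ N ((le_max_right _ _).trans hN)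
  simp only [Function.comp_apply] at hlogN
  refine ⟨K.toReal, fun D μ hμ f => ?_⟩
  have := hμ.2.prob
  rw [ENNReal.ofReal_toReal hK]
  have hN1 : (1 : ℝ) < N := by
    have := D.N₀_pos; have := D.N₀_lt
    exact_mod_cast (by omega : 1 < N)
  have hlog : 0 < Real.log N := Real.log_pos hN1
  have hα := hμ.alpha_ge hc₀
  have h1 : -(1 / r) ≤ Real.log c₀ / Real.log N := by
    rw [le_div_iff₀ hlog, neg_mul, neg_le, one_div, inv_mul_eq_div, le_div_iff₀ hr0]
    linarith
  have h2 : 1 / (2 * r) = 1 / r / 2 := by field_simp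
  have h3 : 2 / p = 2 * (1 / p) := by ring
  refine le_trans (le_of_eq ?_) (hKl D μ hμ (by linarith) f)
  rw [eLpNorm_ofReal_eq_of_ennreal hp0, mixNorm]
  simp only [eLpNorm_ofReal_eq hr0, timeNorm, sobolevAvg_zero]

/-- The space-time Sobolev estimate for averages over `Λ(p)` Cantor measures. -/
theorem exists_eLpNorm_sobolevAvg_le {p : ℝ} (c₀ c₁ C : ℝ) (hp : 2 ≤ p) {η : ℝ} (hη : 0 < η) :
    ∃ N₁ : ℕ, ∀ N : ℕ, N₁ ≤ N → ∀ γ : ℝ, ∃ K : ℝ,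
      ∀ (D : Construction N) (μ : Measure ℝ), IsLambdaCantorMeasure p c₀ c₁ C D μ →
        γ ≤ D.alpha / 2 - η → ∀ f : SchwartzMap ℝ ℂ,
          eLpNorm (fun z : ℝ × ℝ => sobolevAvg γ μ f z.2 z.1) (ENNReal.ofReal p)
              ((volume : Measure ℝ).prod (volume.restrict (Set.Icc (1 : ℝ) 2)))
            ≤ ENNReal.ofReal K * eLpNorm f (ENNReal.ofReal p) volume := by
  have hp0 : 0 < p := by linarith
  obtain ⟨N₁, h⟩ := exists_mixNorm_sobolevAvg_le c₀ c₁ C hp le_rfl hη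
  refine ⟨N₁, fun N hN γ => ?_⟩
  obtain ⟨K, hK, hKl⟩ := h N hN γ
  refine ⟨K.toReal, fun D μ hμ hγ f => ?_⟩
  have := hμ.2.prob
  rw [ENNReal.ofReal_toReal hK]
  refine le_trans (le_of_eq ?_) (hKl D μ hμ (by simpa using hγ) f)
  have hc : Continuous fun z : ℝ × ℝ => sobolevAvg γ μ f z.2 z.1 := by
    simp only [sobolevAvg_eq_multAvg]
    exact continuous_multAvg μ (integrable_bessel_mul_fourier γ f)
  rw [eLpNorm_eq_lintegral_rpow_enorm_toReal (by simpa using hp0) ENNReal.ofReal_ne_top,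
    ENNReal.toReal_ofReal hp0.le, mixNorm, lintegral_prod _ (hc.enorm.measurable.pow_const p).aemeasurable]
  congr 1
  refine lintegral_congr fun x => ?_
  rw [timeNorm, ← ENNReal.rpow_mul, one_div_mul_cancel hp0.ne', ENNReal.rpow_one]

/-! ### Multiplier norms dominate symbols. -/

lemma integral_comp_affine (F : ℝ → ℂ) (ξ₀ : ℝ) {ε : ℝ} (hε : 0 < ε) :
    ∫ ξ, F ξ = ε * ∫ η, F (ξ₀ + ε * η) := by
  have h := Measure.integral_comp_mul_left (fun u => F (ξ₀ + u)) ε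
  rw [h, integral_add_left_eq_self (μ := volume) F ξ₀, abs_of_pos (inv_pos.2 hε), Complex.real_smul,
    ← mul_assoc, ← Complex.ofReal_mul, mul_inv_cancel₀ hε.ne', Complex.ofReal_one, one_mul]

lemma lintegral_comp_mul_left_pos {F : ℝ → ℝ≥0∞} (hF : Measurable F) {ε : ℝ} (hε : 0 < ε) :
    ∫⁻ x, F (ε * x) = ENNReal.ofReal ε⁻¹ * ∫⁻ x, F x := by
  rw [← lintegral_map hF (measurable_const_mul ε), Real.map_volume_mul_left hε.ne',
    lintegral_smul_measure, abs_of_pos (inv_pos.2 hε), smul_eq_mul]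

/-- Fatou's lemma for `L^p` norms of continuous functions. -/
lemma eLpNorm_le_of_tendsto {p : ℝ} {g : ℕ → ℝ → ℂ} {h : ℝ → ℂ}
    (hg : ∀ n, Continuous (g n)) (hlim : ∀ x, Tendsto (fun n => g n x) atTop (𝓝 (h x)))
    {B : ℝ≥0∞} (hB : ∀ n, eLpNorm (g n) (ENNReal.ofReal p) volume ≤ B) :
    eLpNorm h (ENNReal.ofReal p) volume ≤ B := by
  refine (Lp.eLpNorm_lim_le_liminf_eLpNorm (fun n => (hg n).aestronglyMeasurable) h
    (.of_forall hlim)).trans ?_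
  exact liminf_le_of_le (by isBoundedDefault) fun b hb => by
    obtain ⟨n, hn⟩ := hb.exists
    exact hn.trans (hB n)

/-- An `L^p` multiplier bound controls the symbol pointwise. -/
theorem norm_symbol_le_of_eLpNorm_le {p : ℝ} (hp : 1 ≤ p) {m : ℝ → ℂ} (hm : Continuous m) {K : ℝ≥0∞}
    (hK : ∀ f : SchwartzMap ℝ ℂ, eLpNorm (fun x => ∫ ξ, m ξ * 𝓕 (f : ℝ → ℂ) ξ * ec (ξ * x))
      (ENNReal.ofReal p) volume ≤ K * eLpNorm f (ENNReal.ofReal p) volume) (ξ₀ : ℝ) :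
    ‖m ξ₀‖ₑ ≤ K := by
  have hp0 : 0 < p := by linarith
  obtain ⟨B, hB1, hB2⟩ := exists_schwartz_bump (r := 1) (R := 2) (by norm_num) (by norm_num)
  have hBc : Continuous B := B.continuous
  set φ : SchwartzMap ℝ ℂ := 𝓕⁻ B with hφ
  have hφe : ∀ x, φ x = ∫ η, B η * ec (η * x) := fun x => by
    rw [hφ, SchwartzMap.fourierInv_coe, ec_fourierInv]
  set F := eLpNorm φ (ENNReal.ofReal p) volume with hF
  have hFfin : F ≠ ⊤ := (φ.memLp (ENNReal.ofReal p) volume).2.ne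
  have hF0 : F ≠ 0 := by
    intro h0
    rw [hF, eLpNorm_eq_zero_iff φ.continuous.aestronglyMeasurable (by simpa using hp0)] at h0
    have h1 : (φ : ℝ → ℂ) = fun _ => 0 :=
      (Continuous.ae_eq_iff_eq volume φ.continuous continuous_const).1 h0
    have h2 : 𝓕 φ = B := FourierTransform.fourier_fourierInv_eq B
    have h3 : φ = 0 := by ext x; exact congrFun h1 x
    have h4 := hB1 0 (by simp)
    rw [← h2, h3] at h4
    simp at h4
  -- Test functions with Fourier transform concentrated in an `ε`-neighbourhood of `ξ₀`, where `ε =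
  -- 1/(n+1)`. Once modulation and dilation are removed, the input is the fixed `φ` and the output
  -- is `g n`, which tends to `m ξ₀ * φ` by continuity of `m`.
  set g : ℕ → ℝ → ℂ := fun n x =>
    ∫ η, m (ξ₀ + (1 / ((n : ℝ) + 1)) * η) * B η * ec (η * x) with hg
  obtain ⟨Cm, hCm⟩ := (isCompact_Icc (a := ξ₀ - 2) (b := ξ₀ + 2)).exists_bound_of_continuousOn
    hm.continuousOn
  have hbd : ∀ (n : ℕ) η, ‖m (ξ₀ + (1 / ((n : ℝ) + 1)) * η) * B η‖ ≤ Cm * ‖B η‖ := by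
    intro n η
    rw [norm_mul]
    by_cases h : |η| < 2
    · gcongr
      refine hCm _ ?_
      have hε : 0 ≤ 1 / ((n : ℝ) + 1) := by positivity
      have hε1 : 1 / ((n : ℝ) + 1) ≤ 1 := by
        rw [div_le_one (by positivity)]; linarith [Nat.cast_nonneg (α := ℝ) n]
      have : |1 / ((n : ℝ) + 1) * η| ≤ 2 := by
        rw [abs_mul, abs_of_nonneg hε]; nlinarith [abs_nonneg η]
      rw [abs_le] at this
      exact ⟨by linarith, by linarith⟩
    · rw [hB2 η (not_lt.1 h)]; simp
  have hBi : Integrable fun η => Cm * ‖B η‖ := B.integrable.norm.const_mul _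
  have hgc : ∀ n, Continuous (g n) := fun n =>
    continuous_of_dominated (fun x => Continuous.aestronglyMeasurable (by fun_prop))
      (fun x => .of_forall fun η => by rw [norm_mul, norm_ec, mul_one]; exact hbd n η) hBi
      (.of_forall fun η => by fun_prop)
  have hlim : ∀ x, Tendsto (fun n => g n x) atTop (𝓝 (m ξ₀ * φ x)) := by
    intro x
    rw [hφe, ← integral_const_mul]
    refine tendsto_integral_of_dominated_convergence _
      (fun n => Continuous.aestronglyMeasurable (by fun_prop)) hBi
      (fun n => .of_forall fun η => by rw [norm_mul, norm_ec, mul_one]; exact hbd n η)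
      (.of_forall fun η => ?_)
    simp only [← mul_assoc]
    refine Tendsto.mul_const _ (Tendsto.mul_const _ ((hm.tendsto ξ₀).comp ?_))
    have h := (tendsto_one_div_add_atTop_nhds_zero_nat (𝕜 := ℝ)).mul_const η
    simpa using h.const_add ξ₀
  have hscale : ∀ {ε : ℝ}, 0 < ε → ∀ {u h : ℝ → ℂ}, Continuous h →
      (∀ x, u x = ε * ec (ξ₀ * x) * h (ε * x)) →
      eLpNorm u (ENNReal.ofReal p) volume = ENNReal.ofReal ε * ENNReal.ofReal ε⁻¹ ^ (1 / p) *
        eLpNorm h (ENNReal.ofReal p) volume := by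
    intro ε hε u h hh hu
    rw [eLpNorm_ofReal_eq hp0, eLpNorm_ofReal_eq hp0]
    simp only [hu, enorm_mul, enorm_ec, mul_one, ENNReal.mul_rpow_of_nonneg _ _ hp0.le]
    rw [lintegral_const_mul' _ _ (ENNReal.rpow_ne_top_of_nonneg hp0.le enorm_ne_top),
      lintegral_comp_mul_left_pos (F := fun x => ‖h x‖ₑ ^ p) (hh.enorm.measurable.pow_const p) hε,
      ENNReal.mul_rpow_of_nonneg _ _ (by positivity), ENNReal.mul_rpow_of_nonneg _ _ (by positivity),
      ← ENNReal.rpow_mul, mul_one_div_cancel hp0.ne', ENNReal.rpow_one, ← mul_assoc]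
    congr 3
    rw [← ofReal_norm, Complex.norm_real, Real.norm_eq_abs, abs_of_pos hε]
  have hgK : ∀ n, eLpNorm (g n) (ENNReal.ofReal p) volume ≤ K * F := by
    intro n
    set ε : ℝ := 1 / ((n : ℝ) + 1) with hεd
    have hε : 0 < ε := by positivity
    have hdil : ∃ Bε : SchwartzMap ℝ ℂ, ∀ ξ, Bε ξ = B ((ξ - ξ₀) / ε) := by
      have hcs : HasCompactSupport fun ξ => B ((ξ - ξ₀) / ε) := by
        refine HasCompactSupport.of_support_subset_isCompact
          (isCompact_Icc (a := ξ₀ - 2 * ε) (b := ξ₀ + 2 * ε)) fun ξ hξ => ?_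
        by_contra hn
        refine hξ (hB2 _ ?_)
        rw [abs_div, abs_of_pos hε, le_div_iff₀ hε]
        by_contra hlt
        rw [not_le, abs_lt] at hlt
        exact hn ⟨by linarith, by linarith⟩
      have hsm : ContDiff ℝ (⊤ : ℕ∞) fun ξ => B ((ξ - ξ₀) / ε) :=
        (B.smooth ⊤).comp ((contDiff_id.sub contDiff_const).div_const ε)
      exact ⟨hcs.toSchwartzMap hsm, fun ξ => rfl⟩
    obtain ⟨Bε, hBε⟩ := hdil
    have hsub : ∀ η, Bε (ξ₀ + ε * η) = B η := fun η => by
      rw [hBε, add_sub_cancel_left, mul_div_cancel_left₀ _ hε.ne']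
    have hFour : 𝓕 ((𝓕⁻ Bε : SchwartzMap ℝ ℂ) : ℝ → ℂ) = Bε := by
      rw [← SchwartzMap.fourier_coe, FourierTransform.fourier_fourierInv_eq]
    have h := hK (𝓕⁻ Bε)
    have e : ∀ (M : ℝ → ℂ) x, ∫ ξ, M ξ * Bε ξ * ec (ξ * x) =
        ε * ec (ξ₀ * x) * ∫ η, M (ξ₀ + ε * η) * B η * ec (η * (ε * x)) := by
      intro M x
      rw [integral_comp_affine _ ξ₀ hε, mul_assoc, ← integral_const_mul (ec (ξ₀ * x))]
      congr 2
      funext η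
      rw [hsub, add_mul, ec_add, show ε * η * x = η * (ε * x) by ring]
      ring
    rw [hscale hε (u := fun x => ∫ ξ, m ξ * 𝓕 ((𝓕⁻ Bε : SchwartzMap ℝ ℂ) : ℝ → ℂ) ξ * ec (ξ * x)) (hgc n) (fun x => by rw [hFour]; exact e m x),
      hscale hε (u := (𝓕⁻ Bε : SchwartzMap ℝ ℂ)) φ.continuous (fun x => by
        rw [SchwartzMap.fourierInv_coe, ec_fourierInv, hφe]
        simpa using e (fun _ => 1) x), ← hF, mul_left_comm] at h
    -- Input and output carry the same dilation factor `ε · ε^{-1/p}`, which cancels.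
    refine (ENNReal.mul_le_mul_iff_right ?_ ?_).1 h
    · refine mul_ne_zero (by simpa using hε) (ENNReal.rpow_pos ?_ ENNReal.ofReal_ne_top).ne'
      simpa using hε
    · exact ENNReal.mul_ne_top ENNReal.ofReal_ne_top
        (ENNReal.rpow_ne_top_of_nonneg (by positivity) ENNReal.ofReal_ne_top)
  have hfin := eLpNorm_le_of_tendsto hgc hlim hgK
  have hconst : eLpNorm (fun x => m ξ₀ * φ x) (ENNReal.ofReal p) volume = ‖m ξ₀‖ₑ * F :=
    eLpNorm_const_smul (m ξ₀) (φ : ℝ → ℂ) (ENNReal.ofReal p) volume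
  rw [hconst] at hfin
  exact (ENNReal.mul_le_mul_iff_left hF0 hFfin).1 hfin

/-! ### Fourier coefficients of self-similar Cantor measures and part (iii). -/

namespace Construction

variable {N : ℕ} (D : Construction N)

/-- Discrete exponential sums over a self-similar construction factor. -/
lemma W_ec_of_selfSimilar {S : Finset ℕ} (hS : ∀ k, ∀ a ∈ D.A k, D.choice k a = S) (ξ : ℝ)
    (i j : ℕ) (a : ℝ) (ha : a ∈ D.A j) :
    D.W i j a (fun y => ec (-(y * ξ))) =
      ec (-(a * ξ)) * ∏ l ∈ Finset.range i, ∑ s ∈ S, ec (-(s * (ξ / (N : ℝ) ^ (j + l + 1)))) := by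
  induction i generalizing j a with
  | zero => simp [W]
  | succ i ih =>
    rw [W, hS j a ha, Finset.prod_range_succ', mul_comm _ (∑ s ∈ S, _), ← mul_assoc,
      Finset.mul_sum, Finset.sum_mul]
    refine Finset.sum_congr rfl fun s hs => ?_
    rw [ih (j + 1)]
    · rw [← ec_add, Finset.prod_congr rfl fun l _ => by
        rw [show j + 1 + l + 1 = j + (l + 1) + 1 by ring]]
      congr 2
      rw [add_zero]
      ring
    · simp only [A, Set.mem_iUnion]
      exact ⟨a, ha, s, by rwa [hS j a ha], rfl⟩

end Construction

open Construction

/-- In the self-similar case the Fourier coefficients of `μ` do not change under `n ↦ N n`. -/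
lemma fourierMeasure_base_mul {N : ℕ} {D : Construction N} {μ : Measure ℝ} (hμ : D.IsCantorMeasure μ)
    (hD : D.IsSelfSimilar) (n : ℤ) :
    fourierMeasure μ ((N : ℝ) * n) = fourierMeasure μ n := by
  obtain ⟨S, hSm, hS⟩ := hD
  have hN := D.N_pos'
  have hN0 : (D.N₀ : ℂ) ≠ 0 := Nat.cast_ne_zero.2 D.N₀_pos.ne'
  have hlim : ∀ k : ℤ, Tendsto (fun i => ((D.N₀ : ℂ) ^ i)⁻¹ *
      ∏ l ∈ Finset.range i, ∑ s ∈ S, ec (-(s * ((k : ℝ) / (N : ℝ) ^ (0 + l + 1))))) atTop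
      (𝓝 (fourierMeasure μ k)) := by
    intro k
    have h := hμ.tendsto_W D (H := fun y => ec (-(y * k))) (K := 1) (L := 2 * Real.pi * |(k : ℝ)|)
      (fun x => by simp) fun x y => by
        refine (norm_ec_sub_le _ _).trans (le_of_eq ?_)
        rw [show -(x * (k : ℝ)) - -(y * k) = -((k : ℝ) * (x - y)) by ring, abs_neg, abs_mul]
        ring
    rw [← fourierMeasure_eq] at h
    refine h.congr fun i => ?_
    -- The root of the tree is the point `1`, and its character is trivial at integer frequencies.
    rw [D.W_ec_of_selfSimilar hS _ i 0 1 rfl, one_mul, ← Int.cast_neg, ec_int, one_mul]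
  have h1 := (hlim (N * n)).comp (tendsto_add_atTop_nat 1)
  have h2 := hlim n
  push_cast at h1
  refine tendsto_nhds_unique h1 (h2.congr fun i => ?_)
  simp only [Function.comp_apply]
  rw [Finset.prod_range_succ', pow_succ, mul_inv]
  -- Passing from `n` to `N n` shifts the product by one place. The new first factor has integer
  -- phases, so it equals `N₀` and compensates the additional normalization.
  have e0 : ∑ s ∈ S, ec (-(s * ((N : ℝ) * n / (N : ℝ) ^ (0 + 0 + 1)))) = D.N₀ := by
    rw [← D.card_eq S hSm, Finset.card_eq_sum_ones, Nat.cast_sum]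
    refine Finset.sum_congr rfl fun s _ => ?_
    rw [zero_add, zero_add, pow_one, mul_div_cancel_left₀ _ hN.ne', Nat.cast_one,
      show -((s : ℝ) * n) = ((-(s * n) : ℤ) : ℝ) by push_cast; ring, ec_int]
  rw [e0]
  have e1 : ∀ l : ℕ, (N : ℝ) * n / (N : ℝ) ^ (0 + (l + 1) + 1) = n / (N : ℝ) ^ (0 + l + 1) := by
    intro l
    rw [show 0 + (l + 1) + 1 = 0 + l + 1 + 1 by ring, pow_succ' (N : ℝ) (0 + l + 1),
      mul_div_mul_left _ _ hN.ne']
  simp only [e1]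
  rw [mul_comm (∏ l ∈ _, _), ← mul_assoc, mul_assoc _ _ (D.N₀ : ℂ), inv_mul_cancel₀ hN0, mul_one]

lemma fourierMeasure_base_pow_mul {N : ℕ} {D : Construction N} {μ : Measure ℝ}
    (hμ : D.IsCantorMeasure μ) (hD : D.IsSelfSimilar) (n : ℤ) (k : ℕ) :
    fourierMeasure μ ((N : ℝ) ^ k * n) = fourierMeasure μ n := by
  induction k with
  | zero => simp
  | succ k ih =>
    have h := fourierMeasure_base_mul hμ hD (N ^ k * n)
    push_cast at h
    rw [← ih, pow_succ', mul_assoc, h]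

/-- A probability measure with vanishing nonzero Fourier coefficients projects to the uniform measure
on the circle. -/
lemma integral_eq_haar_of_fourierMeasure_eq_zero {μ : Measure ℝ} [IsProbabilityMeasure μ]
    (h0 : ∀ n : ℤ, n ≠ 0 → fourierMeasure μ n = 0) (g : C(UnitAddCircle, ℂ)) :
    ∫ y, g (y : UnitAddCircle) ∂μ = ∫ z, g z ∂(AddCircle.haarAddCircle (T := 1)) := by
  have hc : Continuous fun y : ℝ => (y : UnitAddCircle) := AddCircle.continuous_mk' 1
  have hi1 : ∀ g : C(UnitAddCircle, ℂ), Integrable (fun y : ℝ => g (y : UnitAddCircle)) μ :=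
    fun g => Integrable.of_bound (g.continuous.comp hc).aestronglyMeasurable ‖g‖
      (.of_forall fun y => g.norm_coe_le_norm _)
  have hi2 : ∀ g : C(UnitAddCircle, ℂ), Integrable g (AddCircle.haarAddCircle (T := 1)) :=
    fun g => Integrable.of_bound g.continuous.aestronglyMeasurable ‖g‖
      (.of_forall fun y => g.norm_coe_le_norm _)
  -- The functions satisfying the identity form a closed subspace that contains all characters;
  -- their span is dense.
  let V : Submodule ℂ C(UnitAddCircle, ℂ) :=
    { carrier := {g | ∫ y, g (y : UnitAddCircle) ∂μ = ∫ z, g z ∂(AddCircle.haarAddCircle (T := 1))}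
      add_mem' := fun {g h} hg hh => by
        simp only [Set.mem_ofPred_eq, ContinuousMap.add_apply] at hg hh ⊢
        rw [integral_add (hi1 g) (hi1 h), integral_add (hi2 g) (hi2 h), hg, hh]
      zero_mem' := by simp
      smul_mem' := fun c g hg => by
        simp only [Set.mem_ofPred_eq, ContinuousMap.smul_apply] at hg ⊢
        rw [integral_smul, integral_smul, hg] }
  have hclosed : IsClosed (V : Set C(UnitAddCircle, ℂ)) := by
    have hL1 : Continuous fun g : C(UnitAddCircle, ℂ) => ∫ y, g (y : UnitAddCircle) ∂μ := by
      refine LipschitzWith.continuous (K := 1) (LipschitzWith.of_dist_le_mul fun g h => ?_)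
      rw [dist_eq_norm, dist_eq_norm, ← integral_sub (hi1 g) (hi1 h), NNReal.coe_one, one_mul]
      simpa using norm_integral_le_of_norm_le_const (μ := μ) (C := ‖g - h‖)
        (.of_forall fun y : ℝ => (g - h).norm_coe_le_norm (y : UnitAddCircle))
    have hL2 : Continuous fun g : C(UnitAddCircle, ℂ) =>
        ∫ z, g z ∂(AddCircle.haarAddCircle (T := 1)) := by
      refine LipschitzWith.continuous (K := 1) (LipschitzWith.of_dist_le_mul fun g h => ?_)
      rw [dist_eq_norm, dist_eq_norm, ← integral_sub (hi2 g) (hi2 h), NNReal.coe_one, one_mul]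
      simpa using norm_integral_le_of_norm_le_const (μ := AddCircle.haarAddCircle (T := 1))
        (C := ‖g - h‖) (.of_forall fun y => (g - h).norm_coe_le_norm y)
    exact isClosed_eq hL1 hL2
  have hspan : Submodule.span ℂ (Set.range <| @fourier 1) ≤ V := by
    rw [Submodule.span_le]
    rintro _ ⟨n, rfl⟩
    change ∫ y, fourier n (y : UnitAddCircle) ∂μ = ∫ z, fourier n z ∂_
    have h1 : ∫ y, fourier n (y : UnitAddCircle) ∂μ = fourierMeasure μ (-n : ℤ) := by
      rw [fourierMeasure_eq]
      refine integral_congr_ae (.of_forall fun y => ?_)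
      simp only [fourier_coe_apply, ec]
      congr 1
      push_cast
      ring
    have h2 : ∫ z, fourier n z ∂(AddCircle.haarAddCircle (T := 1)) = (Pi.single n 1 : ℤ → ℂ) 0 := by
      rw [← fourierCoeff_fourier (T := 1) n, fourierCoeff]
      simp
    rw [h1, h2]
    rcases eq_or_ne n 0 with rfl | hn
    · simp [fourierMeasure]
    · rw [h0 _ (neg_ne_zero.2 hn), Pi.single_eq_of_ne' hn]
  have htop : (⊤ : Submodule ℂ C(UnitAddCircle, ℂ)) ≤ V := by
    rw [← span_fourier_closure_eq_top]
    exact Submodule.topologicalClosure_minimal _ hspan hclosed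
  exact htop (Submodule.mem_top : g ∈ ⊤)

/-- Since the digit `N - 1` is never used, `μ` leaves a gap on the circle. -/
lemma exists_fourierMeasure_ne_zero {N : ℕ} {D : Construction N} {μ : Measure ℝ}
    (hμ : D.IsCantorMeasure μ) (hlt : ∀ S ∈ D.Sigma, ∀ s ∈ S, s + 1 < N) :
    ∃ n : ℤ, n ≠ 0 ∧ fourierMeasure μ n ≠ 0 := by
  by_contra! h0
  have := hμ.prob
  have hN := D.N_pos'
  set δ : ℝ := 1 / (2 * N) with hδ
  have hδ0 : 0 < δ := by positivity
  have hNδ : 1 / (N : ℝ) = 2 * δ := by rw [hδ]; field_simp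
  -- A tent centred at `-δ` and positive exactly on `(-2δ, 0)` modulo one. With `2δ = 1/N` this is
  -- the interior of the last interval of length `1/N`, the one left empty by the missing digit `N -
  -- 1`.
  set u : UnitAddCircle → ℝ := fun z => max 0 (δ - ‖z + (δ : UnitAddCircle)‖) with hu
  have huc : Continuous u := by fun_prop
  let g : C(UnitAddCircle, ℂ) := ⟨fun z => (u z : ℂ), Complex.continuous_ofReal.comp huc⟩
  have hbound : ∀ z, |u z| ≤ δ := fun z => by
    rw [abs_of_nonneg (le_max_left _ _)]
    exact max_le hδ0.le (by linarith [norm_nonneg (z + (δ : UnitAddCircle))])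
  have hlip : ∀ x y : ℝ, |u x - u y| ≤ 1 * |x - y| := by
    intro x y
    refine (abs_max_sub_max_le_max _ _ _ _).trans ?_
    rw [sub_self, abs_zero, one_mul]
    refine max_le (abs_nonneg _) ?_
    rw [sub_sub_sub_cancel_left]
    refine (abs_norm_sub_norm_le _ _).trans ?_
    rw [add_sub_add_right_eq_sub, ← AddCircle.coe_sub, abs_sub_comm, UnitAddCircle.norm_eq]
    simpa using round_le (y - x) 0
  have hW := hμ.tendsto_W D (H := fun y => g (y : UnitAddCircle)) (K := δ) (L := 1)
    (fun x => by simpa [g] using hbound x)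
    (fun x y => by
      change ‖((u x : ℝ) : ℂ) - (u y : ℝ)‖ ≤ _
      rw [← Complex.ofReal_sub, Complex.norm_real]
      exact hlip x y)
  -- One generation suffices: if the first digit is at most `N - 2`, every descendant lies in `[1, 2
  -- - 2δ]`, where `u` vanishes.
  have hzero : ∀ k, D.W (k + 1) 0 1 (fun y => g (y : UnitAddCircle)) = 0 := by
    intro k
    rw [D.W_congr (h := fun _ => 0), D.W_const, mul_zero]
    intro b hb
    simp only [leaves, Set.mem_iUnion] at hb
    obtain ⟨s, hs, hb⟩ := hb
    have hsub := D.leaves_subset _ _ _ b hb ⟨le_rfl, by simp⟩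
    simp only [zero_add, pow_one] at hsub
    have hs1 := hlt _ (D.choice_mem 0 1) s hs
    have hs2 : (s : ℝ) + 2 ≤ N := by exact_mod_cast hs1
    obtain ⟨hb1, hb2⟩ := hsub
    have h1 : 1 ≤ b := le_trans (by simp; positivity) hb1
    have h2 : b ≤ 2 - 2 * δ := by
      refine hb2.trans ?_
      have : (s : ℝ) / N + 2 * (1 / N) ≤ 1 := by
        rw [mul_one_div, ← add_div, div_le_one hN]; exact hs2
      linarith
    change ((u b : ℝ) : ℂ) = 0
    rw [Complex.ofReal_eq_zero, hu]
    refine max_eq_left ?_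
    rw [← AddCircle.coe_add, UnitAddCircle.norm_eq, sub_nonpos]
    -- As `b + δ ∈ [1 + δ, 2 - δ]`, an integer at distance less than `δ` would lie strictly between
    -- `1` and `2`.
    have hr : |b + δ - round (b + δ)| < δ → False := by
      intro hlt
      rw [abs_lt] at hlt
      have a1 : (1 : ℝ) < round (b + δ) := by linarith
      have a2 : (round (b + δ) : ℝ) < 2 := by linarith
      have a1' : 1 < round (b + δ) := by exact_mod_cast a1
      have a2' : round (b + δ) < 2 := by exact_mod_cast a2
      omega
    exact not_lt.1 hr
  have hint0 : ∫ y, g (y : UnitAddCircle) ∂μ = 0 := by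
    refine tendsto_nhds_unique (hW.comp (tendsto_add_atTop_nat 1)) ?_
    refine tendsto_const_nhds.congr fun k => ?_
    simp only [Function.comp_apply]
    rw [hzero, mul_zero]
  rw [integral_eq_haar_of_fourierMeasure_eq_zero h0] at hint0
  have hreal : ∫ z, u z ∂(AddCircle.haarAddCircle (T := 1)) = 0 := by
    have : ∫ z, g z ∂(AddCircle.haarAddCircle (T := 1)) =
        ((∫ z, u z ∂(AddCircle.haarAddCircle (T := 1)) : ℝ) : ℂ) := integral_ofReal
    rw [this] at hint0
    exact_mod_cast hint0
  have hpos : 0 < ∫ z, u z ∂(AddCircle.haarAddCircle (T := 1)) :=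
    huc.integral_pos_of_hasCompactSupport_nonneg_nonzero (HasCompactSupport.of_compactSpace u)
      (fun z => le_max_left _ _) (x := -(δ : UnitAddCircle)) (by simp [hu, hδ0.ne', hδ0.le])
  exact hpos.ne' hreal

/-- There is no Sobolev gain at a fixed time in the self-similar case. -/
theorem not_exists_eLpNorm_sobolevAvg_le {p c₀ c₁ C : ℝ} (hp : 1 ≤ p) {N : ℕ} {D : Construction N}
    {μ : Measure ℝ} (hμ : IsLambdaCantorMeasure p c₀ c₁ C D μ) (hD : D.IsSelfSimilar) {γ t : ℝ}
    (hγ : 0 < γ) (ht : 0 < t) :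
    ¬ ∃ K : ℝ, ∀ f : SchwartzMap ℝ ℂ,
      eLpNorm (fun x : ℝ => sobolevAvg γ μ f t x) (ENNReal.ofReal p) volume
        ≤ ENNReal.ofReal K * eLpNorm f (ENNReal.ofReal p) volume := by
  rintro ⟨K, hK⟩
  have := hμ.2.prob
  obtain ⟨n, hn, hne⟩ := exists_fourierMeasure_ne_zero hμ.2 fun S hS => (hμ.1 S hS).lt
  have hsymb : ∀ ξ, bessel γ ξ * ‖fourierMeasure μ (t * ξ)‖ ≤ max K 0 := by
    intro ξ
    have h := norm_symbol_le_of_eLpNorm_le hp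
      (m := fun ξ => (bessel γ ξ : ℂ) * fourierMeasure μ (t * ξ))
      (by have := continuous_bessel γ; have := continuous_fourierMeasure μ; fun_prop)
      (K := ENNReal.ofReal K) (fun f => ?_) ξ
    · rw [← ofReal_norm, norm_mul, Complex.norm_real, Real.norm_eq_abs,
        abs_of_nonneg (by unfold bessel; positivity)] at h
      exact (ENNReal.ofReal_le_ofReal_iff (le_max_right K 0)).1
        (h.trans (ENNReal.ofReal_le_ofReal (le_max_left K 0)))
    · refine le_trans (le_of_eq ?_) (hK f)
      congr 1
      funext x
      rw [sobolevAvg_eq_multAvg, multAvg]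
      refine integral_congr_ae (.of_forall fun ξ => ?_)
      simp only
      ring
  have hN1 : (1 : ℝ) < N := by exact_mod_cast D.one_lt_base
  have hn0 : (0 : ℝ) < |(n : ℝ)| := abs_pos.2 (Int.cast_ne_zero.2 hn)
  have hge : ∀ ξ : ℝ, |ξ| ^ γ ≤ bessel γ ξ := by
    intro ξ
    have h1 : |ξ| ^ γ = (ξ ^ 2) ^ (γ / 2) := by
      rw [← sq_abs, ← Real.rpow_natCast, ← Real.rpow_mul (abs_nonneg ξ)]
      congr 1
      push_cast
      ring
    rw [h1, bessel]
    exact Real.rpow_le_rpow (sq_nonneg _) (by linarith) (by positivity)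
  -- At `ξ = N^k n / t` the argument `t ξ = N^k n` keeps `μ̂` equal to its nonzero value at `n`,
  -- while the weight grows without bound.
  have hlim : Tendsto (fun k : ℕ => |(N : ℝ) ^ k * n / t| ^ γ * ‖fourierMeasure μ n‖) atTop atTop := by
    refine Tendsto.atTop_mul_const (norm_pos_iff.2 hne) ((tendsto_rpow_atTop hγ).comp ?_)
    have h := ((tendsto_pow_atTop_atTop_of_one_lt hN1).atTop_mul_const hn0).atTop_div_const ht
    refine h.congr fun k => ?_
    rw [abs_div, abs_mul, abs_of_pos ht, abs_of_pos (pow_pos (by linarith : (0 : ℝ) < N) k)]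
  obtain ⟨k, hk⟩ := (hlim.eventually_gt_atTop (max K 0)).exists
  have h := hsymb ((N : ℝ) ^ k * n / t)
  rw [mul_div_cancel₀ _ ht.ne', fourierMeasure_base_pow_mul hμ.2 hD] at h
  have h2 := mul_le_mul_of_nonneg_right (hge ((N : ℝ) ^ k * n / t)) (norm_nonneg (fourierMeasure μ n))
  linarith

end LambdaCantor

end

theorem mainTheorem2 (p c₀ c₁ C : ℝ) (hp : 2 ≤ p) (hc₀ : 0 < c₀) :
    -- (i) mixed norm estimate
    (∀ r : ℝ, p < r → ∃ N₁ : ℕ, ∀ N : ℕ, N₁ ≤ N → ∃ K : ℝ,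
      ∀ (D : LambdaCantor.Construction N) (μ : Measure ℝ),
        LambdaCantor.IsLambdaCantorMeasure p c₀ c₁ C D μ →
        ∀ f : SchwartzMap ℝ ℂ,
          eLpNorm
              (fun x : ℝ => eLpNorm (fun t : ℝ => LambdaCantor.avg μ f t x)
                (ENNReal.ofReal r) (volume.restrict (Set.Icc (1 : ℝ) 2)))
              (ENNReal.ofReal p) volume
            ≤ ENNReal.ofReal K * eLpNorm f (ENNReal.ofReal p) volume) ∧
    -- (ii) space-time Sobolev improvement below `α / 2`
    (∀ η : ℝ, 0 < η → ∃ N₁ : ℕ, ∀ N : ℕ, N₁ ≤ N → ∀ γ : ℝ, ∃ K : ℝ,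
      ∀ (D : LambdaCantor.Construction N) (μ : Measure ℝ),
        LambdaCantor.IsLambdaCantorMeasure p c₀ c₁ C D μ →
        γ ≤ D.alpha / 2 - η →
        ∀ f : SchwartzMap ℝ ℂ,
          eLpNorm (fun z : ℝ × ℝ => LambdaCantor.sobolevAvg γ μ f z.2 z.1)
              (ENNReal.ofReal p)
              ((volume : Measure ℝ).prod (volume.restrict (Set.Icc (1 : ℝ) 2)))
            ≤ ENNReal.ofReal K * eLpNorm f (ENNReal.ofReal p) volume) ∧
    -- (iii) no Sobolev improvement at a fixed time in the self-similar case
    (∀ (N : ℕ) (D : LambdaCantor.Construction N) (μ : Measure ℝ),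
      LambdaCantor.IsLambdaCantorMeasure p c₀ c₁ C D μ → D.IsSelfSimilar →
      ∀ γ t : ℝ, 0 < γ → 0 < t →
        ¬ ∃ K : ℝ, ∀ f : SchwartzMap ℝ ℂ,
          eLpNorm (fun x : ℝ => LambdaCantor.sobolevAvg γ μ f t x) (ENNReal.ofReal p) volume
            ≤ ENNReal.ofReal K * eLpNorm f (ENNReal.ofReal p) volume) := by
  exact ⟨fun r hr => LambdaCantor.exists_eLpNorm_avg_le c₀ c₁ C hp hc₀ hr,
    fun η hη => LambdaCantor.exists_eLpNorm_sobolevAvg_le c₀ c₁ C hp hη,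
    fun N D μ hμ hD γ t hγ ht =>
      LambdaCantor.not_exists_eLpNorm_sobolevAvg_le (by linarith) hμ hD hγ ht⟩
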